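/- **Setting.** A tabular contextual MDP with context space $\mathcal C$ (a measurable space), $S$ states, $A$ actions, horizon $H\ge 1$ and fixed initial state $s^1$ is a model $M=\{P^h,R^h\}_{h=1}^H$ with $P^h(\cdot\mid s,a;c)\in\Delta(\mathcal S)$ and $R^h(s,a;c)\in\Delta([0,1])$, depending measurably on $c$. A policy is $\pi=(\pi^1,\dots,\pi^H)$ with $\pi^h:\mathcal S\to\Delta(\mathcal A)$. Write $M(\pi,c)$ for the law of the trajectory $(s^h,a^h,r^h)_{h\le H}$, $V_M(\pi,c)$ for the expected total reward, and $\mathrm{reg}_M(\pi,c)=\max_{\pi'}V_M(\pi',c)-V_M(\pi,c)$. Let $\mathcal M$ be a finite class of models containing the true model $M_\star$, whose total reward $\sum_h r^h$ is at most $1$ almost surely. In round $t=1,\dots,T$ a context $c_t\sim\mathcal D$ is drawn independently of the past, the learner picks a policy $\pi_t$, and a trajectory drawn from $M_\star(\pi_t,c_t)$ is observed. The regret is $\mathrm{Reg}(T)=\sum_{t=1}^T\mathbb E_t[\mathrm{reg}_{M_\star}(\pi_t,c_t)]$, where $\mathbb E_t$ is the conditional expectation given the information available before round $t$. **Algorithm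 (LOLIPOP with the maximum likelihood oracle and the doubling schedule).** Let $\tau_{-1}=\tau_0=0$ and $\tau_m=2^m$ for $m\ge1$. Epoch $m\ge1$ consists of $H$ consecutive segments of $\tau_m-\tau_{m-1}$ rounds each; the algorithm is stopped after $T$ rounds, and $N$ is the least integer $N\ge1$ with $T/H\le\tau_N$. Fix $\delta\in(0,1/2)$, a numerical constant $K>0$ and integers $\nu_m$ with $m\le\nu_m\le N$ for $1\le m\le N$ (for instance $\nu_m=N$, or $\nu_m=m$, which does not require knowledge of $T$). For $m\ge2$ set $$\mathcal E_m=\frac{K\log(2\nu_m^2|\mathcal M|/\delta)}{\tau_{m-1}-\tau_{m-2}},\quad \gamma_m=\sqrt{\frac{H^6S^4A^3}{\mathcal E_m}},\quad \eta_m=\frac{\gamma_m}{720\,e\,H^5S^3A^2},\quad \zeta_m=\frac{\gamma_m}{8\,e\,H(H+1)^2},$$ and $\gamma_1=\eta_1=\zeta_1=0$ (that is, $\mathcal E_1=\infty$). Let $\widehat M_0$ be any model with zero rewards. At the end of segment $h$ of epoch $m$ the oracle is called: it returns a maximizer over $M\in\mathcal M$ of the likelihood of the trajectories of this segment given their contexts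 and policies. The $h$-th layer of its output is the $h$-th layer $(\widehat P_m^h,\widehat R_m^h)$ of $\widehat M_m$. Write $\widehat{\mathrm{reg}}_{m-1}=\mathrm{reg}_{\widehat M_{m-1}}$. For each context $c$, let $\widetilde d_m^1(s;\pi,c)=\mathbb 1(s=s^1)$, $\widetilde d_m^h(s,a;\pi,c)=\widetilde d_m^h(s;\pi,c)\,\pi^h(s,a)$, $$\widetilde{\mathcal T}_m^h(c)=\Big\{(s,a,s'):\max_\pi\frac{\widetilde d_m^h(s,a;\pi,c)}{SA+\eta_m\widehat{\mathrm{reg}}_{m-1}(\pi,c)}\,\widehat P_m^h(s'\mid s,a;c)\ge\frac1{\zeta_m}\Big\},$$ $$\widetilde d_m^{h+1}(s;\pi,c)=\sum_{s',a':\,(s',a',s)\in\widetilde{\mathcal T}_m^h(c)}\widetilde d_m^h(s',a';\pi,c)\,\widehat P_m^h(s\mid s',a';c)$$ (with $1/\zeta_1=\infty$, so no transition is trusted in epoch $1$). In segment $h$ of epoch $m$, upon observing $c_t=c$, the learner forms the set $\Pi_m^h(c)$ consisting of a maximizer of $V_{\widehat M_{m-1}}(\cdot,c)$ and, for each $(s,a)$,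 a maximizer over $\pi$ of $\widetilde d_m^h(s,a;\pi,c)/(SA+\eta_m\widehat{\mathrm{reg}}_{m-1}(\pi,c))$. It then draws $\pi_t$ from the distribution on $\Pi_m^h(c)$ with weights $1/(\lambda+\eta_m\widehat{\mathrm{reg}}_{m-1}(\pi,c))$, where $\lambda>0$ normalizes the weights. Ties in all maximizations are broken arbitrarily (measurably, using the information available at that time). **Theorem.** For every $K>0$ there is a constant $B>0$, depending only on $K$, such that in every such setting, for every $T\ge2$ and every $\delta\in(0,1/2)$, with probability at least $1-\delta$, $$\mathrm{Reg}(T)\le B\sqrt{H^7S^4A^3\,T\,\log\!\big(|\mathcal M|\log T/\delta\big)},$$ and the number of oracle calls made within the $T$ rounds is finite and at most $B\,H\log T$. -/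

import Mathlib

open MeasureTheory ProbabilityTheory

namespace Lolipop

/-! ### Tabular contextual Markov decision processes

Layers, rounds and segments are numbered from `0`; epochs are numbered from `1`. -/

/-- A tabular contextual MDP with context space `C`, finite state space `S`, finite action space
`A` and `H` layers: `P h s a c` is the law of the next state and `R h s a c` the law of the reward,
a distribution on `[0,1]`, both depending measurably on the context. -/
structure CMDP (C S A : Type*) [MeasurableSpace C] [Fintype S] (H : ℕ) where
  P : Fin H → S → A → C → stdSimplex ℝ S
  P_meas : ∀ h s a, Measurable (P h s a)
  R : Fin H → S → A → Kernel C unitInterval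
  R_prob : ∀ h s a, IsMarkovKernel (R h s a)

/-- Randomized non-stationary policies. -/
abbrev Policy (S A : Type*) [Fintype A] (H : ℕ) : Type _ := Fin H → S → stdSimplex ℝ A

/-- Trajectories `(s¹, a¹, r¹, …, s^H, a^H, r^H)`. -/
abbrev Traj (S A : Type*) (H : ℕ) : Type _ := Fin H → S × A × unitInterval

section Model

variable {C S A : Type*} [MeasurableSpace C] [Fintype S] [Fintype A] {H : ℕ}

open Classical in
/-- The probability of arriving in the state of layer `h` of the path `x`, given the previous
state-action pair of the path; the first state is `s1`. -/
noncomputable def arrivalProb (M : CMDP C S A H) (s1 : S) (c : C) (x : Fin H → S × A)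
    (h : Fin H) : ℝ :=
  if (h : ℕ) = 0 then (if (x h).1 = s1 then 1 else 0)
  else
    let g : Fin H := ⟨h - 1, lt_of_le_of_lt (Nat.sub_le _ _) h.isLt⟩
    (M.P g (x g).1 (x g).2 c).1 (x h).1

/-- The probability of the state-action path `x` when `π` is run in `M` under the context `c`. -/
noncomputable def pathProb (M : CMDP C S A H) (s1 : S) (c : C) (π : Policy S A H)
    (x : Fin H → S × A) : ℝ :=
  ∏ h : Fin H, arrivalProb M s1 c x h * (π h (x h).1).1 (x h).2

/-- The law `M(π, c)` of the trajectory: the state-action path has probabilities `pathProb`, and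
given the path the rewards are independent with laws `R h (s h) (a h) c`. -/
noncomputable def trajLaw [MeasurableSpace S] [MeasurableSpace A]
    (M : CMDP C S A H) (s1 : S) (c : C) (π : Policy S A H) : Measure (Traj S A H) :=
  ∑ x : Fin H → S × A, ENNReal.ofReal (pathProb M s1 c π x) •
    (Measure.pi fun h => M.R h (x h).1 (x h).2 c).map fun r h => ((x h).1, (x h).2, r h)

/-- The value `V¹(π, c)`: the expected total reward of `π` in `M` under the context `c`. -/
noncomputable def value [MeasurableSpace S] [MeasurableSpace A]
    (M : CMDP C S A H) (s1 : S) (c : C) (π : Policy S A H) : ℝ :=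
  ∫ y, ∑ h, ((y h).2.2 : ℝ) ∂(trajLaw M s1 c π)

/-- The regret of `π` in `M` under the context `c`: the optimal value minus the value of `π`. -/
noncomputable def regret [MeasurableSpace S] [MeasurableSpace A]
    (M : CMDP C S A H) (s1 : S) (c : C) (π : Policy S A H) : ℝ :=
  (⨆ π' : Policy S A H, value M s1 c π') - value M s1 c π

/-- The model whose layer `h` is the layer `h` of the model `f h`. -/
def layerwise (f : Fin H → CMDP C S A H) : CMDP C S A H where
  P h := (f h).P h
  P_meas h := (f h).P_meas h
  R h := (f h).R h
  R_prob h := (f h).R_prob h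

/-! ### Maximum likelihood -/

/-- The density of the trajectory law `M(π, c)` at the trajectory `y`. The reward densities are
taken with respect to `∑ M' ∈ 𝓜, R_{M'}`, which dominates the reward laws of all models of `𝓜`;
states and actions have the counting measure. -/
noncomputable def density (𝓜 : Finset (CMDP C S A H)) (M : CMDP C S A H) (s1 : S) (c : C)
    (π : Policy S A H) (y : Traj S A H) : ENNReal :=
  ENNReal.ofReal (pathProb M s1 c π fun h => ((y h).1, (y h).2.1)) *
    ∏ h : Fin H, Kernel.rnDeriv (M.R h (y h).1 (y h).2.1)
      (∑ M' ∈ 𝓜, M'.R h (y h).1 (y h).2.1) c (y h).2.2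

/-- `M` is a maximum likelihood estimator over the class `𝓜` for the data `(c_t, π_t, y_t)`,
`t ∈ I`. -/
def IsMLE (𝓜 : Finset (CMDP C S A H)) (s1 : S) (I : Finset ℕ) (c : ℕ → C)
    (π : ℕ → Policy S A H) (y : ℕ → Traj S A H) (M : CMDP C S A H) : Prop :=
  M ∈ 𝓜 ∧ ∀ M' ∈ 𝓜,
    ∏ t ∈ I, density 𝓜 M' s1 (c t) (π t) (y t) ≤ ∏ t ∈ I, density 𝓜 M s1 (c t) (π t) (y t)

/-! ### Trusted transitions and trusted occupancy measures -/

/-- `π^h(s, a)`, with the layer given as a natural number. -/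
noncomputable def actProb (π : Policy S A H) (h : ℕ) (s : S) (a : A) : ℝ :=
  if hh : h < H then (π ⟨h, hh⟩ s).1 a else 0

/-- `P^h(s' | s, a; c)`, with the layer given as a natural number. -/
noncomputable def transProb (M : CMDP C S A H) (c : C) (h : ℕ) (s : S) (a : A) (s' : S) : ℝ :=
  if hh : h < H then (M.P ⟨h, hh⟩ s a c).1 s' else 0

/-- The ratio maximized by the policy cover: `d(s, a; π) / (S A + η reg(π))`, where `d π s` is
the (trusted) mass of the state `s` at layer `h`. -/
noncomputable def coverRatio (η : ℝ) (reg : Policy S A H → ℝ) (d : Policy S A H → S → ℝ) (h : ℕ)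
    (s : S) (a : A) (π : Policy S A H) : ℝ :=
  d π s * actProb π h s a / ((Fintype.card S : ℝ) * Fintype.card A + η * reg π)

/-- The trusted transitions at layer `h`: the triples `(s, a, s')` with
`max_π d(s, a; π) / (S A + η reg(π)) * P^h(s' | s, a) ≥ 1 / ζ`. The inequality is multiplied by
`ζ ≥ 0`, so that no transition is trusted when `ζ = 0` (that is, `1 / ζ = ∞`). -/
def trusted (η ζ : ℝ) (reg : Policy S A H → ℝ) (P : ℕ → S → A → S → ℝ)
    (d : Policy S A H → S → ℝ) (h : ℕ) : Set (S × A × S) :=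
  {q | 1 ≤ ζ * ((⨆ π : Policy S A H, coverRatio η reg d h q.1 q.2.1 π) * P h q.1 q.2.1 q.2.2)}

open Classical in
/-- The trusted occupancy measure `d̃^h(s; π)`. -/
noncomputable def trustedOcc (s1 : S) (η ζ : ℝ) (reg : Policy S A H → ℝ)
    (P : ℕ → S → A → S → ℝ) : ℕ → Policy S A H → S → ℝ
  | 0 => fun _ s => if s = s1 then 1 else 0
  | h + 1 => fun π s => ∑ s', ∑ a',
      if (s', a', s) ∈ trusted η ζ reg P (trustedOcc s1 η ζ reg P h) h
      then trustedOcc s1 η ζ reg P h π s' * actProb π h s' a' * P h s' a' s else 0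

end Model

/-! ### Schedule and parameters -/

/-- The epoch schedule: `τ₀ = 0` and `τ_m = 2 ^ m` for `m ≥ 1`. -/
def tau (m : ℕ) : ℕ := if m = 0 then 0 else 2 ^ m

/-- The first round of segment `h` of epoch `m ≥ 1`. -/
def segStart (H m h : ℕ) : ℕ := tau (m - 1) * H + (tau m - tau (m - 1)) * h

/-- The rounds of segment `h` of epoch `m ≥ 1`. -/
def segment (H m h : ℕ) : Finset ℕ := Finset.Ico (segStart H m h) (segStart H m (h + 1))

/-- The number of epochs started within `T` rounds: the least `N ≥ 1` with `T / H ≤ τ_N`. -/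
noncomputable def numEpochs (H T : ℕ) : ℕ := sInf {N | 1 ≤ N ∧ T ≤ tau N * H}

/-- The oracle calls made within `T` rounds: one call at the end of each completed segment. -/
def oracleCalls (H T : ℕ) : Set (ℕ × Fin H) :=
  {q | 1 ≤ q.1 ∧ segStart H q.1 (q.2 + 1) ≤ T}

/-- The rate `K log (|𝓜| / δ) / n` of the maximum likelihood oracle. -/
noncomputable def mleRate (K : ℝ) (card : ℕ) (δ : ℝ) (n : ℕ) : ℝ := K * Real.log (card / δ) / n

/-- `γ_m = √(H⁶ S⁴ A³ / 𝓔_m)`, where `𝓔_m` is the rate at confidence `δ / (2 ν²)` and sample size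
`τ_{m-1} - τ_{m-2}`. In epoch `1` the sample size is `0`, the rate is `∞`, and `γ₁ = 0`. -/
noncomputable def gammaParam (K δ : ℝ) (card H S A ν m : ℕ) : ℝ :=
  if m ≤ 1 then 0
  else Real.sqrt ((H : ℝ) ^ 6 * (S : ℝ) ^ 4 * (A : ℝ) ^ 3 /
    mleRate K card (δ / (2 * (ν : ℝ) ^ 2)) (tau (m - 1) - tau (m - 2)))

/-- `η_m = γ_m / (720 e H⁵ S³ A²)`. -/
noncomputable def etaParam (K δ : ℝ) (card H S A ν m : ℕ) : ℝ :=
  gammaParam K δ card H S A ν m /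
    (720 * Real.exp 1 * (H : ℝ) ^ 5 * (S : ℝ) ^ 3 * (A : ℝ) ^ 2)

/-- `ζ_m = γ_m / (8 e H (H + 1)²)`. -/
noncomputable def zetaParam (K δ : ℝ) (card H S A ν m : ℕ) : ℝ :=
  gammaParam K δ card H S A ν m / (8 * Real.exp 1 * (H : ℝ) * ((H : ℝ) + 1) ^ 2)

/-! ### Runs of the algorithm -/

/-- What is recorded in a run of the algorithm: the rounds `(c_t, π_t, y_t)`, the models
`est m h` returned by the oracle at the end of segment `h` of epoch `m`, and the quantities that
are chosen during epoch `m`: the greedy policy `greedy m` of the previous estimate, the covering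
policies `cover m h s a`, and the normalization `lam m h` of the inverse gap weighting. -/
structure RunData (Ω C S A : Type*) [MeasurableSpace C] [Fintype S] [Fintype A] (H : ℕ) where
  ctx : ℕ → Ω → C
  pol : ℕ → Ω → Policy S A H
  traj : ℕ → Ω → Traj S A H
  est : ℕ → Fin H → Ω → CMDP C S A H
  greedy : ℕ → Ω → C → Policy S A H
  cover : ℕ → Fin H → S → A → Ω → C → Policy S A H
  lam : ℕ → Fin H → Ω → C → ℝ

section Run

variable {Ω C S A : Type*} [MeasurableSpace C] [Fintype S] [Fintype A]
  [MeasurableSpace S] [MeasurableSpace A] {H : ℕ}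

/-- The estimated model `M̂_m`: the initial model for `m = 0`, and for `m ≥ 1` the model whose
layer `h` is the layer `h` of the oracle output of segment `h` of epoch `m`. -/
def RunData.estModel (X : RunData Ω C S A H) (M0 : CMDP C S A H) (m : ℕ) (ω : Ω) :
    CMDP C S A H :=
  if m = 0 then M0 else layerwise fun h => X.est m h ω

/-- The estimated regret that is used in epoch `m`, namely the regret in `M̂_{m-1}`. -/
noncomputable def RunData.regHat (X : RunData Ω C S A H) (M0 : CMDP C S A H) (s1 : S) (m : ℕ)
    (ω : Ω) (c : C) (π : Policy S A H) : ℝ :=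
  regret (X.estModel M0 (m - 1) ω) s1 c π

/-- The ratio `d̃_m^h(s, a; π, c) / (S A + η_m reg_{m-1}(π, c))`. Only the layers before `h` of
`M̂_m` enter. -/
noncomputable def RunData.ratio (X : RunData Ω C S A H) (M0 : CMDP C S A H) (s1 : S) (η ζ : ℝ)
    (m : ℕ) (h : Fin H) (s : S) (a : A) (ω : Ω) (c : C) (π : Policy S A H) : ℝ :=
  coverRatio η (X.regHat M0 s1 m ω c)
    (trustedOcc s1 η ζ (X.regHat M0 s1 m ω c) (transProb (X.estModel M0 m ω) c) h) h s a π

open Classical in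
/-- The policy cover: the greedy policy and the covering policies, as a set. -/
noncomputable def RunData.polCover (X : RunData Ω C S A H) (m : ℕ) (h : Fin H) (ω : Ω) (c : C) :
    Finset (Policy S A H) :=
  insert (X.greedy m ω c) (Finset.univ.image fun q : S × A => X.cover m h q.1 q.2 ω c)

/-- The weight `1 / (λ + η_m reg_{m-1}(π, c))` of the inverse gap weighting. -/
noncomputable def RunData.weight (X : RunData Ω C S A H) (M0 : CMDP C S A H) (s1 : S) (η : ℝ)
    (m : ℕ) (h : Fin H) (ω : Ω) (c : C) (π : Policy S A H) : ℝ :=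
  1 / (X.lam m h ω c + η * X.regHat M0 s1 m ω c π)

/-- The inverse gap weighting distribution `p_m^h(c)` on the policy cover. -/
noncomputable def RunData.igw (X : RunData Ω C S A H) (M0 : CMDP C S A H) (s1 : S) (η : ℝ)
    (m : ℕ) (h : Fin H) (ω : Ω) (c : C) : Measure (Policy S A H) :=
  ∑ π ∈ X.polCover m h ω c, ENNReal.ofReal (X.weight M0 s1 η m h ω c π) • Measure.dirac π

/-- `X` is a run of the first `T` rounds of the algorithm with the maximum likelihood oracle, in
the environment with context distribution `𝒟` and true model `Mstar`. The σ-algebra `ℱ t`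
describes what is known before round `t`. The parameters of epoch `m` are
`η m` and `ζ m`; ties in maximizations are broken arbitrarily, but measurably. -/
structure IsRun [mΩ : MeasurableSpace Ω] (μ : Measure Ω) (ℱ : Filtration ℕ mΩ) (𝒟 : Measure C)
    (s1 : S) (𝓜 : Finset (CMDP C S A H)) (Mstar M0 : CMDP C S A H) (η ζ : ℕ → ℝ) (T : ℕ)
    (X : RunData Ω C S A H) : Prop where
  /-- The rounds are observed. -/
  ctx_meas : ∀ t < T, Measurable[ℱ (t + 1)] (X.ctx t)
  pol_meas : ∀ t < T, Measurable[ℱ (t + 1)] (X.pol t)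
  traj_meas : ∀ t < T, Measurable[ℱ (t + 1)] (X.traj t)
  /-- At the end of a segment the oracle is called with the data of this segment. -/
  est_mle : ∀ m, 1 ≤ m → ∀ h : Fin H, segStart H m (h + 1) ≤ T → ∀ ω,
    IsMLE 𝓜 s1 (segment H m h) (fun t => X.ctx t ω) (fun t => X.pol t ω) (fun t => X.traj t ω)
      (X.est m h ω)
  est_meas : ∀ m, 1 ≤ m → ∀ h : Fin H, segStart H m (h + 1) ≤ T → ∀ M ∈ 𝓜,
    MeasurableSet[ℱ (segStart H m (h + 1))] {ω | X.est m h ω = M}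
  /-- The greedy policy is optimal in the previous estimate. -/
  greedy_max : ∀ m, 1 ≤ m → segStart H m 0 < T → ∀ ω c π,
    value (X.estModel M0 (m - 1) ω) s1 c π ≤
      value (X.estModel M0 (m - 1) ω) s1 c (X.greedy m ω c)
  greedy_meas : ∀ m, 1 ≤ m → segStart H m 0 < T →
    Measurable[(ℱ (segStart H m 0)).prod inferInstance] fun q : Ω × C => X.greedy m q.1 q.2
  /-- The covering policies maximize the ratio. -/
  cover_max : ∀ m, 1 ≤ m → ∀ h : Fin H, segStart H m h < T → ∀ s a ω c π,
    X.ratio M0 s1 (η m) (ζ m) m h s a ω c π ≤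
      X.ratio M0 s1 (η m) (ζ m) m h s a ω c (X.cover m h s a ω c)
  cover_meas : ∀ m, 1 ≤ m → ∀ h : Fin H, segStart H m h < T → ∀ s a,
    Measurable[(ℱ (segStart H m h)).prod inferInstance] fun q : Ω × C => X.cover m h s a q.1 q.2
  /-- `lam` normalizes the inverse gap weighting. -/
  lam_pos : ∀ m, 1 ≤ m → ∀ h : Fin H, segStart H m h < T → ∀ ω c, 0 < X.lam m h ω c
  lam_sum : ∀ m, 1 ≤ m → ∀ h : Fin H, segStart H m h < T → ∀ ω c,
    ∑ π ∈ X.polCover m h ω c, X.weight M0 s1 (η m) m h ω c π = 1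
  /-- In a round `t` of segment `h` of epoch `m`, given `ℱ t`, the context is drawn from `𝒟`, then
  the policy from the inverse gap weighting, then the trajectory from the true model. -/
  round_law : ∀ m, 1 ≤ m → ∀ h : Fin H, ∀ t ∈ segment H m h, t < T →
    ∀ B, MeasurableSet[ℱ t] B → ∀ f : C × Policy S A H × Traj S A H → ENNReal, Measurable f →
      ∫⁻ ω in B, f (X.ctx t ω, X.pol t ω, X.traj t ω) ∂μ =
        ∫⁻ ω in B, ∫⁻ c, ∫⁻ π, ∫⁻ y, f (c, π, y) ∂(trajLaw Mstar s1 c π)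
          ∂(X.igw M0 s1 (η m) m h ω c) ∂𝒟 ∂μ

end Run

end Lolipop

open Lolipop

/-!
The proof combines a likelihood bound for the oracle, a deterministic error bound for one epoch
under one context, and a recursion over the epochs.

*Likelihood.* Two models are compared through the Bhattacharyya affinity `aff` of their trajectory
laws. It bounds the conditional expectation of the square root of a likelihood ratio
(`lintegral_sqrt_likelihoodRatio_le`), so the sum over the class of the square roots of the
likelihood ratios of a segment, each compensated by the exponential of its accumulated loss of
affinity, has conditional expectation at most `|𝓜|`. Taking the product over the `H` segments of an
epoch and applying Markov's inequality once bounds the total loss of affinity of the `H` oracle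
outputs by `H log |𝓜| + log (1 / δ)` (`IsRun.measure_mle_failure_le`); no union bound over the
segments is needed, which would cost a factor `log H` inside the logarithm.

*One epoch, one context.* A loss of affinity of trajectories dominates the losses of affinity of
rewards and of transitions along the true occupancy measures. By the definition of trusted
transitions, the true transition probability at a trusted triple is at least `(1 - ε) ^ 2` times the
estimated one, so the trusted occupancy measures are at most four times the true ones, unless the
loss of affinity is so large that the claimed bound exceeds the trivial bound `H`. Inverse gap
weighting covers the trusted occupancy measure of every policy `π` up to the factor
`2 (S A + η reg π)`; a change of measure by Cauchy-Schwarz then gives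
`|V̂(π) - V(π)| ≤ reg π / 8 + (additive error)`, with the regret `reg` of the previous estimate
(`LayerCover.abs_value_sub_le`).

*Recursion.* Since only an eighth of the previous regret enters, the true and the estimated regret
agree up to a factor `2` and an additive `slack`, which contracts by a factor `3` per epoch up to
new errors (`IsRun.regret_le_and_regret_le`). The policies of an epoch have an estimated regret of
at most `2 S A / η` on average, so all errors of epoch `m` are of the order
`H⁶ S⁴ A³ / γ_m = √(H⁶ S⁴ A³ 𝓔_m)`, which decays like `2 ^ (-m / 2)`. Epoch `1`, and with it the
case of a single epoch, is covered by the trivial bound `H`, which is of the same order.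
A round `t` of epoch `m` has `t < 2 ^ m H`, so its regret is of the order `√(H / (t + 1))` times the
scale, and the sum over the rounds gives the bound.
-/

set_option linter.unusedSectionVars false

namespace Lolipop


/-! ### Path sums and forward recursions -/

section Chain

variable {Z : Type*}

/-- The weight of a path of length `n` of a (not necessarily stochastic) inhomogeneous chain with
initial weights `init` and transition weights `step`. -/
def chainWeight (init : Z → ℝ) (step : ℕ → Z → Z → ℝ) (n : ℕ) (x : Fin n → Z) : ℝ :=
  ∏ h : Fin n, if (h : ℕ) = 0 then init (x h)
    else step (h - 1) (x ⟨h - 1, lt_of_le_of_lt (Nat.sub_le _ _) h.isLt⟩) (x h)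

/-- The total weight of the paths that end in a given point, computed by the forward recursion. -/
def chainMass [Fintype Z] (init : Z → ℝ) (step : ℕ → Z → Z → ℝ) : ℕ → Z → ℝ
  | 0 => init
  | n + 1 => fun z' => ∑ z, chainMass init step n z * step n z z'

lemma chainWeight_snoc (init : Z → ℝ) (step : ℕ → Z → Z → ℝ) (n : ℕ) (x : Fin (n + 1) → Z)
    (z : Z) :
    chainWeight init step (n + 2) (Fin.snoc x z : Fin (n + 2) → Z) =
      chainWeight init step (n + 1) x * step n (x (Fin.last n)) z := by
  have key : ∀ (k : ℕ) (hk : k < n + 1),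
      (Fin.snoc x z : Fin (n + 2) → Z) ⟨k, by omega⟩ = x ⟨k, hk⟩ := by
    intro k hk
    exact Fin.snoc_castSucc (α := fun _ => Z) z x ⟨k, hk⟩
  unfold chainWeight
  rw [Fin.prod_univ_castSucc]
  congr 1
  · refine Finset.prod_congr rfl fun i _ => ?_
    have h1 := key i i.isLt
    have h2 := key (i - 1) (lt_of_le_of_lt (Nat.sub_le _ _) i.isLt)
    simp only [Fin.val_castSucc]
    rw [Fin.snoc_castSucc (α := fun _ => Z)]
    rw [h2]
  · simp only [Fin.val_last, Nat.add_eq_zero_iff, one_ne_zero, and_false, if_false]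
    rw [Fin.snoc_last (α := fun _ => Z)]
    exact congrArg (fun w => step n w z) (key n (by omega))

lemma sum_snoc [Fintype Z] (n : ℕ) (F : (Fin (n + 1) → Z) → ℝ) :
    ∑ x, F x = ∑ x : Fin n → Z, ∑ z, F (Fin.snoc x z : Fin (n + 1) → Z) := by
  rw [← (Fin.snocEquiv (fun _ : Fin (n + 1) => Z)).sum_comp, Fintype.sum_prod_type,
    Finset.sum_comm]
  rfl

lemma sum_chainWeight_last [Fintype Z] (init : Z → ℝ) (step : ℕ → Z → Z → ℝ) (n : ℕ)
    (g : Z → ℝ) :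
    ∑ x : Fin (n + 1) → Z, chainWeight init step (n + 1) x * g (x (Fin.last n)) =
      ∑ z, chainMass init step n z * g z := by
  induction n generalizing g with
  | zero =>
    rw [← (Equiv.funUnique (Fin 1) Z).symm.sum_comp]
    refine Finset.sum_congr rfl fun z _ => ?_
    simp [chainWeight, chainMass]
  | succ n ih =>
    rw [sum_snoc]
    have : ∀ x : Fin (n + 1) → Z, ∑ z, chainWeight init step (n + 1 + 1)
        (Fin.snoc x z : Fin (n + 2) → Z) * g ((Fin.snoc x z : Fin (n + 2) → Z) (Fin.last (n + 1)))
        = chainWeight init step (n + 1) x *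
          (fun w => ∑ z, step n w z * g z) (x (Fin.last n)) := by
      intro x
      rw [Finset.mul_sum]
      refine Finset.sum_congr rfl fun z _ => ?_
      rw [chainWeight_snoc, Fin.snoc_last (α := fun _ => Z)]
      ring
    rw [Finset.sum_congr rfl fun x _ => this x, ih fun w => ∑ z, step n w z * g z]
    simp only [chainMass, Finset.mul_sum, Finset.sum_mul]
    rw [Finset.sum_comm]
    refine Finset.sum_congr rfl fun z _ => Finset.sum_congr rfl fun w _ => by ring

/-- If the transitions from layer `h` on are stochastic, the later layers can be summed out. -/
lemma sum_chainWeight_apply [Fintype Z] (init : Z → ℝ) (step : ℕ → Z → Z → ℝ) (n h : ℕ)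
    (hh : h < n) (hs : ∀ j, h ≤ j → j + 1 < n → ∀ z, ∑ z', step j z z' = 1) (g : Z → ℝ) :
    ∑ x : Fin n → Z, chainWeight init step n x * g (x ⟨h, hh⟩) =
      ∑ z, chainMass init step h z * g z := by
  induction n with
  | zero => omega
  | succ n ih =>
    rcases Nat.lt_succ_iff_lt_or_eq.1 hh with h1 | rfl
    · obtain ⟨k, rfl⟩ : ∃ k, n = k + 1 := ⟨n - 1, by omega⟩
      rw [sum_snoc, ← ih h1 (fun j hj hj' => hs j hj (by omega))]
      refine Finset.sum_congr rfl fun x _ => ?_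
      have h3 : ∀ z, (Fin.snoc x z : Fin (k + 2) → Z) ⟨h, hh⟩ = x ⟨h, h1⟩ := fun z =>
        Fin.snoc_castSucc (α := fun _ => Z) z x ⟨h, h1⟩
      simp_rw [h3, chainWeight_snoc, ← Finset.sum_mul, ← Finset.mul_sum]
      rw [hs k (by omega) (by omega), mul_one]
    · exact sum_chainWeight_last init step h g

lemma chainMass_nonneg [Fintype Z] {init : Z → ℝ} {step : ℕ → Z → Z → ℝ} (hi : ∀ z, 0 ≤ init z)
    (hs : ∀ j z z', 0 ≤ step j z z') (n : ℕ) (z : Z) : 0 ≤ chainMass init step n z := by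
  induction n generalizing z with
  | zero => exact hi z
  | succ n ih => exact Finset.sum_nonneg fun w _ => mul_nonneg (ih w) (hs _ _ _)

end Chain

/-! ### Occupancy measures and values -/

section Occ

variable {C S A : Type*} [MeasurableSpace C] [Fintype S] [Fintype A] {H : ℕ}

lemma actProb_nonneg (π : Policy S A H) (h : ℕ) (s : S) (a : A) : 0 ≤ actProb π h s a := by
  unfold actProb; split_ifs
  · exact (π _ s).2.1 a
  · exact le_rfl

lemma sum_actProb (π : Policy S A H) {h : ℕ} (hh : h < H) (s : S) :
    ∑ a, actProb π h s a = 1 := by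
  simp only [actProb, dif_pos hh]; exact (π _ s).2.2

lemma sum_actProb_le (π : Policy S A H) (h : ℕ) (s : S) : ∑ a, actProb π h s a ≤ 1 := by
  by_cases hh : h < H
  · exact (sum_actProb π hh s).le
  · simp [actProb, hh]

lemma transProb_nonneg (M : CMDP C S A H) (c : C) (h : ℕ) (s : S) (a : A) (s' : S) :
    0 ≤ transProb M c h s a s' := by
  unfold transProb; split_ifs
  · exact (M.P _ s a c).2.1 s'
  · exact le_rfl

lemma sum_transProb (M : CMDP C S A H) (c : C) {h : ℕ} (hh : h < H) (s : S) (a : A) :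
    ∑ s', transProb M c h s a s' = 1 := by
  simp only [transProb, dif_pos hh]; exact (M.P _ s a c).2.2

lemma sum_transProb_le (M : CMDP C S A H) (c : C) (h : ℕ) (s : S) (a : A) :
    ∑ s', transProb M c h s a s' ≤ 1 := by
  by_cases hh : h < H
  · exact (sum_transProb M c hh s a).le
  · simp [transProb, hh]

open Classical in
/-- The occupancy measure `d^h(s; π, c)` of the states of layer `h` in the model `M`. -/
noncomputable def occ (M : CMDP C S A H) (s1 : S) (c : C) : ℕ → Policy S A H → S → ℝ
  | 0 => fun _ s => if s = s1 then 1 else 0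
  | h + 1 => fun π s => ∑ s', ∑ a', occ M s1 c h π s' * actProb π h s' a' * transProb M c h s' a' s

lemma occ_nonneg (M : CMDP C S A H) (s1 : S) (c : C) (h : ℕ) (π : Policy S A H) (s : S) :
    0 ≤ occ M s1 c h π s := by
  induction h generalizing s with
  | zero => simp only [occ]; split_ifs <;> norm_num
  | succ h ih =>
    exact Finset.sum_nonneg fun s' _ => Finset.sum_nonneg fun a' _ =>
      mul_nonneg (mul_nonneg (ih s') (actProb_nonneg _ _ _ _)) (transProb_nonneg _ _ _ _ _ _)

lemma sum_occ (M : CMDP C S A H) (s1 : S) (c : C) {h : ℕ} (hh : h ≤ H) (π : Policy S A H) :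
    ∑ s, occ M s1 c h π s = 1 := by
  induction h with
  | zero =>
    classical
    simp only [occ]
    rw [Finset.sum_ite_eq' Finset.univ s1 fun _ => (1 : ℝ), if_pos (Finset.mem_univ _)]
  | succ h ih =>
    simp only [occ]
    rw [Finset.sum_comm, ← ih (by omega)]
    refine Finset.sum_congr rfl fun s' _ => ?_
    rw [Finset.sum_comm]
    simp_rw [← Finset.mul_sum, sum_transProb M c (show h < H by omega), mul_one, ← Finset.mul_sum,
      sum_actProb π (show h < H by omega), mul_one]

open Classical in
lemma pathProb_eq_chainWeight (M : CMDP C S A H) (s1 : S) (c : C) (π : Policy S A H)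
    (x : Fin H → S × A) :
    pathProb M s1 c π x = chainWeight
      (fun z : S × A => (if z.1 = s1 then 1 else 0) * actProb π 0 z.1 z.2)
      (fun j z z' => transProb M c j z.1 z.2 z'.1 * actProb π (j + 1) z'.1 z'.2) H x := by
  unfold pathProb chainWeight
  refine Finset.prod_congr rfl fun h _ => ?_
  unfold arrivalProb
  by_cases h0 : (h : ℕ) = 0
  · simp only [h0, if_true]
    have : h = ⟨0, by have := h.isLt; omega⟩ := Fin.ext h0
    simp only [actProb]
    rw [dif_pos (by have := h.isLt; omega), ← this]
  · have h1 : (h : ℕ) - 1 < H := lt_of_le_of_lt (Nat.sub_le _ _) h.isLt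
    have h2 : (h : ℕ) - 1 + 1 = h := by omega
    simp only [h0, if_false, h2, actProb, transProb]
    rw [dif_pos h1, dif_pos h.isLt]

open Classical in
lemma chainMass_eq_occ (M : CMDP C S A H) (s1 : S) (c : C) (π : Policy S A H) (h : ℕ)
    (z : S × A) :
    chainMass (fun z : S × A => (if z.1 = s1 then 1 else 0) * actProb π 0 z.1 z.2)
      (fun j z z' => transProb M c j z.1 z.2 z'.1 * actProb π (j + 1) z'.1 z'.2) h z =
      occ M s1 c h π z.1 * actProb π h z.1 z.2 := by
  induction h generalizing z with
  | zero => rfl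
  | succ h ih =>
    simp only [chainMass, occ]
    simp_rw [ih, ← mul_assoc]
    rw [← Finset.sum_mul, Fintype.sum_prod_type]

lemma pathProb_nonneg (M : CMDP C S A H) (s1 : S) (c : C) (π : Policy S A H)
    (x : Fin H → S × A) : 0 ≤ pathProb M s1 c π x := by
  refine Finset.prod_nonneg fun h _ => mul_nonneg ?_ ((π h _).2.1 _)
  unfold arrivalProb
  split_ifs
  · norm_num
  · exact le_rfl
  · exact (M.P _ _ _ c).2.1 _

/-- The occupancy measure of layer `h` is the marginal of the path probabilities. -/
lemma sum_pathProb_mul (M : CMDP C S A H) (s1 : S) (c : C) (π : Policy S A H) (h : Fin H)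
    (g : S × A → ℝ) :
    ∑ x, pathProb M s1 c π x * g (x h) =
      ∑ s, ∑ a, occ M s1 c h π s * actProb π h s a * g (s, a) := by
  classical
  simp_rw [pathProb_eq_chainWeight]
  rw [sum_chainWeight_apply _ _ H h h.isLt, Fintype.sum_prod_type]
  · simp_rw [chainMass_eq_occ]
  · intro j _ hj z
    rw [Fintype.sum_prod_type]
    simp_rw [← Finset.mul_sum, sum_actProb π hj, mul_one]
    exact sum_transProb M c (by omega) _ _

lemma sum_pathProb (M : CMDP C S A H) (s1 : S) (c : C) (π : Policy S A H) (hH : 1 ≤ H) :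
    ∑ x, pathProb M s1 c π x = 1 := by
  have := sum_pathProb_mul M s1 c π ⟨0, hH⟩ (fun _ => 1)
  simp only [mul_one] at this
  rw [this]
  simp_rw [← Finset.mul_sum, sum_actProb π (show 0 < H from hH), mul_one]
  exact sum_occ M s1 c (by omega) π

/-- The expected reward of a state-action pair. -/
noncomputable def meanReward (M : CMDP C S A H) (h : Fin H) (s : S) (a : A) (c : C) : ℝ :=
  ∫ r : unitInterval, (r : ℝ) ∂(M.R h s a c)

lemma integrable_unitInterval (ρ : Measure unitInterval) [IsFiniteMeasure ρ] :
    Integrable (fun r : unitInterval => (r : ℝ)) ρ :=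
  Integrable.of_bound (C := 1) (by fun_prop)
    (Filter.Eventually.of_forall fun r => by
      rw [Real.norm_eq_abs, abs_of_nonneg r.2.1]; exact r.2.2)

lemma meanReward_nonneg (M : CMDP C S A H) (h : Fin H) (s : S) (a : A) (c : C) :
    0 ≤ meanReward M h s a c := integral_nonneg fun r => r.2.1

lemma meanReward_le_one (M : CMDP C S A H) (h : Fin H) (s : S) (a : A) (c : C) :
    meanReward M h s a c ≤ 1 := by
  have := M.R_prob h s a
  calc meanReward M h s a c ≤ ∫ _ : unitInterval, (1 : ℝ) ∂(M.R h s a c) :=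
        integral_mono (integrable_unitInterval _) (integrable_const _) fun r => r.2.2
    _ = 1 := by simp

lemma measurable_meanReward (M : CMDP C S A H) (h : Fin H) (s : S) (a : A) :
    Measurable (meanReward M h s a) := by
  have := M.R_prob h s a
  have h1 : StronglyMeasurable fun p : C × unitInterval => (p.2 : ℝ) :=
    (measurable_subtype_coe.comp measurable_snd).stronglyMeasurable
  exact (h1.integral_kernel_prod_right' (κ := M.R h s a)).measurable

variable [MeasurableSpace S] [MeasurableSpace A]

lemma measurable_rewardTraj (x : Fin H → S × A) :
    Measurable fun r : Fin H → unitInterval => fun h => ((x h).1, (x h).2, r h) := by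
  fun_prop

lemma lintegral_trajLaw (M : CMDP C S A H) (s1 : S) (c : C) (π : Policy S A H)
    {f : Traj S A H → ENNReal} (hf : Measurable f) :
    ∫⁻ y, f y ∂(trajLaw M s1 c π) = ∑ x, ENNReal.ofReal (pathProb M s1 c π x) *
      ∫⁻ r, f (fun h => ((x h).1, (x h).2, r h)) ∂(Measure.pi fun h => M.R h (x h).1 (x h).2 c) := by
  unfold trajLaw
  rw [lintegral_finsetSum_measure]
  refine Finset.sum_congr rfl fun x _ => ?_
  rw [lintegral_smul_measure, lintegral_map hf (measurable_rewardTraj x), smul_eq_mul]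

/-- The value is the average of the expected rewards over the occupancy measures. -/
lemma value_eq_sum_pathProb (M : CMDP C S A H) (s1 : S) (c : C) (π : Policy S A H) :
    value M s1 c π = ∑ x, pathProb M s1 c π x * ∑ h, meanReward M h (x h).1 (x h).2 c := by
  have hp := M.R_prob
  have hm : Measurable fun y : Traj S A H => ∑ h, ((y h).2.2 : ℝ) := by fun_prop
  have hb : ∀ y : Traj S A H, ‖∑ h, ((y h).2.2 : ℝ)‖ ≤ H := by
    intro y
    rw [Real.norm_eq_abs, abs_of_nonneg (Finset.sum_nonneg fun h _ => (y h).2.2.2.1)]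
    calc ∑ h, ((y h).2.2 : ℝ) ≤ ∑ _h : Fin H, (1 : ℝ) :=
          Finset.sum_le_sum fun h _ => (y h).2.2.2.2
      _ = H := by simp
  have hmp : ∀ x : Fin H → S × A, IsProbabilityMeasure
      ((Measure.pi fun h => M.R h (x h).1 (x h).2 c).map
        fun r h => ((x h).1, (x h).2, r h) : Measure (Traj S A H)) := fun x =>
    Measure.isProbabilityMeasure_map (measurable_rewardTraj x).aemeasurable
  unfold value trajLaw
  rw [integral_finsetSum_measure]
  · refine Finset.sum_congr rfl fun x _ => ?_
    rw [integral_smul_measure, ENNReal.toReal_ofReal (pathProb_nonneg _ _ _ _ _), smul_eq_mul,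
      integral_map (measurable_rewardTraj x).aemeasurable hm.aestronglyMeasurable]
    congr 1
    rw [integral_finsetSum]
    · refine Finset.sum_congr rfl fun h _ => ?_
      exact integral_comp_eval (μ := fun h => M.R h (x h).1 (x h).2 c) (i := h)
        (f := fun r : unitInterval => (r : ℝ)) (by fun_prop)
    · intro h _
      exact integrable_comp_eval (μ := fun h => M.R h (x h).1 (x h).2 c) (i := h)
        (f := fun r : unitInterval => (r : ℝ)) (integrable_unitInterval _)
  · intro x _
    refine Integrable.smul_measure ?_ ENNReal.ofReal_ne_top
    exact Integrable.of_bound hm.aestronglyMeasurable H (Filter.Eventually.of_forall hb)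

lemma value_eq_sum_occ (M : CMDP C S A H) (s1 : S) (c : C) (π : Policy S A H) :
    value M s1 c π = ∑ h : Fin H, ∑ s, ∑ a,
      occ M s1 c h π s * actProb π h s a * meanReward M h s a c := by
  rw [value_eq_sum_pathProb]
  simp_rw [Finset.mul_sum]
  rw [Finset.sum_comm]
  exact Finset.sum_congr rfl fun h _ =>
    sum_pathProb_mul M s1 c π h fun z => meanReward M h z.1 z.2 c

lemma value_nonneg (M : CMDP C S A H) (s1 : S) (c : C) (π : Policy S A H) :
    0 ≤ value M s1 c π := by
  rw [value_eq_sum_pathProb]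
  exact Finset.sum_nonneg fun x _ => mul_nonneg (pathProb_nonneg _ _ _ _ _)
    (Finset.sum_nonneg fun h _ => meanReward_nonneg _ _ _ _ _)

lemma value_le (M : CMDP C S A H) (s1 : S) (c : C) (π : Policy S A H) :
    value M s1 c π ≤ H := by
  rcases Nat.eq_zero_or_pos H with rfl | hH
  · rw [value_eq_sum_occ]; simp
  calc value M s1 c π ≤ ∑ x, pathProb M s1 c π x * ∑ _h : Fin H, (1 : ℝ) := by
        rw [value_eq_sum_pathProb]
        exact Finset.sum_le_sum fun x _ => mul_le_mul_of_nonneg_left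
          (Finset.sum_le_sum fun h _ => meanReward_le_one _ _ _ _ _) (pathProb_nonneg _ _ _ _ _)
    _ = H := by rw [← Finset.sum_mul, sum_pathProb _ _ _ _ hH]; simp

lemma continuous_pathProb (M : CMDP C S A H) (s1 : S) (c : C) (x : Fin H → S × A) :
    Continuous fun π : Policy S A H => pathProb M s1 c π x := by
  unfold pathProb
  refine continuous_finsetProd _ fun h _ => continuous_const.mul ?_
  exact (continuous_apply (x h).2).comp (continuous_subtype_val.comp
    ((continuous_apply (x h).1).comp (continuous_apply h)))

lemma continuous_value (M : CMDP C S A H) (s1 : S) (c : C) :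
    Continuous fun π : Policy S A H => value M s1 c π := by
  simp_rw [value_eq_sum_pathProb]
  exact continuous_finsetSum _ fun x _ => (continuous_pathProb M s1 c x).mul continuous_const

lemma measurable_arrivalProb (M : CMDP C S A H) (s1 : S) (x : Fin H → S × A) (h : Fin H) :
    Measurable fun c => arrivalProb M s1 c x h := by
  unfold arrivalProb
  split_ifs
  · exact measurable_const
  · exact measurable_const
  · exact (measurable_pi_apply _).comp (measurable_subtype_coe.comp (M.P_meas _ _ _))

lemma measurable_policy_apply (h : Fin H) (s : S) (a : A) :
    Measurable fun π : Policy S A H => (π h s).1 a :=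
  (measurable_pi_apply a).comp (measurable_subtype_coe.comp
    ((measurable_pi_apply s).comp (measurable_pi_apply h)))

lemma measurable_pathProb (M : CMDP C S A H) (s1 : S) (x : Fin H → S × A) :
    Measurable fun q : C × Policy S A H => pathProb M s1 q.1 q.2 x := by
  unfold pathProb
  refine Finset.measurable_prod _ fun h _ => ?_
  exact ((measurable_arrivalProb M s1 x h).comp measurable_fst).mul
    ((measurable_policy_apply h _ _).comp measurable_snd)

lemma measurable_value (M : CMDP C S A H) (s1 : S) :
    Measurable fun q : C × Policy S A H => value M s1 q.1 q.2 := by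
  simp_rw [value_eq_sum_pathProb]
  refine Finset.measurable_sum _ fun x _ => (measurable_pathProb M s1 x).mul ?_
  exact Finset.measurable_sum _ fun h _ => (measurable_meanReward M h _ _).comp measurable_fst

lemma bddAbove_value (M : CMDP C S A H) (s1 : S) (c : C) :
    BddAbove (Set.range fun π : Policy S A H => value M s1 c π) :=
  ⟨H, by rintro _ ⟨π, rfl⟩; exact value_le M s1 c π⟩

lemma regret_nonneg (M : CMDP C S A H) (s1 : S) (c : C) (π : Policy S A H) :
    0 ≤ regret M s1 c π :=
  sub_nonneg.2 (le_ciSup (bddAbove_value M s1 c) π)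

lemma regret_le (M : CMDP C S A H) (s1 : S) (c : C) (π : Policy S A H) :
    regret M s1 c π ≤ H := by
  have : Nonempty (Policy S A H) := ⟨π⟩
  have h1 := ciSup_le fun π' => value_le M s1 c π'
  have h2 := value_nonneg M s1 c π
  unfold regret; linarith

lemma regret_eq_of_forall_le (M : CMDP C S A H) (s1 : S) (c : C) {π₀ : Policy S A H}
    (h0 : ∀ π, value M s1 c π ≤ value M s1 c π₀) (π : Policy S A H) :
    regret M s1 c π = value M s1 c π₀ - value M s1 c π := by
  have : Nonempty (Policy S A H) := ⟨π⟩
  unfold regret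
  rw [le_antisymm (ciSup_le h0) (le_ciSup (bddAbove_value M s1 c) π₀)]

lemma exists_optimal [Nonempty A] (M : CMDP C S A H) (s1 : S) (c : C) :
    ∃ π₀ : Policy S A H, ∀ π, value M s1 c π ≤ value M s1 c π₀ := by
  obtain ⟨π₀, -, h⟩ := isCompact_univ.exists_isMaxOn Set.univ_nonempty
    (continuous_value M s1 c).continuousOn
  exact ⟨π₀, fun π => h (Set.mem_univ π)⟩

/-- By continuity, the optimal value is a supremum over a countable dense set of policies. -/
lemma iSup_value_eq_of_denseRange [Nonempty A] (M : CMDP C S A H) (s1 : S) (c : C)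
    {u : ℕ → Policy S A H} (hu : DenseRange u) :
    (⨆ π : Policy S A H, value M s1 c π) = ⨆ n, value M s1 c (u n) := by
  refine le_antisymm (ciSup_le fun π => ?_) (ciSup_le fun n => le_ciSup (bddAbove_value M s1 c) _)
  have hb : BddAbove (Set.range fun n => value M s1 c (u n)) :=
    ⟨H, by rintro _ ⟨n, rfl⟩; exact value_le M s1 c _⟩
  have hc : IsClosed {π : Policy S A H | value M s1 c π ≤ ⨆ n, value M s1 c (u n)} :=
    isClosed_le (continuous_value M s1 c) continuous_const
  exact hu.induction_on (p := fun π => value M s1 c π ≤ ⨆ n, value M s1 c (u n)) π hc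
    fun n => le_ciSup hb n

lemma measurable_value_left (M : CMDP C S A H) (s1 : S) (π : Policy S A H) :
    Measurable fun c => value M s1 c π := by
  simp_rw [value_eq_sum_pathProb]
  refine Finset.measurable_sum _ fun x _ => Measurable.mul ?_ ?_
  · unfold pathProb
    exact Finset.measurable_prod _ fun h _ => (measurable_arrivalProb M s1 x h).mul measurable_const
  · exact Finset.measurable_sum _ fun h _ => measurable_meanReward M h _ _

lemma measurable_regret [Nonempty A] (M : CMDP C S A H) (s1 : S) :
    Measurable fun q : C × Policy S A H => regret M s1 q.1 q.2 := by
  obtain ⟨u, hu⟩ := TopologicalSpace.exists_dense_seq (Policy S A H)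
  have h1 : Measurable fun c => ⨆ π : Policy S A H, value M s1 c π := by
    have : (fun c => ⨆ π : Policy S A H, value M s1 c π) = fun c => ⨆ n, value M s1 c (u n) :=
      funext fun c => iSup_value_eq_of_denseRange M s1 c hu
    rw [this]
    exact Measurable.iSup fun n => measurable_value_left M s1 (u n)
  have h2 : Measurable fun q : C × Policy S A H => ⨆ π : Policy S A H, value M s1 q.1 π :=
    h1.comp measurable_fst
  exact Measurable.sub h2 (measurable_value M s1)

end Occ

/-! ### Bhattacharyya affinities -/

lemma sq_le_eight_mul_of_forall {D b : ℝ} (h : ∀ κ : ℝ, 0 < κ → D * κ ≤ κ ^ 2 * b + 2)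
    (hD : 0 ≤ D) : D ^ 2 ≤ 8 * b := by
  have h1 : ∀ x : ℝ, 0 ≤ b * (x * x) + (-D) * x + 2 := by
    intro x
    rcases lt_or_ge 0 x with hx | hx
    · have := h x hx; nlinarith
    · have hb : 0 ≤ b := by
        by_contra hb
        push Not at hb
        have h2 := h (1 + 2 / (-b)) (by have : 0 < 2 / (-b) := by apply div_pos <;> linarith
                                        linarith)
        have h3 : 0 < -b := by linarith
        have h4 : 0 ≤ D * (1 + 2 / (-b)) := by positivity
        have h5 : (1 + 2 / (-b)) ^ 2 * b + 2 = b - 2 - 4 / (-b) := by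
          have : b ≠ 0 := hb.ne
          field_simp
          ring
        have : 0 ≤ 4 / (-b) := by positivity
        linarith
      nlinarith [mul_nonneg hb (mul_self_nonneg x), mul_nonneg hD (neg_nonneg.2 hx)]
  have := discrim_le_zero h1
  unfold discrim at this
  nlinarith

/-- Two laws on `[0,1]` with densities `f`, `g`: their affinity is at most one, and it controls the
difference of the means. -/
lemma affinity_le_one_and_sq_sub_integral_le (ρ : Measure unitInterval)
    {f g : unitInterval → ENNReal} (hf : Measurable f) (hg : Measurable g)
    [IsProbabilityMeasure (ρ.withDensity f)] [IsProbabilityMeasure (ρ.withDensity g)] :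
    ∫⁻ r, (f r / g r) ^ (1 / 2 : ℝ) ∂(ρ.withDensity g) ≤ 1 ∧
    (∫ r : unitInterval, (r : ℝ) ∂(ρ.withDensity f) -
      ∫ r : unitInterval, (r : ℝ) ∂(ρ.withDensity g)) ^ 2 ≤
      8 * (1 - (∫⁻ r, (f r / g r) ^ (1 / 2 : ℝ) ∂(ρ.withDensity g)).toReal) := by
  have hf1 : ∫⁻ r, f r ∂ρ = 1 := by
    have := measure_univ (μ := ρ.withDensity f)
    rwa [withDensity_apply _ MeasurableSet.univ, setLIntegral_univ] at this
  have hg1 : ∫⁻ r, g r ∂ρ = 1 := by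
    have := measure_univ (μ := ρ.withDensity g)
    rwa [withDensity_apply _ MeasurableSet.univ, setLIntegral_univ] at this
  have hft : ∀ᵐ r ∂ρ, f r < ⊤ := ae_lt_top hf (by rw [hf1]; simp)
  have hgt : ∀ᵐ r ∂ρ, g r < ⊤ := ae_lt_top hg (by rw [hg1]; simp)
  set p : unitInterval → ℝ := fun r => (f r).toReal with hp
  set q : unitInterval → ℝ := fun r => (g r).toReal with hq
  have hpi : Integrable p ρ := integrable_toReal_of_lintegral_ne_top hf.aemeasurable (by simp [hf1])
  have hqi : Integrable q ρ := integrable_toReal_of_lintegral_ne_top hg.aemeasurable (by simp [hg1])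
  have hp1 : ∫ r, p r ∂ρ = 1 := by rw [integral_toReal hf.aemeasurable hft, hf1]; simp
  have hq1 : ∫ r, q r ∂ρ = 1 := by rw [integral_toReal hg.aemeasurable hgt, hg1]; simp
  have hp0 : ∀ r, 0 ≤ p r := fun r => ENNReal.toReal_nonneg
  have hq0 : ∀ r, 0 ≤ q r := fun r => ENNReal.toReal_nonneg
  have hsm : Measurable fun r => Real.sqrt (p r * q r) :=
    (hf.ennreal_toReal.mul hg.ennreal_toReal).sqrt
  have hsle : ∀ r, Real.sqrt (p r * q r) ≤ (p r + q r) / 2 := fun r =>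
    Real.sqrt_le_iff.2 ⟨by have := hp0 r; have := hq0 r; positivity,
      by nlinarith [sq_nonneg (p r - q r)]⟩
  have hsi : Integrable (fun r => Real.sqrt (p r * q r)) ρ :=
    Integrable.mono' ((hpi.add hqi).div_const 2) hsm.aestronglyMeasurable
      (Filter.Eventually.of_forall fun r => by
        rw [Real.norm_of_nonneg (Real.sqrt_nonneg _)]; exact hsle r)
  have ha : ∫⁻ r, (f r / g r) ^ (1 / 2 : ℝ) ∂(ρ.withDensity g) =
      ENNReal.ofReal (∫ r, Real.sqrt (p r * q r) ∂ρ) := by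
    rw [lintegral_withDensity_eq_lintegral_mul _ hg (by fun_prop),
      ofReal_integral_eq_lintegral_ofReal hsi (Filter.Eventually.of_forall fun r =>
        Real.sqrt_nonneg _)]
    refine lintegral_congr_ae ?_
    filter_upwards [hft, hgt] with r h1 h2
    simp only [Pi.mul_apply]
    have e1 : f r = ENNReal.ofReal (p r) := (ENNReal.ofReal_toReal h1.ne).symm
    have e2 : g r = ENNReal.ofReal (q r) := (ENNReal.ofReal_toReal h2.ne).symm
    rw [e1, e2]
    rcases (hq0 r).eq_or_lt with h0 | h0
    · rw [← h0]; simp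
    · rw [← ENNReal.ofReal_div_of_pos h0, ENNReal.ofReal_rpow_of_nonneg
        (div_nonneg (hp0 r) h0.le) (by norm_num), ← ENNReal.ofReal_mul h0.le]
      congr 1
      rw [← Real.sqrt_eq_rpow, Real.sqrt_div (hp0 r), Real.sqrt_mul (hp0 r)]
      have := Real.mul_self_sqrt h0.le
      have h3 : Real.sqrt (q r) ≠ 0 := (Real.sqrt_pos.2 h0).ne'
      field_simp
      rw [Real.sq_sqrt h0.le, mul_comm]
  set a := ∫ r, Real.sqrt (p r * q r) ∂ρ with hadef
  have ha0 : 0 ≤ a := integral_nonneg fun r => Real.sqrt_nonneg _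
  have ha1 : a ≤ 1 := by
    calc a ≤ ∫ r, (p r + q r) / 2 ∂ρ := integral_mono hsi ((hpi.add hqi).div_const 2) hsle
      _ = 1 := by rw [integral_div, integral_add hpi hqi, hp1, hq1]; norm_num
  refine ⟨by rw [ha]; exact ENNReal.ofReal_le_one.2 ha1, ?_⟩
  rw [ha, ENNReal.toReal_ofReal ha0, ← sq_abs]
  refine sq_le_eight_mul_of_forall (fun κ hκ => ?_) (abs_nonneg _)
  have i1 : ∫ r : unitInterval, (r : ℝ) ∂(ρ.withDensity f) = ∫ r : unitInterval, p r * r ∂ρ := by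
    rw [integral_withDensity_eq_integral_toReal_smul hf hft]; rfl
  have i2 : ∫ r : unitInterval, (r : ℝ) ∂(ρ.withDensity g) = ∫ r : unitInterval, q r * r ∂ρ := by
    rw [integral_withDensity_eq_integral_toReal_smul hg hgt]; rfl
  have hbd : ∀ {w : unitInterval → ℝ}, Integrable w ρ →
      Integrable (fun r : unitInterval => w r * r) ρ := fun {w} hw =>
    hw.mul_bdd (c := 1) (by fun_prop) (Filter.Eventually.of_forall fun r => by
      rw [Real.norm_of_nonneg r.2.1]; exact r.2.2)
  rw [i1, i2, ← integral_sub (hbd hpi) (hbd hqi)]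
  have step : |∫ r : unitInterval, (p r * r - q r * r) ∂ρ| ≤
      ∫ r, (κ * (p r + q r - 2 * Real.sqrt (p r * q r)) +
        (p r + q r + 2 * Real.sqrt (p r * q r)) / κ) / 2 ∂ρ := by
    refine (abs_integral_le_integral_abs).trans (integral_mono ((hbd hpi).sub (hbd hqi)).abs ?_ ?_)
    · exact (((((hpi.add hqi).sub (hsi.const_mul 2)).const_mul κ).add
        (((hpi.add hqi).add (hsi.const_mul 2)).div_const κ)).div_const 2)
    · intro r
      have e1 := Real.sq_sqrt (hp0 r)
      have e2 := Real.sq_sqrt (hq0 r)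
      have e3 : Real.sqrt (p r * q r) = Real.sqrt (p r) * Real.sqrt (q r) := Real.sqrt_mul (hp0 r) _
      simp only [e3]
      set x := Real.sqrt (p r)
      set y := Real.sqrt (q r)
      have hx : 0 ≤ x := Real.sqrt_nonneg _
      have hy : 0 ≤ y := Real.sqrt_nonneg _
      rw [← e1, ← e2, ← sub_mul, abs_mul, abs_of_nonneg r.2.1]
      have h4 : |x ^ 2 - y ^ 2| * (r : ℝ) ≤ |x ^ 2 - y ^ 2| :=
        mul_le_of_le_one_right (abs_nonneg _) r.2.2
      refine h4.trans ?_
      rw [sq_sub_sq, abs_mul, abs_of_nonneg (by positivity : 0 ≤ x + y), le_div_iff₀ two_pos]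
      have h5 : κ * (x ^ 2 + y ^ 2 - 2 * (x * y)) + (x ^ 2 + y ^ 2 + 2 * (x * y)) / κ
          = κ * |x - y| ^ 2 + (x + y) ^ 2 / κ := by rw [sq_abs]; ring
      rw [h5]
      have h6 : κ * |x - y| ^ 2 + (x + y) ^ 2 / κ - (x + y) * |x - y| * 2 =
          (κ * |x - y| - (x + y)) ^ 2 / κ := by field_simp; ring
      have : 0 ≤ (κ * |x - y| - (x + y)) ^ 2 / κ := by positivity
      linarith
  have hint : ∫ r, (κ * (p r + q r - 2 * Real.sqrt (p r * q r)) +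
        (p r + q r + 2 * Real.sqrt (p r * q r)) / κ) / 2 ∂ρ =
      (κ * (2 - 2 * a) + (2 + 2 * a) / κ) / 2 := by
    have I1 : Integrable (fun r => (κ / 2 + 1 / (2 * κ)) * (p r + q r)) ρ :=
      (hpi.add hqi).const_mul _
    have I2 : Integrable (fun r => (1 / κ - κ) * Real.sqrt (p r * q r)) ρ := hsi.const_mul _
    calc _ = ∫ r, ((κ / 2 + 1 / (2 * κ)) * (p r + q r) +
          (1 / κ - κ) * Real.sqrt (p r * q r)) ∂ρ :=
          integral_congr_ae (Filter.Eventually.of_forall fun r => by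
            simp only; field_simp; ring)
      _ = _ := by
          rw [integral_add I1 I2, integral_const_mul, integral_const_mul, integral_add hpi hqi,
            hp1, hq1, ← hadef]
          field_simp; ring
  rw [hint] at step
  calc _ ≤ (κ * (2 - 2 * a) + (2 + 2 * a) / κ) / 2 * κ := mul_le_mul_of_nonneg_right step hκ.le
    _ = κ ^ 2 * (1 - a) + (1 + a) := by field_simp
    _ ≤ _ := by linarith

section Discrete

variable {S : Type*} [Fintype S] {p q : S → ℝ}

lemma sum_sqrt_mul_le_one (hp : ∀ s, 0 ≤ p s) (hq : ∀ s, 0 ≤ q s) (hp1 : ∑ s, p s ≤ 1)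
    (hq1 : ∑ s, q s ≤ 1) : ∑ s, Real.sqrt (p s * q s) ≤ 1 := by
  calc ∑ s, Real.sqrt (p s * q s) ≤ ∑ s, (p s + q s) / 2 := by
        refine Finset.sum_le_sum fun s _ => Real.sqrt_le_iff.2 ⟨?_, ?_⟩
        · have := hp s; have := hq s; positivity
        · nlinarith [sq_nonneg (p s - q s)]
    _ ≤ 1 := by rw [← Finset.sum_div, Finset.sum_add_distrib]; linarith

lemma sum_sq_sqrt_sub_sqrt (hp : ∀ s, 0 ≤ p s) (hq : ∀ s, 0 ≤ q s) (hp1 : ∑ s, p s = 1)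
    (hq1 : ∑ s, q s = 1) :
    ∑ s, (Real.sqrt (p s) - Real.sqrt (q s)) ^ 2 = 2 * (1 - ∑ s, Real.sqrt (p s * q s)) := by
  have : ∀ s, (Real.sqrt (p s) - Real.sqrt (q s)) ^ 2 = p s + q s - 2 * Real.sqrt (p s * q s) := by
    intro s
    rw [sub_sq, Real.sq_sqrt (hp s), Real.sq_sqrt (hq s), Real.sqrt_mul (hp s)]; ring
  simp_rw [this]
  rw [Finset.sum_sub_distrib, Finset.sum_add_distrib, ← Finset.mul_sum, hp1, hq1]; ring

lemma sq_sum_abs_sub_le (hp : ∀ s, 0 ≤ p s) (hq : ∀ s, 0 ≤ q s) (hp1 : ∑ s, p s = 1)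
    (hq1 : ∑ s, q s = 1) :
    (∑ s, |p s - q s|) ^ 2 ≤ 8 * (1 - ∑ s, Real.sqrt (p s * q s)) := by
  have h1 : ∀ s, |p s - q s| =
      |Real.sqrt (p s) - Real.sqrt (q s)| * (Real.sqrt (p s) + Real.sqrt (q s)) := by
    intro s
    rw [← abs_of_nonneg (by positivity : 0 ≤ Real.sqrt (p s) + Real.sqrt (q s)), ← abs_mul]
    congr 1
    nlinarith [Real.sq_sqrt (hp s), Real.sq_sqrt (hq s)]
  have h2 : ∑ s, (Real.sqrt (p s) + Real.sqrt (q s)) ^ 2 ≤ 4 := by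
    calc _ ≤ ∑ s, 2 * (p s + q s) := Finset.sum_le_sum fun s _ => by
          nlinarith [Real.sq_sqrt (hp s), Real.sq_sqrt (hq s),
            sq_nonneg (Real.sqrt (p s) - Real.sqrt (q s))]
      _ = 4 := by rw [← Finset.mul_sum, Finset.sum_add_distrib, hp1, hq1]; norm_num
  have h3 := sum_sq_sqrt_sub_sqrt hp hq hp1 hq1
  have h4 : 0 ≤ ∑ s, (Real.sqrt (p s) - Real.sqrt (q s)) ^ 2 :=
    Finset.sum_nonneg fun s _ => sq_nonneg _
  calc (∑ s, |p s - q s|) ^ 2 = (∑ s, |Real.sqrt (p s) - Real.sqrt (q s)| *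
        (Real.sqrt (p s) + Real.sqrt (q s))) ^ 2 := by simp_rw [h1]
    _ ≤ (∑ s, |Real.sqrt (p s) - Real.sqrt (q s)| ^ 2) *
        ∑ s, (Real.sqrt (p s) + Real.sqrt (q s)) ^ 2 := Finset.sum_mul_sq_le_sq_mul_sq _ _ _
    _ ≤ (∑ s, |Real.sqrt (p s) - Real.sqrt (q s)| ^ 2) * 4 := by
        refine mul_le_mul_of_nonneg_left h2 (Finset.sum_nonneg fun s _ => sq_nonneg _)
    _ = _ := by simp_rw [sq_abs]; rw [h3]; ring

end Discrete

section ChainAff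

variable {Z : Type*}

lemma sqrt_chainWeight_mul {i₁ i₂ : Z → ℝ} {t₁ t₂ : ℕ → Z → Z → ℝ} (h1 : ∀ z, 0 ≤ i₁ z)
    (h2 : ∀ z, 0 ≤ i₂ z) (h3 : ∀ j z z', 0 ≤ t₁ j z z') (h4 : ∀ j z z', 0 ≤ t₂ j z z') (n : ℕ)
    (x : Fin n → Z) :
    Real.sqrt (chainWeight i₁ t₁ n x * chainWeight i₂ t₂ n x) =
      chainWeight (fun z => Real.sqrt (i₁ z * i₂ z))
        (fun j z z' => Real.sqrt (t₁ j z z' * t₂ j z z')) n x := by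
  unfold chainWeight
  rw [← Finset.prod_mul_distrib, Real.sqrt_prod]
  · refine Finset.prod_congr rfl fun h _ => ?_
    split_ifs <;> rfl
  · intro h _
    split_ifs
    · exact mul_nonneg (h1 _) (h2 _)
    · exact mul_nonneg (h3 _ _ _) (h4 _ _ _)

/-- Cauchy-Schwarz along the forward recursion. -/
lemma chainMass_sqrt_le [Fintype Z] {i₁ i₂ : Z → ℝ} {t₁ t₂ : ℕ → Z → Z → ℝ}
    (h1 : ∀ z, 0 ≤ i₁ z) (h2 : ∀ z, 0 ≤ i₂ z) (h3 : ∀ j z z', 0 ≤ t₁ j z z')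
    (h4 : ∀ j z z', 0 ≤ t₂ j z z') (n : ℕ) (z : Z) :
    chainMass (fun z => Real.sqrt (i₁ z * i₂ z))
        (fun j z z' => Real.sqrt (t₁ j z z' * t₂ j z z')) n z ≤
      Real.sqrt (chainMass i₁ t₁ n z * chainMass i₂ t₂ n z) := by
  induction n generalizing z with
  | zero => exact le_rfl
  | succ n ih =>
    have n1 := chainMass_nonneg h1 h3 n
    have n2 := chainMass_nonneg h2 h4 n
    simp only [chainMass]
    calc _ ≤ ∑ w, Real.sqrt (chainMass i₁ t₁ n w * t₁ n w z) *
          Real.sqrt (chainMass i₂ t₂ n w * t₂ n w z) := by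
          refine Finset.sum_le_sum fun w _ => ?_
          rw [← Real.sqrt_mul (mul_nonneg (n1 w) (h3 _ _ _)), mul_mul_mul_comm,
            Real.sqrt_mul (mul_nonneg (n1 w) (n2 w))]
          exact mul_le_mul_of_nonneg_right (ih w) (Real.sqrt_nonneg _)
      _ ≤ _ := by
          rw [Real.sqrt_mul (Finset.sum_nonneg fun w _ => mul_nonneg (n1 w) (h3 _ _ _))]
          exact Real.sum_sqrt_mul_sqrt_le _ (fun w => mul_nonneg (n1 w) (h3 _ _ _))
            (fun w => mul_nonneg (n2 w) (h4 _ _ _))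

lemma sum_chainMass_antitone [Fintype Z] {i : Z → ℝ} {t : ℕ → Z → Z → ℝ} (hi : ∀ z, 0 ≤ i z)
    (ht : ∀ j z z', 0 ≤ t j z z') (hs : ∀ j z, ∑ z', t j z z' ≤ 1) {m n : ℕ} (hmn : m ≤ n) :
    ∑ z, chainMass i t n z ≤ ∑ z, chainMass i t m z := by
  induction n, hmn using Nat.le_induction with
  | base => exact le_rfl
  | succ n _ ih =>
    refine le_trans ?_ ih
    simp only [chainMass]
    rw [Finset.sum_comm]
    refine Finset.sum_le_sum fun z _ => ?_
    rw [← Finset.mul_sum]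
    exact mul_le_of_le_one_right (chainMass_nonneg hi ht n z) (hs n z)

end ChainAff

section Affinity

variable {C S A : Type*} [MeasurableSpace C] [Fintype S] [Fintype A] {H : ℕ}

instance (M : CMDP C S A H) (h : Fin H) (s : S) (a : A) : IsMarkovKernel (M.R h s a) :=
  M.R_prob h s a

/-- The reward density that enters the likelihood. -/
noncomputable def rewDens (𝓜 : Finset (CMDP C S A H)) (M : CMDP C S A H) (h : Fin H) (s : S)
    (a : A) (c : C) (r : unitInterval) : ENNReal :=
  Kernel.rnDeriv (M.R h s a) (∑ M' ∈ 𝓜, M'.R h s a) c r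

lemma isFiniteKernel_sum_R (𝓜 : Finset (CMDP C S A H)) (h : Fin H) (s : S) (a : A) :
    IsFiniteKernel (∑ M' ∈ 𝓜, M'.R h s a) := by
  classical
  induction 𝓜 using Finset.induction_on with
  | empty => rw [Finset.sum_empty]; infer_instance
  | insert M 𝓜 hM ih => rw [Finset.sum_insert hM]; infer_instance

lemma measurable_rewDens (𝓜 : Finset (CMDP C S A H)) (M : CMDP C S A H) (h : Fin H) (s : S)
    (a : A) : Measurable fun p : C × unitInterval => rewDens 𝓜 M h s a p.1 p.2 :=
  Kernel.measurable_rnDeriv _ _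

lemma measurable_rewDens_right (𝓜 : Finset (CMDP C S A H)) (M : CMDP C S A H) (h : Fin H) (s : S)
    (a : A) (c : C) : Measurable (rewDens 𝓜 M h s a c) :=
  Kernel.measurable_rnDeriv_right _ _ _

lemma withDensity_rewDens {𝓜 : Finset (CMDP C S A H)} {M : CMDP C S A H} (hM : M ∈ 𝓜) (h : Fin H)
    (s : S) (a : A) (c : C) :
    ((∑ M' ∈ 𝓜, M'.R h s a : Kernel C unitInterval) c).withDensity (rewDens 𝓜 M h s a c) =
      M.R h s a c := by
  have := isFiniteKernel_sum_R 𝓜 h s a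
  have hac : M.R h s a c ≪ (∑ M' ∈ 𝓜, M'.R h s a : Kernel C unitInterval) c := by
    refine Measure.absolutelyContinuous_of_le ?_
    rw [sum_apply]
    exact Finset.single_le_sum (f := fun M' : CMDP C S A H => M'.R h s a c)
      (fun _ _ => Measure.zero_le _) hM
  have h1 := Kernel.withDensity_rnDeriv_eq hac
  rw [Kernel.withDensity_apply _ (Kernel.measurable_rnDeriv _ _)] at h1
  exact h1

lemma ae_rewDens_ne {𝓜 : Finset (CMDP C S A H)} {M : CMDP C S A H} (hM : M ∈ 𝓜) (h : Fin H)
    (s : S) (a : A) (c : C) :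
    ∀ᵐ r ∂(M.R h s a c), rewDens 𝓜 M h s a c r ≠ 0 ∧ rewDens 𝓜 M h s a c r ≠ ⊤ := by
  have hm := measurable_rewDens_right 𝓜 M h s a c
  rw [← withDensity_rewDens hM h s a c, ae_withDensity_iff hm]
  have h1 : ∫⁻ r, rewDens 𝓜 M h s a c r
      ∂((∑ M' ∈ 𝓜, M'.R h s a : Kernel C unitInterval) c) ≠ ⊤ := by
    rw [← setLIntegral_univ, ← withDensity_apply _ MeasurableSet.univ, withDensity_rewDens hM]
    simp
  filter_upwards [ae_lt_top hm h1] with r hr h0 using ⟨h0, hr.ne⟩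

/-- The Bhattacharyya affinity of the reward laws of `M` and `Ms` at `(s, a)`. -/
noncomputable def rewAff (𝓜 : Finset (CMDP C S A H)) (M Ms : CMDP C S A H) (h : Fin H) (s : S)
    (a : A) (c : C) : ℝ :=
  (∫⁻ r, (rewDens 𝓜 M h s a c r / rewDens 𝓜 Ms h s a c r) ^ (1 / 2 : ℝ) ∂(Ms.R h s a c)).toReal

/-- The Bhattacharyya affinity of the transition laws of `M` and `Ms` at `(s, a)`. -/
noncomputable def transAff (M Ms : CMDP C S A H) (c : C) (h : ℕ) (s : S) (a : A) : ℝ :=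
  ∑ s', Real.sqrt (transProb M c h s a s' * transProb Ms c h s a s')

lemma transAff_nonneg (M Ms : CMDP C S A H) (c : C) (h : ℕ) (s : S) (a : A) :
    0 ≤ transAff M Ms c h s a := Finset.sum_nonneg fun _ _ => Real.sqrt_nonneg _

lemma transAff_le_one (M Ms : CMDP C S A H) (c : C) (h : ℕ) (s : S) (a : A) :
    transAff M Ms c h s a ≤ 1 :=
  sum_sqrt_mul_le_one (fun _ => transProb_nonneg _ _ _ _ _ _) (fun _ => transProb_nonneg _ _ _ _ _ _)
    (sum_transProb_le _ _ _ _ _) (sum_transProb_le _ _ _ _ _)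

variable {𝓜 : Finset (CMDP C S A H)} {M Ms : CMDP C S A H}

lemma lintegral_rewDens_le_one (hM : M ∈ 𝓜) (hMs : Ms ∈ 𝓜) (h : Fin H) (s : S) (a : A) (c : C) :
    ∫⁻ r, (rewDens 𝓜 M h s a c r / rewDens 𝓜 Ms h s a c r) ^ (1 / 2 : ℝ) ∂(Ms.R h s a c) ≤ 1 := by
  have e1 := withDensity_rewDens hM h s a c
  have e2 := withDensity_rewDens hMs h s a c
  have i1 : IsProbabilityMeasure (((∑ M' ∈ 𝓜, M'.R h s a : Kernel C unitInterval) c).withDensity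
    (rewDens 𝓜 M h s a c)) := by rw [e1]; infer_instance
  have i2 : IsProbabilityMeasure (((∑ M' ∈ 𝓜, M'.R h s a : Kernel C unitInterval) c).withDensity
    (rewDens 𝓜 Ms h s a c)) := by rw [e2]; infer_instance
  have := (affinity_le_one_and_sq_sub_integral_le
    ((∑ M' ∈ 𝓜, M'.R h s a : Kernel C unitInterval) c) (measurable_rewDens_right 𝓜 M h s a c)
    (measurable_rewDens_right 𝓜 Ms h s a c)).1
  rwa [e2] at this

lemma ofReal_rewAff (hM : M ∈ 𝓜) (hMs : Ms ∈ 𝓜) (h : Fin H) (s : S) (a : A) (c : C) :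
    ENNReal.ofReal (rewAff 𝓜 M Ms h s a c) =
      ∫⁻ r, (rewDens 𝓜 M h s a c r / rewDens 𝓜 Ms h s a c r) ^ (1 / 2 : ℝ) ∂(Ms.R h s a c) :=
  ENNReal.ofReal_toReal ((lintegral_rewDens_le_one hM hMs h s a c).trans_lt ENNReal.one_lt_top).ne

lemma rewAff_nonneg (h : Fin H) (s : S) (a : A) (c : C) : 0 ≤ rewAff 𝓜 M Ms h s a c :=
  ENNReal.toReal_nonneg

lemma rewAff_le_one (hM : M ∈ 𝓜) (hMs : Ms ∈ 𝓜) (h : Fin H) (s : S) (a : A) (c : C) :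
    rewAff 𝓜 M Ms h s a c ≤ 1 :=
  ENNReal.toReal_le_of_le_ofReal zero_le_one
    (by simpa using lintegral_rewDens_le_one hM hMs h s a c)

/-- The reward affinity controls the difference of the expected rewards. -/
lemma sq_meanReward_sub_le (hM : M ∈ 𝓜) (hMs : Ms ∈ 𝓜) (h : Fin H) (s : S) (a : A) (c : C) :
    (meanReward M h s a c - meanReward Ms h s a c) ^ 2 ≤ 8 * (1 - rewAff 𝓜 M Ms h s a c) := by
  have e1 := withDensity_rewDens hM h s a c
  have e2 := withDensity_rewDens hMs h s a c
  have i1 : IsProbabilityMeasure (((∑ M' ∈ 𝓜, M'.R h s a : Kernel C unitInterval) c).withDensity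
    (rewDens 𝓜 M h s a c)) := by rw [e1]; infer_instance
  have i2 : IsProbabilityMeasure (((∑ M' ∈ 𝓜, M'.R h s a : Kernel C unitInterval) c).withDensity
    (rewDens 𝓜 Ms h s a c)) := by rw [e2]; infer_instance
  have := (affinity_le_one_and_sq_sub_integral_le
    ((∑ M' ∈ 𝓜, M'.R h s a : Kernel C unitInterval) c) (measurable_rewDens_right 𝓜 M h s a c)
    (measurable_rewDens_right 𝓜 Ms h s a c)).2
  rwa [e1, e2] at this

lemma measurable_rewAff (h : Fin H) (s : S) (a : A) : Measurable (rewAff 𝓜 M Ms h s a) := by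
  refine Measurable.ennreal_toReal ?_
  exact Measurable.lintegral_kernel_prod_right' (κ := Ms.R h s a)
    (f := fun p : C × unitInterval =>
      (rewDens 𝓜 M h s a p.1 p.2 / rewDens 𝓜 Ms h s a p.1 p.2) ^ (1 / 2 : ℝ))
    (((measurable_rewDens 𝓜 M h s a).div (measurable_rewDens 𝓜 Ms h s a)).pow_const _)

/-- The Bhattacharyya affinity of the trajectory laws of `M` and `Ms`. -/
noncomputable def aff (𝓜 : Finset (CMDP C S A H)) (M Ms : CMDP C S A H) (s1 : S) (c : C)
    (π : Policy S A H) : ℝ :=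
  ∑ x, Real.sqrt (pathProb M s1 c π x * pathProb Ms s1 c π x) *
    ∏ h, rewAff 𝓜 M Ms h (x h).1 (x h).2 c

lemma aff_nonneg (s1 : S) (c : C) (π : Policy S A H) : 0 ≤ aff 𝓜 M Ms s1 c π :=
  Finset.sum_nonneg fun _ _ => mul_nonneg (Real.sqrt_nonneg _)
    (Finset.prod_nonneg fun _ _ => rewAff_nonneg _ _ _ _)

lemma aff_le_sum_sqrt (hM : M ∈ 𝓜) (hMs : Ms ∈ 𝓜) (s1 : S) (c : C) (π : Policy S A H) :
    aff 𝓜 M Ms s1 c π ≤ ∑ x, Real.sqrt (pathProb M s1 c π x * pathProb Ms s1 c π x) :=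
  Finset.sum_le_sum fun _ _ => mul_le_of_le_one_right (Real.sqrt_nonneg _)
    (Finset.prod_le_one (fun _ _ => rewAff_nonneg _ _ _ _) fun _ _ => rewAff_le_one hM hMs _ _ _ _)

lemma aff_le_one (hM : M ∈ 𝓜) (hMs : Ms ∈ 𝓜) (hH : 1 ≤ H) (s1 : S) (c : C) (π : Policy S A H) :
    aff 𝓜 M Ms s1 c π ≤ 1 :=
  (aff_le_sum_sqrt hM hMs s1 c π).trans
    (sum_sqrt_mul_le_one (fun _ => pathProb_nonneg _ _ _ _ _) (fun _ => pathProb_nonneg _ _ _ _ _)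
      (sum_pathProb _ _ _ _ hH).le (sum_pathProb _ _ _ _ hH).le)

/-- The trajectory affinity controls the reward affinities along the occupancy measure of `Ms`. -/
lemma sum_occ_mul_one_sub_rewAff_le (hM : M ∈ 𝓜) (hMs : Ms ∈ 𝓜) (s1 : S) (c : C)
    (π : Policy S A H) (h : Fin H) :
    ∑ s, ∑ a, occ Ms s1 c h π s * actProb π h s a * (1 - rewAff 𝓜 M Ms h s a c) ≤
      2 * (1 - aff 𝓜 M Ms s1 c π) := by
  have hH : 1 ≤ H := by have := h.isLt; omega
  rw [← sum_pathProb_mul Ms s1 c π h fun z => 1 - rewAff 𝓜 M Ms h z.1 z.2 c]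
  have key : ∀ x, Real.sqrt (pathProb M s1 c π x * pathProb Ms s1 c π x) *
      ∏ h, rewAff 𝓜 M Ms h (x h).1 (x h).2 c ≤ (pathProb M s1 c π x + pathProb Ms s1 c π x -
        pathProb Ms s1 c π x * (1 - rewAff 𝓜 M Ms h (x h).1 (x h).2 c)) / 2 := by
    intro x
    have p0 := pathProb_nonneg M s1 c π x
    have q0 := pathProb_nonneg Ms s1 c π x
    have b0 := rewAff_nonneg (𝓜 := 𝓜) (M := M) (Ms := Ms) h (x h).1 (x h).2 c
    have b1 := rewAff_le_one hM hMs h (x h).1 (x h).2 c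
    have hprod : ∏ h, rewAff 𝓜 M Ms h (x h).1 (x h).2 c ≤ rewAff 𝓜 M Ms h (x h).1 (x h).2 c := by
      rw [← Finset.mul_prod_erase Finset.univ _ (Finset.mem_univ h)]
      exact mul_le_of_le_one_right b0 (Finset.prod_le_one (fun _ _ => rewAff_nonneg _ _ _ _)
        fun _ _ => rewAff_le_one hM hMs _ _ _ _)
    refine (mul_le_mul_of_nonneg_left hprod (Real.sqrt_nonneg _)).trans ?_
    rw [Real.sqrt_mul p0]
    set b := rewAff 𝓜 M Ms h (x h).1 (x h).2 c
    have e1 := Real.sq_sqrt p0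
    have e2 := Real.sq_sqrt q0
    set u := Real.sqrt (pathProb M s1 c π x)
    set v := Real.sqrt (pathProb Ms s1 c π x)
    rw [← e1, ← e2]
    have : v ^ 2 * b ^ 2 ≤ v ^ 2 * b :=
      mul_le_mul_of_nonneg_left (by nlinarith) (sq_nonneg v)
    nlinarith [sq_nonneg (u - v * b)]
  have := Finset.sum_le_sum fun x (_ : x ∈ Finset.univ) => key x
  rw [← Finset.sum_div, Finset.sum_sub_distrib, Finset.sum_add_distrib, sum_pathProb _ _ _ _ hH,
    sum_pathProb _ _ _ _ hH] at this
  unfold aff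
  linarith

/-- The trajectory affinity controls the transition affinities along the occupancy measure of
`Ms`. -/
lemma sum_occ_mul_one_sub_transAff_le (hM : M ∈ 𝓜) (hMs : Ms ∈ 𝓜) (s1 : S) (c : C)
    (π : Policy S A H) {h : ℕ} (hh : h + 1 < H) :
    ∑ s, ∑ a, occ Ms s1 c h π s * actProb π h s a * (1 - transAff M Ms c h s a) ≤
      2 * (1 - aff 𝓜 M Ms s1 c π) := by
  classical
  obtain ⟨n, rfl⟩ : ∃ n, H = n + 1 := ⟨H - 1, by omega⟩
  set i : S × A → ℝ := fun z => (if z.1 = s1 then 1 else 0) * actProb π 0 z.1 z.2 with hi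
  set t : CMDP C S A (n + 1) → ℕ → S × A → S × A → ℝ := fun M j z z' =>
    transProb M c j z.1 z.2 z'.1 * actProb π (j + 1) z'.1 z'.2 with ht
  have i0 : ∀ z, 0 ≤ i z := fun z => mul_nonneg (by split_ifs <;> norm_num) (actProb_nonneg _ _ _ _)
  have t0 : ∀ M j z z', 0 ≤ t M j z z' := fun M j z z' =>
    mul_nonneg (transProb_nonneg _ _ _ _ _ _) (actProb_nonneg _ _ _ _)
  set u := chainMass (fun z => Real.sqrt (i z * i z))
    (fun j z z' => Real.sqrt (t M j z z' * t Ms j z z')) with hu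
  have hrow : ∀ j z, ∑ z', Real.sqrt (t M j z z' * t Ms j z z') ≤ transAff M Ms c j z.1 z.2 := by
    intro j z
    rw [Fintype.sum_prod_type]
    refine Finset.sum_le_sum fun s' _ => ?_
    have : ∀ a', Real.sqrt (t M j z (s', a') * t Ms j z (s', a')) =
        Real.sqrt (transProb M c j z.1 z.2 s' * transProb Ms c j z.1 z.2 s') *
          actProb π (j + 1) s' a' := by
      intro a'
      simp only [ht]
      rw [mul_mul_mul_comm, Real.sqrt_mul (mul_nonneg (transProb_nonneg _ _ _ _ _ _)
        (transProb_nonneg _ _ _ _ _ _)), Real.sqrt_mul_self (actProb_nonneg _ _ _ _)]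
    simp_rw [this, ← Finset.mul_sum]
    exact mul_le_of_le_one_right (Real.sqrt_nonneg _) (sum_actProb_le _ _ _)
  have u0 : ∀ m z, 0 ≤ u m z := fun m z =>
    chainMass_nonneg (fun _ => Real.sqrt_nonneg _) (fun _ _ _ => Real.sqrt_nonneg _) m z
  have h1 : aff 𝓜 M Ms s1 c π ≤ ∑ z, u n z := by
    refine (aff_le_sum_sqrt hM hMs s1 c π).trans (le_of_eq ?_)
    have := sum_chainWeight_last (fun z => Real.sqrt (i z * i z))
      (fun j z z' => Real.sqrt (t M j z z' * t Ms j z z')) n (fun _ => 1)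
    simp only [mul_one] at this
    rw [← hu] at this
    rw [← this]
    refine Finset.sum_congr rfl fun x _ => ?_
    rw [pathProb_eq_chainWeight, pathProb_eq_chainWeight]
    exact sqrt_chainWeight_mul i0 i0 (t0 M) (t0 Ms) (n + 1) x
  have h2 : ∑ z, u n z ≤ ∑ z, u (h + 1) z :=
    sum_chainMass_antitone (fun _ => Real.sqrt_nonneg _) (fun _ _ _ => Real.sqrt_nonneg _)
      (fun j z => (hrow j z).trans (transAff_le_one _ _ _ _ _ _)) (by omega)
  have h3 : ∑ z, u (h + 1) z ≤ ∑ z, u h z * transAff M Ms c h z.1 z.2 := by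
    simp only [hu, chainMass]
    rw [Finset.sum_comm]
    refine Finset.sum_le_sum fun z _ => ?_
    rw [← Finset.mul_sum]
    exact mul_le_mul_of_nonneg_left (hrow h z) (u0 h z)
  have h4 : ∀ z, u h z * transAff M Ms c h z.1 z.2 ≤
      (occ M s1 c h π z.1 * actProb π h z.1 z.2 + occ Ms s1 c h π z.1 * actProb π h z.1 z.2 -
        occ Ms s1 c h π z.1 * actProb π h z.1 z.2 * (1 - transAff M Ms c h z.1 z.2)) / 2 := by
    intro z
    have h5 := chainMass_sqrt_le i0 i0 (t0 M) (t0 Ms) h z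
    rw [chainMass_eq_occ M s1 c π h z, chainMass_eq_occ Ms s1 c π h z] at h5
    have p0 : 0 ≤ occ M s1 c h π z.1 * actProb π h z.1 z.2 :=
      mul_nonneg (occ_nonneg _ _ _ _ _ _) (actProb_nonneg _ _ _ _)
    have q0 : 0 ≤ occ Ms s1 c h π z.1 * actProb π h z.1 z.2 :=
      mul_nonneg (occ_nonneg _ _ _ _ _ _) (actProb_nonneg _ _ _ _)
    have b0 := transAff_nonneg M Ms c h z.1 z.2
    have b1 := transAff_le_one M Ms c h z.1 z.2
    refine (mul_le_mul_of_nonneg_right h5 b0).trans ?_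
    rw [Real.sqrt_mul p0]
    set b := transAff M Ms c h z.1 z.2
    have e1 := Real.sq_sqrt p0
    have e2 := Real.sq_sqrt q0
    set v := Real.sqrt (occ M s1 c h π z.1 * actProb π h z.1 z.2)
    set w := Real.sqrt (occ Ms s1 c h π z.1 * actProb π h z.1 z.2)
    rw [← e1, ← e2]
    have : w ^ 2 * b ^ 2 ≤ w ^ 2 * b :=
      mul_le_mul_of_nonneg_left (by nlinarith) (sq_nonneg w)
    nlinarith [sq_nonneg (v - w * b)]
  have hone : ∀ M : CMDP C S A (n + 1),
      ∑ z : S × A, occ M s1 c h π z.1 * actProb π h z.1 z.2 = 1 := by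
    intro M
    rw [Fintype.sum_prod_type]
    simp_rw [← Finset.mul_sum, sum_actProb π (show h < n + 1 by omega), mul_one]
    exact sum_occ M s1 c (by omega) π
  have h6 := Finset.sum_le_sum fun z (_ : z ∈ Finset.univ) => h4 z
  rw [← Finset.sum_div, Finset.sum_sub_distrib, Finset.sum_add_distrib, hone, hone] at h6
  rw [← Fintype.sum_prod_type (f := fun z : S × A => occ Ms s1 c h π z.1 * actProb π h z.1 z.2 *
    (1 - transAff M Ms c h z.1 z.2))]
  linarith

variable [MeasurableSpace S] [MeasurableSpace A]

lemma measurable_aff (s1 : S) :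
    Measurable fun q : C × Policy S A H => aff 𝓜 M Ms s1 q.1 q.2 := by
  unfold aff
  refine Finset.measurable_sum _ fun x _ => Measurable.mul ?_ ?_
  · exact ((measurable_pathProb M s1 x).mul (measurable_pathProb Ms s1 x)).sqrt
  · exact Finset.measurable_prod _ fun h _ => (measurable_rewAff h _ _).comp measurable_fst

lemma density_eq (M : CMDP C S A H) (s1 : S) (c : C) (π : Policy S A H) (y : Traj S A H) :
    density 𝓜 M s1 c π y = ENNReal.ofReal (pathProb M s1 c π fun h => ((y h).1, (y h).2.1)) *
      ∏ h : Fin H, rewDens 𝓜 M h (y h).1 (y h).2.1 c (y h).2.2 := rfl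

variable [MeasurableSingletonClass S] [MeasurableSingletonClass A]

lemma measurable_density (M : CMDP C S A H) (s1 : S) :
    Measurable fun q : C × Policy S A H × Traj S A H => density 𝓜 M s1 q.1 q.2.1 q.2.2 := by
  let G : (Fin H → S × A) → C × Policy S A H × Traj S A H → ENNReal := fun x q =>
    ENNReal.ofReal (pathProb M s1 q.1 q.2.1 x) *
      ∏ h : Fin H, rewDens 𝓜 M h (x h).1 (x h).2 q.1 (q.2.2 h).2.2
  have hG : ∀ x, Measurable (G x) := by
    intro x
    refine Measurable.mul (Measurable.ennreal_ofReal ?_) (Finset.measurable_prod _ fun h _ => ?_)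
    · have h1 : Measurable fun q : C × Policy S A H × Traj S A H => (q.1, q.2.1) := by fun_prop
      exact ((measurable_pathProb M s1 x).comp h1 :)
    · have h1 : Measurable fun q : C × Policy S A H × Traj S A H => (q.1, (q.2.2 h).2.2) := by
        fun_prop
      exact ((measurable_rewDens 𝓜 M h (x h).1 (x h).2).comp h1 :)
  have hp : Measurable fun q : C × Policy S A H × Traj S A H =>
      ((fun h => ((q.2.2 h).1, (q.2.2 h).2.1), q) :
        (Fin H → S × A) × (C × Policy S A H × Traj S A H)) := by fun_prop
  exact ((measurable_from_prod_countable_right (f := fun z : (Fin H → S × A) ×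
    (C × Policy S A H × Traj S A H) => G z.1 z.2) hG).comp hp :)

lemma ae_pi_rewDens_ne (hMs : Ms ∈ 𝓜) (c : C) (x : Fin H → S × A) :
    ∀ᵐ r ∂(Measure.pi fun h => Ms.R h (x h).1 (x h).2 c), ∀ h,
      rewDens 𝓜 Ms h (x h).1 (x h).2 c (r h) ≠ 0 ∧ rewDens 𝓜 Ms h (x h).1 (x h).2 c (r h) ≠ ⊤ := by
  rw [ae_all_iff]
  intro h
  exact (measurePreserving_eval (fun h => Ms.R h (x h).1 (x h).2 c) h).quasiMeasurePreserving.ae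
    (ae_rewDens_ne hMs h (x h).1 (x h).2 c)

/-- The likelihood of a trajectory drawn from the model is neither zero nor infinite. -/
lemma lintegral_density_eq_zero_or_top (hMs : Ms ∈ 𝓜) (s1 : S) (c : C) (π : Policy S A H) :
    ∫⁻ y, ({y | density 𝓜 Ms s1 c π y = 0 ∨ density 𝓜 Ms s1 c π y = ⊤}.indicator 1 y)
      ∂(trajLaw Ms s1 c π) = 0 := by
  have hm : Measurable fun y => density 𝓜 Ms s1 c π y := by
    have h1 : Measurable fun y : Traj S A H => (c, π, y) := by fun_prop
    exact ((measurable_density Ms s1).comp h1 :)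
  have hs : MeasurableSet {y | density 𝓜 Ms s1 c π y = 0 ∨ density 𝓜 Ms s1 c π y = ⊤} :=
    (hm (measurableSet_singleton 0)).union (hm (measurableSet_singleton ⊤))
  rw [lintegral_trajLaw Ms s1 c π (measurable_one.indicator hs)]
  refine Finset.sum_eq_zero fun x _ => ?_
  rcases (pathProb_nonneg Ms s1 c π x).eq_or_lt with h0 | h0
  · rw [← h0]; simp
  · refine mul_eq_zero_of_right _ ?_
    refine (lintegral_congr_ae (g := fun _ => 0) ?_).trans lintegral_zero
    filter_upwards [ae_pi_rewDens_ne hMs c x] with r hr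
    refine Set.indicator_of_notMem ?_ _
    rw [Set.mem_ofPred_eq, not_or, density_eq]
    refine ⟨mul_ne_zero (by simpa using h0) (Finset.prod_ne_zero_iff.2 fun h _ => (hr h).1),
      ENNReal.mul_ne_top ENNReal.ofReal_ne_top (ENNReal.prod_ne_top fun h _ => (hr h).2)⟩

/-- The expected square root of the likelihood ratio is at most the affinity. -/
lemma lintegral_sqrt_likelihoodRatio_le (hM : M ∈ 𝓜) (hMs : Ms ∈ 𝓜) (s1 : S) (c : C)
    (π : Policy S A H) :
    ∫⁻ y, (density 𝓜 M s1 c π y / density 𝓜 Ms s1 c π y) ^ (1 / 2 : ℝ) ∂(trajLaw Ms s1 c π) ≤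
      ENNReal.ofReal (aff 𝓜 M Ms s1 c π) := by
  have hm : ∀ M, Measurable fun y => density 𝓜 M s1 c π y := by
    intro M
    have h1 : Measurable fun y : Traj S A H => (c, π, y) := by fun_prop
    exact ((measurable_density M s1).comp h1 :)
  have hmm : Measurable fun y => (density 𝓜 M s1 c π y / density 𝓜 Ms s1 c π y) ^ (1 / 2 : ℝ) :=
    ((hm M).div (hm Ms)).pow_const _
  rw [lintegral_trajLaw Ms s1 c π hmm]
  unfold aff
  rw [ENNReal.ofReal_sum_of_nonneg fun x _ => mul_nonneg (Real.sqrt_nonneg _)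
    (Finset.prod_nonneg fun _ _ => rewAff_nonneg _ _ _ _)]
  refine Finset.sum_le_sum fun x _ => ?_
  have p0 := pathProb_nonneg M s1 c π x
  rcases (pathProb_nonneg Ms s1 c π x).eq_or_lt with h0 | h0
  · rw [← h0]; simp
  set f : Fin H → unitInterval → ENNReal := fun h r =>
    (rewDens 𝓜 M h (x h).1 (x h).2 c r / rewDens 𝓜 Ms h (x h).1 (x h).2 c r) ^ (1 / 2 : ℝ) with hf
  have hfm : ∀ h, Measurable (f h) := fun h =>
    ((measurable_rewDens_right 𝓜 M h _ _ c).div (measurable_rewDens_right 𝓜 Ms h _ _ c)).pow_const _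
  have h1 : ∫⁻ r, (density 𝓜 M s1 c π (fun h => ((x h).1, (x h).2, r h)) /
      density 𝓜 Ms s1 c π (fun h => ((x h).1, (x h).2, r h))) ^ (1 / 2 : ℝ)
      ∂(Measure.pi fun h => Ms.R h (x h).1 (x h).2 c) =
      ∫⁻ r, ENNReal.ofReal (Real.sqrt (pathProb M s1 c π x / pathProb Ms s1 c π x)) *
        ∏ h, f h (r h) ∂(Measure.pi fun h => Ms.R h (x h).1 (x h).2 c) := by
    refine lintegral_congr_ae ?_
    filter_upwards [ae_pi_rewDens_ne hMs c x] with r hr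
    simp only [density_eq, hf]
    have g0 : ∏ h, rewDens 𝓜 Ms h (x h).1 (x h).2 c (r h) ≠ 0 :=
      Finset.prod_ne_zero_iff.2 fun h _ => (hr h).1
    have gt : ∏ h, rewDens 𝓜 Ms h (x h).1 (x h).2 c (r h) ≠ ⊤ :=
      ENNReal.prod_ne_top fun h _ => (hr h).2
    rw [ENNReal.prod_rpow_of_nonneg (by norm_num), div_eq_mul_inv,
      ENNReal.mul_inv (Or.inr gt) (Or.inr g0), mul_mul_mul_comm, ENNReal.mul_rpow_of_nonneg _ _
      (by norm_num), ← div_eq_mul_inv, ← ENNReal.ofReal_div_of_pos h0,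
      ENNReal.ofReal_rpow_of_nonneg (div_nonneg p0 h0.le) (by norm_num), ← Real.sqrt_eq_rpow]
    congr 2
    rw [ENNReal.prod_inv_distrib, ← Finset.prod_mul_distrib]
    · simp_rw [← div_eq_mul_inv]
    · intro i _ j _ _
      exact Or.inr (hr j).2
  have hfp : Measurable fun r : Fin H → unitInterval => ∏ h, f h (r h) :=
    Finset.measurable_prod _ fun h _ => (hfm h).comp (measurable_pi_apply h)
  rw [h1, lintegral_const_mul _ hfp]
  have h2 : ∫⁻ r, ∏ h, f h (r h) ∂(Measure.pi fun h => Ms.R h (x h).1 (x h).2 c) =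
      ∏ h, ENNReal.ofReal (rewAff 𝓜 M Ms h (x h).1 (x h).2 c) := by
    have h3 := lintegral_prod_eq_prod_lintegral_of_indepFun
      (μ := Measure.pi fun h => Ms.R h (x h).1 (x h).2 c) Finset.univ
      (fun h (r : Fin H → unitInterval) => f h (r h))
      (iIndepFun_pi fun h => (hfm h).aemeasurable) fun h => (hfm h).comp (measurable_pi_apply h)
    rw [h3]
    refine Finset.prod_congr rfl fun h _ => ?_
    rw [ofReal_rewAff hM hMs]
    exact (measurePreserving_eval (fun h => Ms.R h (x h).1 (x h).2 c) h).lintegral_comp (hfm h)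
  rw [h2, ← ENNReal.ofReal_prod_of_nonneg fun h _ => rewAff_nonneg _ _ _ _, ← mul_assoc,
    ← ENNReal.ofReal_mul h0.le, ← ENNReal.ofReal_mul (mul_nonneg h0.le (Real.sqrt_nonneg _))]
  refine le_of_eq ?_
  congr 2
  rw [Real.sqrt_div p0, Real.sqrt_mul p0]
  have h3 : Real.sqrt (pathProb Ms s1 c π x) ≠ 0 := (Real.sqrt_pos.2 h0).ne'
  field_simp
  rw [Real.sq_sqrt h0.le, mul_comm]

end Affinity

/-! ### The error of the estimated values under one context -/

section Core

variable {C S A : Type*} [MeasurableSpace C] [Fintype S] [Fintype A] {H : ℕ}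
  [MeasurableSpace S] [MeasurableSpace A]

section Trusted

variable (M : CMDP C S A H) (s1 : S) (c : C) (η ζ : ℝ) (reg : Policy S A H → ℝ)

/-- The trusted occupancy measure of the transitions of `M` under the context `c`. -/
noncomputable abbrev tOcc (h : ℕ) (π : Policy S A H) (s : S) : ℝ :=
  trustedOcc s1 η ζ reg (transProb M c) h π s

lemma tOcc_nonneg (h : ℕ) (π : Policy S A H) (s : S) : 0 ≤ tOcc M s1 c η ζ reg h π s := by
  classical
  induction h generalizing s with
  | zero => simp only [tOcc, trustedOcc]; split_ifs <;> norm_num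
  | succ h ih =>
    simp only [tOcc, trustedOcc]
    refine Finset.sum_nonneg fun s' _ => Finset.sum_nonneg fun a' _ => ?_
    split_ifs
    · exact mul_nonneg (mul_nonneg (ih s') (actProb_nonneg _ _ _ _)) (transProb_nonneg _ _ _ _ _ _)
    · exact le_rfl

lemma tOcc_le_occ (h : ℕ) (π : Policy S A H) (s : S) :
    tOcc M s1 c η ζ reg h π s ≤ occ M s1 c h π s := by
  classical
  induction h generalizing s with
  | zero => simp only [tOcc, trustedOcc, occ]; split_ifs <;> norm_num
  | succ h ih =>
    simp only [tOcc, trustedOcc, occ]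
    refine Finset.sum_le_sum fun s' _ => Finset.sum_le_sum fun a' _ => ?_
    split_ifs
    · exact mul_le_mul_of_nonneg_right (mul_le_mul_of_nonneg_right (ih s') (actProb_nonneg _ _ _ _))
        (transProb_nonneg _ _ _ _ _ _)
    · exact mul_nonneg (mul_nonneg (occ_nonneg _ _ _ _ _ _) (actProb_nonneg _ _ _ _))
        (transProb_nonneg _ _ _ _ _ _)

lemma sum_tOcc_mul_actProb_le {h : ℕ} (hh : h < H) (π : Policy S A H) :
    ∑ s, ∑ a, tOcc M s1 c η ζ reg h π s * actProb π h s a ≤ 1 := by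
  simp_rw [← Finset.mul_sum, sum_actProb π hh, mul_one]
  exact (Finset.sum_le_sum fun s _ => tOcc_le_occ M s1 c η ζ reg h π s).trans
    (sum_occ M s1 c hh.le π).le

open Classical in
/-- The mass that is lost at layer `h` because the transition is not trusted. -/
noncomputable def untrustedMass (h : ℕ) (π : Policy S A H) : ℝ :=
  ∑ s, ∑ a, ∑ s', if (s, a, s') ∈ trusted η ζ reg (transProb M c) (tOcc M s1 c η ζ reg h) h
    then 0 else tOcc M s1 c η ζ reg h π s * actProb π h s a * transProb M c h s a s'

lemma sum_occ_sub_tOcc_le {h : ℕ} (hh : h ≤ H) (π : Policy S A H) :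
    ∑ s, |occ M s1 c h π s - tOcc M s1 c η ζ reg h π s| ≤
      ∑ j ∈ Finset.range h, untrustedMass M s1 c η ζ reg j π := by
  classical
  induction h with
  | zero => simp [tOcc, trustedOcc, occ]
  | succ h ih =>
    rw [Finset.sum_range_succ]
    refine le_trans ?_ (add_le_add_left (ih (by omega)) _)
    have step : ∀ s', |occ M s1 c (h + 1) π s' - tOcc M s1 c η ζ reg (h + 1) π s'| ≤
        ∑ s, ∑ a, (|occ M s1 c h π s - tOcc M s1 c η ζ reg h π s| * actProb π h s a *
          transProb M c h s a s' +
          if (s, a, s') ∈ trusted η ζ reg (transProb M c) (tOcc M s1 c η ζ reg h) h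
          then 0 else tOcc M s1 c η ζ reg h π s * actProb π h s a * transProb M c h s a s') := by
      intro s'
      simp only [occ, tOcc, trustedOcc]
      rw [← Finset.sum_sub_distrib]
      refine (Finset.abs_sum_le_sum_abs _ _).trans (Finset.sum_le_sum fun s _ => ?_)
      rw [← Finset.sum_sub_distrib]
      refine (Finset.abs_sum_le_sum_abs _ _).trans (Finset.sum_le_sum fun a _ => ?_)
      have ha := actProb_nonneg π h s a
      have hp := transProb_nonneg M c h s a s'
      have ht := tOcc_nonneg M s1 c η ζ reg h π s
      have e : ∀ x : ℝ, |x| * actProb π h s a * transProb M c h s a s' =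
          |x * actProb π h s a * transProb M c h s a s'| := by
        intro x; rw [abs_mul, abs_mul, abs_of_nonneg ha, abs_of_nonneg hp]
      rw [e]
      split_ifs
      · rw [← sub_mul, ← sub_mul, add_zero]
      · have e2 : occ M s1 c h π s * actProb π h s a * transProb M c h s a s' - 0 =
            (occ M s1 c h π s - tOcc M s1 c η ζ reg h π s) * actProb π h s a *
              transProb M c h s a s' +
            tOcc M s1 c η ζ reg h π s * actProb π h s a * transProb M c h s a s' := by ring
        rw [e2]
        refine (abs_add_le _ _).trans (add_le_add_right (le_of_eq ?_) _)
        exact abs_of_nonneg (mul_nonneg (mul_nonneg ht ha) hp)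
    refine (Finset.sum_le_sum fun s' _ => step s').trans (le_of_eq ?_)
    simp_rw [Finset.sum_add_distrib]
    congr 1
    · rw [Finset.sum_comm]
      refine Finset.sum_congr rfl fun s _ => ?_
      rw [Finset.sum_comm]
      simp_rw [← Finset.mul_sum, sum_transProb M c (show h < H by omega), mul_one,
        ← Finset.mul_sum, sum_actProb π (show h < H by omega), mul_one]
    · unfold untrustedMass
      rw [Finset.sum_comm]
      refine Finset.sum_congr rfl fun s _ => ?_
      rw [Finset.sum_comm]

lemma sum_tOcc_sub_occ_le (Ms : CMDP C S A H) {h : ℕ} (hh : h ≤ H) (π : Policy S A H) :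
    ∑ s, |tOcc M s1 c η ζ reg h π s - occ Ms s1 c h π s| ≤
      ∑ j ∈ Finset.range h, (∑ s, ∑ a, tOcc M s1 c η ζ reg j π s * actProb π j s a *
        ∑ s', |transProb M c j s a s' - transProb Ms c j s a s'| +
        untrustedMass M s1 c η ζ reg j π) := by
  classical
  induction h with
  | zero => simp [tOcc, trustedOcc, occ]
  | succ h ih =>
    rw [Finset.sum_range_succ]
    refine le_trans ?_ (add_le_add_left (ih (by omega)) _)
    have step : ∀ s', |tOcc M s1 c η ζ reg (h + 1) π s' - occ Ms s1 c (h + 1) π s'| ≤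
        ∑ s, ∑ a, (|tOcc M s1 c η ζ reg h π s - occ Ms s1 c h π s| * actProb π h s a *
          transProb Ms c h s a s' + (tOcc M s1 c η ζ reg h π s * actProb π h s a *
            |transProb M c h s a s' - transProb Ms c h s a s'| +
          if (s, a, s') ∈ trusted η ζ reg (transProb M c) (tOcc M s1 c η ζ reg h) h
          then 0 else tOcc M s1 c η ζ reg h π s * actProb π h s a * transProb M c h s a s')) := by
      intro s'
      simp only [occ, tOcc, trustedOcc]
      rw [← Finset.sum_sub_distrib]
      refine (Finset.abs_sum_le_sum_abs _ _).trans (Finset.sum_le_sum fun s _ => ?_)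
      rw [← Finset.sum_sub_distrib]
      refine (Finset.abs_sum_le_sum_abs _ _).trans (Finset.sum_le_sum fun a _ => ?_)
      have ha := actProb_nonneg π h s a
      have hp := transProb_nonneg M c h s a s'
      have hps := transProb_nonneg Ms c h s a s'
      have ht := tOcc_nonneg M s1 c η ζ reg h π s
      have e : ∀ x : ℝ, |x| * actProb π h s a * transProb Ms c h s a s' =
          |x * actProb π h s a * transProb Ms c h s a s'| := by
        intro x; rw [abs_mul, abs_mul, abs_of_nonneg ha, abs_of_nonneg hps]
      have e' : ∀ x : ℝ, tOcc M s1 c η ζ reg h π s * actProb π h s a * |x| =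
          |tOcc M s1 c η ζ reg h π s * actProb π h s a * x| := by
        intro x; rw [abs_mul, abs_of_nonneg (mul_nonneg ht ha)]
      rw [e, e']
      have key : |tOcc M s1 c η ζ reg h π s * actProb π h s a * transProb M c h s a s' -
          occ Ms s1 c h π s * actProb π h s a * transProb Ms c h s a s'| ≤
          |(tOcc M s1 c η ζ reg h π s - occ Ms s1 c h π s) * actProb π h s a *
            transProb Ms c h s a s'| + |tOcc M s1 c η ζ reg h π s * actProb π h s a *
            (transProb M c h s a s' - transProb Ms c h s a s')| := by
        refine le_trans (le_of_eq ?_) (abs_add_le _ _)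
        congr 1; ring
      split_ifs
      · linarith
      · have e2 : (0 : ℝ) - occ Ms s1 c h π s * actProb π h s a * transProb Ms c h s a s' =
            (tOcc M s1 c η ζ reg h π s * actProb π h s a * transProb M c h s a s' -
              occ Ms s1 c h π s * actProb π h s a * transProb Ms c h s a s') +
            -(tOcc M s1 c η ζ reg h π s * actProb π h s a * transProb M c h s a s') := by ring
        rw [e2]
        refine (abs_add_le _ _).trans ?_
        rw [abs_neg, abs_of_nonneg (mul_nonneg (mul_nonneg ht ha) hp)]
        linarith
    refine (Finset.sum_le_sum fun s' _ => step s').trans (le_of_eq ?_)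
    simp_rw [Finset.sum_add_distrib]
    congr 1
    · rw [Finset.sum_comm]
      refine Finset.sum_congr rfl fun s _ => ?_
      rw [Finset.sum_comm]
      simp_rw [← Finset.mul_sum, sum_transProb Ms c (show h < H by omega), mul_one,
        ← Finset.mul_sum, sum_actProb π (show h < H by omega), mul_one]
    · congr 1
      · rw [Finset.sum_comm]
        refine Finset.sum_congr rfl fun s _ => ?_
        rw [Finset.sum_comm]
        simp_rw [Finset.mul_sum]
      · unfold untrustedMass
        rw [Finset.sum_comm]
        refine Finset.sum_congr rfl fun s _ => ?_
        rw [Finset.sum_comm]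

lemma untrustedMass_nonneg (h : ℕ) (π : Policy S A H) : 0 ≤ untrustedMass M s1 c η ζ reg h π := by
  refine Finset.sum_nonneg fun s _ => Finset.sum_nonneg fun a _ => Finset.sum_nonneg fun s' _ => ?_
  split_ifs
  · exact le_rfl
  · exact mul_nonneg (mul_nonneg (tOcc_nonneg M s1 c η ζ reg h π s) (actProb_nonneg _ _ _ _))
      (transProb_nonneg _ _ _ _ _ _)

/-- A decomposition of the error of the estimated value: reward errors and transition errors are
averaged over the trusted occupancy measure, and the untrusted mass is lost twice. -/
lemma abs_value_sub_le (Ms : CMDP C S A H) (π : Policy S A H) :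
    |value M s1 c π - value Ms s1 c π| ≤
      ∑ h : Fin H, ∑ s, ∑ a, tOcc M s1 c η ζ reg h π s * actProb π h s a *
        |meanReward M h s a c - meanReward Ms h s a c| +
      H * ∑ j ∈ Finset.range (H - 1), (∑ s, ∑ a, tOcc M s1 c η ζ reg j π s * actProb π j s a *
        ∑ s', |transProb M c j s a s' - transProb Ms c j s a s'| +
        2 * untrustedMass M s1 c η ζ reg j π) := by
  have hG0 : ∀ j, 0 ≤ ∑ s, ∑ a, tOcc M s1 c η ζ reg j π s * actProb π j s a *
        ∑ s', |transProb M c j s a s' - transProb Ms c j s a s'| := fun j =>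
    Finset.sum_nonneg fun s _ => Finset.sum_nonneg fun a _ => mul_nonneg (mul_nonneg
      (tOcc_nonneg M s1 c η ζ reg j π s) (actProb_nonneg _ _ _ _))
      (Finset.sum_nonneg fun _ _ => abs_nonneg _)
  have hU0 := fun j => untrustedMass_nonneg M s1 c η ζ reg j π
  rw [value_eq_sum_occ, value_eq_sum_occ, ← Finset.sum_sub_distrib]
  have layer : ∀ h : Fin H, |∑ s, ∑ a, occ M s1 c h π s * actProb π h s a * meanReward M h s a c -
      ∑ s, ∑ a, occ Ms s1 c h π s * actProb π h s a * meanReward Ms h s a c| ≤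
      ∑ s, ∑ a, tOcc M s1 c η ζ reg h π s * actProb π h s a *
        |meanReward M h s a c - meanReward Ms h s a c| +
      ∑ j ∈ Finset.range (H - 1), (∑ s, ∑ a, tOcc M s1 c η ζ reg j π s * actProb π j s a *
        ∑ s', |transProb M c j s a s' - transProb Ms c j s a s'| +
        2 * untrustedMass M s1 c η ζ reg j π) := by
    intro h
    have hpt : |∑ s, ∑ a, occ M s1 c h π s * actProb π h s a * meanReward M h s a c -
        ∑ s, ∑ a, occ Ms s1 c h π s * actProb π h s a * meanReward Ms h s a c| ≤
        ∑ s, ∑ a, (|occ M s1 c h π s - tOcc M s1 c η ζ reg h π s| * actProb π h s a +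
          tOcc M s1 c η ζ reg h π s * actProb π h s a *
            |meanReward M h s a c - meanReward Ms h s a c| +
          |tOcc M s1 c η ζ reg h π s - occ Ms s1 c h π s| * actProb π h s a) := by
      rw [← Finset.sum_sub_distrib]
      refine (Finset.abs_sum_le_sum_abs _ _).trans (Finset.sum_le_sum fun s _ => ?_)
      rw [← Finset.sum_sub_distrib]
      refine (Finset.abs_sum_le_sum_abs _ _).trans (Finset.sum_le_sum fun a _ => ?_)
      have ha := actProb_nonneg π h s a
      have ht := tOcc_nonneg M s1 c η ζ reg h π s
      have r0 := meanReward_nonneg M h s a c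
      have r1 := meanReward_le_one M h s a c
      have q0 := meanReward_nonneg Ms h s a c
      have q1 := meanReward_le_one Ms h s a c
      set d := tOcc M s1 c η ζ reg h π s
      have e : occ M s1 c h π s * actProb π h s a * meanReward M h s a c -
          occ Ms s1 c h π s * actProb π h s a * meanReward Ms h s a c =
          (occ M s1 c h π s - d) * actProb π h s a * meanReward M h s a c +
          d * actProb π h s a * (meanReward M h s a c - meanReward Ms h s a c) +
          (d - occ Ms s1 c h π s) * actProb π h s a * meanReward Ms h s a c := by ring
      rw [e]
      refine (abs_add_le _ _).trans (add_le_add ((abs_add_le _ _).trans (add_le_add ?_ ?_)) ?_)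
      · rw [abs_mul, abs_mul, abs_of_nonneg ha, abs_of_nonneg r0]
        exact mul_le_of_le_one_right (mul_nonneg (abs_nonneg _) ha) r1
      · rw [abs_mul, abs_of_nonneg (mul_nonneg ht ha)]
      · rw [abs_mul, abs_mul, abs_of_nonneg ha, abs_of_nonneg q0]
        exact mul_le_of_le_one_right (mul_nonneg (abs_nonneg _) ha) q1
    simp_rw [Finset.sum_add_distrib, ← Finset.mul_sum, sum_actProb π h.isLt, mul_one] at hpt
    have h1 := sum_occ_sub_tOcc_le M s1 c η ζ reg h.isLt.le π
    have h2 := sum_tOcc_sub_occ_le M s1 c η ζ reg Ms h.isLt.le π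
    have h3 : ∑ j ∈ Finset.range h, untrustedMass M s1 c η ζ reg j π +
        ∑ j ∈ Finset.range h, (∑ s, ∑ a, tOcc M s1 c η ζ reg j π s * actProb π j s a *
        ∑ s', |transProb M c j s a s' - transProb Ms c j s a s'| +
        untrustedMass M s1 c η ζ reg j π) ≤
        ∑ j ∈ Finset.range (H - 1), (∑ s, ∑ a, tOcc M s1 c η ζ reg j π s * actProb π j s a *
        ∑ s', |transProb M c j s a s' - transProb Ms c j s a s'| +
        2 * untrustedMass M s1 c η ζ reg j π) := by
      rw [← Finset.sum_add_distrib]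
      refine (Finset.sum_le_sum fun j _ => ?_).trans (Finset.sum_le_sum_of_subset_of_nonneg
        (Finset.range_subset_range.2 (by have := h.isLt; omega)) fun j _ _ => ?_)
      · linarith
      · have := hG0 j; have := hU0 j; linarith
    simp_rw [Finset.mul_sum] at h2 h3 hpt ⊢
    linarith
  refine (Finset.abs_sum_le_sum_abs _ _).trans ((Finset.sum_le_sum fun h _ => layer h).trans ?_)
  rw [Finset.sum_add_distrib, Finset.sum_const, Finset.card_univ, Fintype.card_fin, nsmul_eq_mul]

end Trusted

end Core

lemma le_of_sq_le_sq_of_nonneg {a b : ℝ} (h : a ^ 2 ≤ b ^ 2) (hb : 0 ≤ b) : a ≤ b :=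
  (le_abs_self a).trans (abs_le_of_sq_le_sq h hb)

section CoverCore

variable {C S A : Type*} [MeasurableSpace C] [Fintype S] [Fintype A] {H : ℕ}
  [MeasurableSpace S] [MeasurableSpace A]

/-- The average of `F` over the finite set `Q` with the weights `w`. -/
noncomputable def wavg (Q : Finset (Policy S A H)) (w : Policy S A H → ℝ)
    (F : Policy S A H → ℝ) : ℝ := ∑ π ∈ Q, w π * F π

lemma wavg_nonneg {Q : Finset (Policy S A H)} {w F : Policy S A H → ℝ}
    (hw : ∀ π ∈ Q, 0 ≤ w π) (hF : ∀ π, 0 ≤ F π) : 0 ≤ wavg Q w F :=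
  Finset.sum_nonneg fun π hπ => mul_nonneg (hw π hπ) (hF π)

lemma wavg_mono {Q : Finset (Policy S A H)} {w F G : Policy S A H → ℝ}
    (hw : ∀ π ∈ Q, 0 ≤ w π) (hFG : ∀ π, F π ≤ G π) : wavg Q w F ≤ wavg Q w G :=
  Finset.sum_le_sum fun π hπ => mul_le_mul_of_nonneg_left (hFG π) (hw π hπ)

lemma wavg_const_mul (Q : Finset (Policy S A H)) (w F : Policy S A H → ℝ) (x : ℝ) :
    wavg Q w (fun π => x * F π) = x * wavg Q w F := by
  unfold wavg; rw [Finset.mul_sum]; exact Finset.sum_congr rfl fun π _ => by ring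

/-- The situation of one epoch under one context `c`: in layer `h` policies are drawn from `Q h`
with weights `w h`, these cover the trusted occupancy measures of the estimate `M` up to a factor
`2`, and along the occupancy measures of `Ms` the affinities of `M` and `Ms` are within `e h` of
one on average. The reward deviations are measured by `b`. -/
structure LayerCover (M Ms : CMDP C S A H) (s1 : S) (c : C) (η ζ : ℝ) (reg : Policy S A H → ℝ)
    (Q : ℕ → Finset (Policy S A H)) (w : ℕ → Policy S A H → ℝ) (b : Fin H → S → A → ℝ)
    (e : ℕ → ℝ) : Prop where
  weight_nonneg : ∀ h < H, ∀ π ∈ Q h, 0 ≤ w h π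
  cover : ∀ h < H, ∀ s a π, coverRatio η reg (tOcc M s1 c η ζ reg h) h s a π ≤
    2 * wavg (Q h) (w h) fun π' => tOcc M s1 c η ζ reg h π' s * actProb π' h s a
  reward_sq : ∀ h s a, (meanReward M h s a c - meanReward Ms h s a c) ^ 2 ≤ 8 * b h s a
  reward_nonneg : ∀ h s a, 0 ≤ b h s a
  reward_err : ∀ h : Fin H, wavg (Q h) (w h) (fun π' =>
    ∑ s, ∑ a, occ Ms s1 c h π' s * actProb π' h s a * b h s a) ≤ e h
  trans_err : ∀ h, h + 1 < H → wavg (Q h) (w h) (fun π' =>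
    ∑ s, ∑ a, occ Ms s1 c h π' s * actProb π' h s a * (1 - transAff M Ms c h s a)) ≤ e h
  err_nonneg : ∀ h, 0 ≤ e h

namespace LayerCover

variable {M Ms : CMDP C S A H} {s1 : S} {c : C} {η ζ : ℝ} {reg : Policy S A H → ℝ}
  {Q : ℕ → Finset (Policy S A H)} {w : ℕ → Policy S A H → ℝ} {b : Fin H → S → A → ℝ} {e : ℕ → ℝ}

lemma tOcc_mul_actProb_le (L : LayerCover M Ms s1 c η ζ reg Q w b e) (hη : 0 < η)
    (hreg : ∀ π, 0 ≤ reg π) [Nonempty A] {h : ℕ} (hh : h < H) (π : Policy S A H) (s : S) (a : A) :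
    tOcc M s1 c η ζ reg h π s * actProb π h s a ≤
      2 * ((Fintype.card S : ℝ) * Fintype.card A + η * reg π) *
        wavg (Q h) (w h) fun π' => tOcc M s1 c η ζ reg h π' s * actProb π' h s a := by
  have hS : 0 < Fintype.card S := Fintype.card_pos_iff.2 ⟨s⟩
  have hA : 0 < Fintype.card A := Fintype.card_pos
  have hX : 0 < (Fintype.card S : ℝ) * Fintype.card A + η * reg π := by
    have := mul_nonneg hη.le (hreg π); positivity
  have := L.cover h hh s a π
  rw [coverRatio, div_le_iff₀ hX] at this
  linarith

lemma bddAbove_coverRatio (hη : 0 < η) (hreg : ∀ π, 0 ≤ reg π) {h : ℕ} (hh : h < H) (s : S)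
    (a : A) : BddAbove (Set.range (coverRatio η reg (tOcc M s1 c η ζ reg h) h s a)) := by
  have hS : 0 < Fintype.card S := Fintype.card_pos_iff.2 ⟨s⟩
  have hA : 0 < Fintype.card A := Fintype.card_pos_iff.2 ⟨a⟩
  refine ⟨1 / ((Fintype.card S : ℝ) * Fintype.card A), ?_⟩
  rintro _ ⟨π, rfl⟩
  unfold coverRatio
  have h1 : tOcc M s1 c η ζ reg h π s * actProb π h s a ≤ 1 := by
    refine le_trans ?_ (sum_tOcc_mul_actProb_le M s1 c η ζ reg hh π)
    have h0 : ∀ s a, 0 ≤ tOcc M s1 c η ζ reg h π s * actProb π h s a := fun s a =>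
      mul_nonneg (tOcc_nonneg M s1 c η ζ reg h π s) (actProb_nonneg _ _ _ _)
    exact (Finset.single_le_sum (f := fun a => tOcc M s1 c η ζ reg h π s * actProb π h s a)
      (fun a _ => h0 s a) (Finset.mem_univ a)).trans (Finset.single_le_sum
      (f := fun s => ∑ a, tOcc M s1 c η ζ reg h π s * actProb π h s a)
      (fun s _ => Finset.sum_nonneg fun a _ => h0 s a) (Finset.mem_univ s))
  have := mul_nonneg hη.le (hreg π)
  exact div_le_div₀ zero_le_one h1 (by positivity) (by linarith)

lemma untrustedMass_le (hη : 0 < η) (hζ : 0 < ζ) (hreg : ∀ π, 0 ≤ reg π) [Nonempty A] {h : ℕ}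
    (hh : h < H) (π : Policy S A H) :
    untrustedMass M s1 c η ζ reg h π ≤ (Fintype.card S : ℝ) ^ 2 * Fintype.card A *
      (((Fintype.card S : ℝ) * Fintype.card A + η * reg π) / ζ) := by
  have hA : 0 < Fintype.card A := Fintype.card_pos
  have hX0 : 0 ≤ (Fintype.card S : ℝ) * Fintype.card A + η * reg π := by
    have := mul_nonneg hη.le (hreg π); positivity
  have key : ∀ s a s', (s, a, s') ∉ trusted η ζ reg (transProb M c) (tOcc M s1 c η ζ reg h) h →
      tOcc M s1 c η ζ reg h π s * actProb π h s a * transProb M c h s a s' ≤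
        ((Fintype.card S : ℝ) * Fintype.card A + η * reg π) / ζ := by
    intro s a s' hn
    have hS : 0 < Fintype.card S := Fintype.card_pos_iff.2 ⟨s⟩
    have hX : 0 < (Fintype.card S : ℝ) * Fintype.card A + η * reg π := by
      have := mul_nonneg hη.le (hreg π); positivity
    have hP := transProb_nonneg M c h s a s'
    simp only [trusted, Set.mem_ofPred_eq, not_le] at hn
    have h1 := le_ciSup (bddAbove_coverRatio (M := M) (s1 := s1) (c := c) (ζ := ζ) hη hreg hh s a) π
    have h2 : tOcc M s1 c η ζ reg h π s * actProb π h s a ≤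
        (⨆ π, coverRatio η reg (tOcc M s1 c η ζ reg h) h s a π) *
          ((Fintype.card S : ℝ) * Fintype.card A + η * reg π) := by
      rw [coverRatio, div_le_iff₀ hX] at h1
      exact h1
    rw [le_div_iff₀ hζ]
    calc _ ≤ (⨆ π, coverRatio η reg (tOcc M s1 c η ζ reg h) h s a π) *
          ((Fintype.card S : ℝ) * Fintype.card A + η * reg π) * transProb M c h s a s' * ζ := by
          gcongr
      _ = (ζ * ((⨆ π, coverRatio η reg (tOcc M s1 c η ζ reg h) h s a π) *
          transProb M c h s a s')) * ((Fintype.card S : ℝ) * Fintype.card A + η * reg π) := by ring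
      _ ≤ 1 * _ := mul_le_mul_of_nonneg_right hn.le hX.le
      _ = _ := one_mul _
  calc untrustedMass M s1 c η ζ reg h π ≤ ∑ _s : S, ∑ _a : A, ∑ _s' : S,
        ((Fintype.card S : ℝ) * Fintype.card A + η * reg π) / ζ := by
        refine Finset.sum_le_sum fun s _ => Finset.sum_le_sum fun a _ =>
          Finset.sum_le_sum fun s' _ => ?_
        split_ifs with hmem
        · positivity
        · exact key s a s' hmem
    _ = _ := by simp only [Finset.sum_const, Finset.card_univ, nsmul_eq_mul]; ring

/-- As long as the errors are small compared with `1 / ζ`, the trusted occupancy measures of the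
estimate are dominated by the true occupancy measures. -/
lemma sq_mul_tOcc_le (L : LayerCover M Ms s1 c η ζ reg Q w b e) (hζ : 0 < ζ)
    [Nonempty A] (hsum : ∑ j ∈ Finset.range H, 4 * Real.sqrt (ζ * e j) ≤ 1 / 2) {h : ℕ} (hh : h < H)
    (π : Policy S A H) (s : S) :
    (1 - ∑ j ∈ Finset.range h, 4 * Real.sqrt (ζ * e j)) ^ 2 * tOcc M s1 c η ζ reg h π s ≤
      occ Ms s1 c h π s := by
  classical
  induction h generalizing π s with
  | zero => simp [tOcc, trustedOcc, occ]
  | succ h ih =>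
    have hh' : h < H := by omega
    have hε0 : ∀ j, 0 ≤ 4 * Real.sqrt (ζ * e j) := fun j => by positivity
    have hle : ∑ j ∈ Finset.range (h + 1), 4 * Real.sqrt (ζ * e j) ≤ 1 / 2 :=
      (Finset.sum_le_sum_of_subset_of_nonneg (Finset.range_subset_range.2 hh.le)
        fun j _ _ => hε0 j).trans hsum
    rw [Finset.sum_range_succ] at hle ⊢
    set σ := ∑ j ∈ Finset.range h, 4 * Real.sqrt (ζ * e j) with hσ
    set ε := 4 * Real.sqrt (ζ * e h) with hε
    have hσ0 : 0 ≤ σ := Finset.sum_nonneg fun j _ => hε0 j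
    have hε1 : 0 ≤ ε := hε0 h
    -- trusted transitions are overestimated by a factor close to one only
    have htr : ∀ s a s', (s, a, s') ∈ trusted η ζ reg (transProb M c) (tOcc M s1 c η ζ reg h) h →
        (1 - ε) ^ 2 * transProb M c h s a s' ≤ transProb Ms c h s a s' := by
      intro s a s' hmem
      simp only [trusted, Set.mem_ofPred_eq] at hmem
      set v := wavg (Q h) (w h) fun π' => tOcc M s1 c η ζ reg h π' s * actProb π' h s a with hv
      set P := transProb M c h s a s'
      set P' := transProb Ms c h s a s'
      have hP0 : 0 ≤ P := transProb_nonneg _ _ _ _ _ _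
      have hP'0 : 0 ≤ P' := transProb_nonneg _ _ _ _ _ _
      have hsup : (⨆ π, coverRatio η reg (tOcc M s1 c η ζ reg h) h s a π) ≤ 2 * v :=
        ciSup_le fun π => L.cover h hh' s a π
      have h1 : 1 ≤ ζ * (2 * v * P) := hmem.trans (by gcongr)
      set v' := wavg (Q h) (w h) fun π' => occ Ms s1 c h π' s * actProb π' h s a with hv'
      have hvv' : v ≤ 4 * v' := by
        rw [hv, hv', ← wavg_const_mul]
        refine wavg_mono (L.weight_nonneg h hh') fun π' => ?_
        have h2 := ih hh' π' s
        have h3 : (1 / 4 : ℝ) * tOcc M s1 c η ζ reg h π' s ≤ occ Ms s1 c h π' s :=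
          le_trans (mul_le_mul_of_nonneg_right (by nlinarith) (tOcc_nonneg M s1 c η ζ reg h π' s)) h2
        have := mul_le_mul_of_nonneg_right h3 (actProb_nonneg π' h s a)
        nlinarith
      have h4 : v' * (Real.sqrt P - Real.sqrt P') ^ 2 ≤ 2 * e h := by
        have h5 : (Real.sqrt P - Real.sqrt P') ^ 2 ≤ 2 * (1 - transAff M Ms c h s a) := by
          unfold transAff
          rw [← sum_sq_sqrt_sub_sqrt (fun _ => transProb_nonneg _ _ _ _ _ _)
            (fun _ => transProb_nonneg _ _ _ _ _ _) (sum_transProb M c hh' s a)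
            (sum_transProb Ms c hh' s a)]
          exact Finset.single_le_sum (f := fun s' => (Real.sqrt (transProb M c h s a s') -
            Real.sqrt (transProb Ms c h s a s')) ^ 2) (fun _ _ => sq_nonneg _) (Finset.mem_univ s')
        have hv'0 : 0 ≤ v' := wavg_nonneg (L.weight_nonneg h hh') fun π' =>
          mul_nonneg (occ_nonneg _ _ _ _ _ _) (actProb_nonneg _ _ _ _)
        refine (mul_le_mul_of_nonneg_left h5 hv'0).trans ?_
        have h6 := L.trans_err h hh
        have h7 : v' * (1 - transAff M Ms c h s a) ≤ e h := by
          refine le_trans ?_ h6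
          rw [mul_comm, hv', ← wavg_const_mul]
          refine wavg_mono (L.weight_nonneg h hh') fun π' => ?_
          have h8 : ∀ s a, 0 ≤ occ Ms s1 c h π' s * actProb π' h s a *
              (1 - transAff M Ms c h s a) := fun s a =>
            mul_nonneg (mul_nonneg (occ_nonneg _ _ _ _ _ _) (actProb_nonneg _ _ _ _))
              (sub_nonneg.2 (transAff_le_one _ _ _ _ _ _))
          rw [mul_comm]
          exact (Finset.single_le_sum (f := fun a => occ Ms s1 c h π' s * actProb π' h s a *
            (1 - transAff M Ms c h s a)) (fun a _ => h8 s a) (Finset.mem_univ a)).trans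
            (Finset.single_le_sum (f := fun s => ∑ a, occ Ms s1 c h π' s * actProb π' h s a *
              (1 - transAff M Ms c h s a)) (fun s _ => Finset.sum_nonneg fun a _ => h8 s a)
              (Finset.mem_univ s))
        linarith
      have h9 : (Real.sqrt P - Real.sqrt P') ^ 2 ≤ ε ^ 2 * P := by
        have hε2 : ε ^ 2 = 16 * (ζ * e h) := by
          rw [hε, mul_pow, Real.sq_sqrt (mul_nonneg hζ.le (L.err_nonneg h))]; norm_num
        rw [hε2]
        have h10 : v * (Real.sqrt P - Real.sqrt P') ^ 2 ≤ 8 * e h := by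
          nlinarith [sq_nonneg (Real.sqrt P - Real.sqrt P')]
        calc (Real.sqrt P - Real.sqrt P') ^ 2
            ≤ (ζ * (2 * v * P)) * (Real.sqrt P - Real.sqrt P') ^ 2 :=
              le_mul_of_one_le_left (sq_nonneg _) h1
          _ = (2 * ζ * P) * (v * (Real.sqrt P - Real.sqrt P') ^ 2) := by ring
          _ ≤ (2 * ζ * P) * (8 * e h) := by gcongr
          _ = _ := by ring
      have h11 : Real.sqrt P - Real.sqrt P' ≤ ε * Real.sqrt P := by
        refine le_of_sq_le_sq_of_nonneg ?_ (mul_nonneg hε1 (Real.sqrt_nonneg _))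
        rw [mul_pow, Real.sq_sqrt hP0]; exact h9
      have h12 : (1 - ε) * Real.sqrt P ≤ Real.sqrt P' := by linarith
      have h13 : 0 ≤ (1 - ε) * Real.sqrt P := mul_nonneg (by linarith) (Real.sqrt_nonneg _)
      calc (1 - ε) ^ 2 * P = ((1 - ε) * Real.sqrt P) ^ 2 := by rw [mul_pow, Real.sq_sqrt hP0]
        _ ≤ Real.sqrt P' ^ 2 := by gcongr
        _ = P' := Real.sq_sqrt hP'0
    simp only [tOcc, trustedOcc, occ]
    rw [Finset.mul_sum]
    refine Finset.sum_le_sum fun s' _ => ?_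
    rw [Finset.mul_sum]
    refine Finset.sum_le_sum fun a' _ => ?_
    have ha := actProb_nonneg π h s' a'
    have hps := transProb_nonneg Ms c h s' a' s
    have hp := transProb_nonneg M c h s' a' s
    split_ifs with hmem
    · have h1 := htr s' a' s hmem
      have h2 := ih hh' π s'
      have ht := tOcc_nonneg M s1 c η ζ reg h π s'
      set d := tOcc M s1 c η ζ reg h π s'
      calc (1 - (σ + ε)) ^ 2 * (d * actProb π h s' a' * transProb M c h s' a' s)
          ≤ ((1 - σ) * (1 - ε)) ^ 2 * (d * actProb π h s' a' * transProb M c h s' a' s) := by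
            refine mul_le_mul_of_nonneg_right ?_ (mul_nonneg (mul_nonneg ht ha) hp)
            exact pow_le_pow_left₀ (by linarith) (by nlinarith) 2
        _ = ((1 - σ) ^ 2 * d) * actProb π h s' a' * ((1 - ε) ^ 2 * transProb M c h s' a' s) := by
            ring
        _ ≤ occ Ms s1 c h π s' * actProb π h s' a' * transProb Ms c h s' a' s := by
            have := mul_nonneg (sq_nonneg (1 - ε)) hp
            have := occ_nonneg Ms s1 c h π s'
            gcongr
    · rw [mul_zero]
      exact mul_nonneg (mul_nonneg (occ_nonneg _ _ _ _ _ _) ha) hps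

/-- Change of measure from the trusted occupancy measure of an arbitrary policy to the data
distribution, by Cauchy-Schwarz. -/
lemma sum_tOcc_mul_sq_le (L : LayerCover M Ms s1 c η ζ reg Q w b e) (hη : 0 < η) (hζ : 0 < ζ)
    (hreg : ∀ π, 0 ≤ reg π) [Nonempty A]
    (hsum : ∑ j ∈ Finset.range H, 4 * Real.sqrt (ζ * e j) ≤ 1 / 2) {h : ℕ} (hh : h < H)
    (π : Policy S A H) {x y : S → A → ℝ} (hxy : ∀ s a, x s a ^ 2 ≤ 8 * y s a)
    (hy : ∀ s a, 0 ≤ y s a)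
    (he : wavg (Q h) (w h) (fun π' => ∑ s, ∑ a, occ Ms s1 c h π' s * actProb π' h s a * y s a) ≤
      e h) :
    (∑ s, ∑ a, tOcc M s1 c η ζ reg h π s * actProb π h s a * x s a) ^ 2 ≤
      64 * (((Fintype.card S : ℝ) * Fintype.card A + η * reg π) * e h) := by
  have hA : 0 < Fintype.card A := Fintype.card_pos
  set X := (Fintype.card S : ℝ) * Fintype.card A + η * reg π with hXdef
  have hX : 0 ≤ X := by have := mul_nonneg hη.le (hreg π); positivity
  have hd : ∀ s a, 0 ≤ tOcc M s1 c η ζ reg h π s * actProb π h s a := fun s a =>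
    mul_nonneg (tOcc_nonneg M s1 c η ζ reg h π s) (actProb_nonneg _ _ _ _)
  have hle : ∑ j ∈ Finset.range h, 4 * Real.sqrt (ζ * e j) ≤ 1 / 2 :=
    (Finset.sum_le_sum_of_subset_of_nonneg (Finset.range_subset_range.2 hh.le)
      fun j _ _ => by positivity).trans hsum
  have hdom : ∀ π' s, tOcc M s1 c η ζ reg h π' s ≤ 4 * occ Ms s1 c h π' s := by
    intro π' s
    have h1 := L.sq_mul_tOcc_le hζ hsum hh π' s
    have h2 := tOcc_nonneg M s1 c η ζ reg h π' s
    have h3 : (1 / 4 : ℝ) ≤ (1 - ∑ j ∈ Finset.range h, 4 * Real.sqrt (ζ * e j)) ^ 2 := by nlinarith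
    nlinarith
  have cs : (∑ s, ∑ a, tOcc M s1 c η ζ reg h π s * actProb π h s a * x s a) ^ 2 ≤
      ∑ s, ∑ a, tOcc M s1 c η ζ reg h π s * actProb π h s a * x s a ^ 2 := by
    simp_rw [← Fintype.sum_prod_type']
    have h1 := Finset.sum_mul_sq_le_sq_mul_sq Finset.univ
      (fun z : S × A => Real.sqrt (tOcc M s1 c η ζ reg h π z.1 * actProb π h z.1 z.2))
      (fun z : S × A => Real.sqrt (tOcc M s1 c η ζ reg h π z.1 * actProb π h z.1 z.2) * x z.1 z.2)
    have e1 : ∀ z : S × A, Real.sqrt (tOcc M s1 c η ζ reg h π z.1 * actProb π h z.1 z.2) *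
        (Real.sqrt (tOcc M s1 c η ζ reg h π z.1 * actProb π h z.1 z.2) * x z.1 z.2) =
        tOcc M s1 c η ζ reg h π z.1 * actProb π h z.1 z.2 * x z.1 z.2 := fun z => by
      rw [← mul_assoc, Real.mul_self_sqrt (hd _ _)]
    have e2 : ∀ z : S × A, (Real.sqrt (tOcc M s1 c η ζ reg h π z.1 * actProb π h z.1 z.2) *
        x z.1 z.2) ^ 2 = tOcc M s1 c η ζ reg h π z.1 * actProb π h z.1 z.2 * x z.1 z.2 ^ 2 :=
      fun z => by rw [mul_pow, Real.sq_sqrt (hd _ _)]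
    have e3 : ∀ z : S × A, Real.sqrt (tOcc M s1 c η ζ reg h π z.1 * actProb π h z.1 z.2) ^ 2 =
        tOcc M s1 c η ζ reg h π z.1 * actProb π h z.1 z.2 := fun z => Real.sq_sqrt (hd _ _)
    simp_rw [e1, e2, e3] at h1
    refine h1.trans (mul_le_of_le_one_left (Finset.sum_nonneg fun z _ =>
      mul_nonneg (hd _ _) (sq_nonneg _)) ?_)
    have := sum_tOcc_mul_actProb_le M s1 c η ζ reg hh π
    rwa [← Fintype.sum_prod_type'] at this
  refine cs.trans ?_
  calc ∑ s, ∑ a, tOcc M s1 c η ζ reg h π s * actProb π h s a * x s a ^ 2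
      ≤ ∑ s, ∑ a, (2 * X * wavg (Q h) (w h) fun π' =>
          tOcc M s1 c η ζ reg h π' s * actProb π' h s a) * (8 * y s a) := by
        refine Finset.sum_le_sum fun s _ => Finset.sum_le_sum fun a _ => ?_
        refine mul_le_mul (L.tOcc_mul_actProb_le hη hreg hh π s a) (hxy s a) (sq_nonneg _) ?_
        exact (hd s a).trans (L.tOcc_mul_actProb_le hη hreg hh π s a)
    _ = 16 * X * wavg (Q h) (w h) (fun π' => ∑ s, ∑ a,
          tOcc M s1 c η ζ reg h π' s * actProb π' h s a * y s a) := by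
        unfold wavg
        simp_rw [Finset.mul_sum, Finset.sum_mul]
        symm
        rw [Finset.sum_comm]
        refine Finset.sum_congr rfl fun s _ => ?_
        rw [Finset.sum_comm]
        exact Finset.sum_congr rfl fun a _ => Finset.sum_congr rfl fun π' _ => by ring
    _ ≤ 16 * X * (4 * e h) := by
        refine mul_le_mul_of_nonneg_left ?_ (by positivity)
        refine le_trans ?_ (mul_le_mul_of_nonneg_left he (by norm_num))
        rw [← wavg_const_mul]
        refine wavg_mono (L.weight_nonneg h hh) fun π' => ?_
        simp_rw [Finset.mul_sum]
        refine Finset.sum_le_sum fun s _ => Finset.sum_le_sum fun a _ => ?_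
        have := mul_le_mul_of_nonneg_right (mul_le_mul_of_nonneg_right (hdom π' s)
          (actProb_nonneg π' h s a)) (hy s a)
        linarith
    _ = _ := by ring

/-- The error of the estimated value under one context. -/
theorem abs_value_sub_le (L : LayerCover M Ms s1 c η ζ reg Q w b e) (hη : 0 < η) (hζ : 0 < ζ)
    (hreg : ∀ π, 0 ≤ reg π) [Nonempty A]
    (hηζ : 2 * (H : ℝ) ^ 2 * ((Fintype.card S : ℝ) ^ 2 * Fintype.card A) / ζ ≤ 4 / 45 / η)
    (π : Policy S A H) :
    |value M s1 c π - value Ms s1 c π| ≤ reg π / 8 +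
      ((Fintype.card S : ℝ) * Fintype.card A / (8 * η) +
        (2048 * (H : ℝ) ^ 3 * η + 64 * (H : ℝ) ^ 2 * ζ) * ∑ h ∈ Finset.range H, e h) := by
  rcases Nat.eq_zero_or_pos H with h0 | hH
  · subst h0
    rw [value_eq_sum_occ, value_eq_sum_occ]
    have := hreg π
    simp only [Finset.univ_eq_empty, Finset.sum_empty, sub_self, abs_zero, Finset.range_zero,
      mul_zero, add_zero]
    positivity
  have hHr : (1 : ℝ) ≤ H := by exact_mod_cast hH
  set X := (Fintype.card S : ℝ) * Fintype.card A + η * reg π with hXdef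
  have hX : 0 ≤ X := by have := mul_nonneg hη.le (hreg π); positivity
  set E := ∑ h ∈ Finset.range H, e h with hE
  have hE0 : 0 ≤ E := Finset.sum_nonneg fun h _ => L.err_nonneg h
  have hregπ := hreg π
  by_cases hgood : (H : ℝ) * ζ * E ≤ 1 / 64
  swap
  · have h1 := value_nonneg M s1 c π
    have h2 := value_le M s1 c π
    have h3 := value_nonneg Ms s1 c π
    have h4 := value_le Ms s1 c π
    have h5 : |value M s1 c π - value Ms s1 c π| ≤ H := abs_le.2 ⟨by linarith, by linarith⟩
    push Not at hgood
    have h6 : (H : ℝ) ≤ 64 * (H : ℝ) ^ 2 * ζ * E := by nlinarith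
    have h7 : 0 ≤ 2048 * (H : ℝ) ^ 3 * η * E := by positivity
    have h8 : 0 ≤ (Fintype.card S : ℝ) * Fintype.card A / (8 * η) := by positivity
    rw [add_mul]
    linarith
  have hsum : ∑ j ∈ Finset.range H, 4 * Real.sqrt (ζ * e j) ≤ 1 / 2 := by
    have h1 := sq_sum_le_card_mul_sum_sq (s := Finset.range H) (f := fun j => Real.sqrt (ζ * e j))
    have h2 : ∀ j, Real.sqrt (ζ * e j) ^ 2 = ζ * e j := fun j =>
      Real.sq_sqrt (mul_nonneg hζ.le (L.err_nonneg j))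
    simp_rw [h2, ← Finset.mul_sum, Finset.card_range] at h1
    rw [← Finset.mul_sum]
    have h3 : ∑ j ∈ Finset.range H, Real.sqrt (ζ * e j) ≤ 1 / 8 := by
      refine le_of_sq_le_sq_of_nonneg ?_ (by norm_num)
      nlinarith
    linarith
  set β := 1 / (256 * (H : ℝ) ^ 2 * η) with hβ
  have hβ0 : 0 < β := by positivity
  -- the geometric mean is split with the weight `β`
  have amgm : ∀ h (u : ℝ), u ^ 2 ≤ 64 * (X * e h) → u ≤ 4 * (β * X + e h / β) := by
    intro h u hu
    have he := L.err_nonneg h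
    refine le_of_sq_le_sq_of_nonneg (hu.trans ?_) (by positivity)
    have : X * e h = (β * X) * (e h / β) := by field_simp
    rw [this]
    nlinarith [sq_nonneg (β * X - e h / β)]
  have hF : ∑ h : Fin H, ∑ s, ∑ a, tOcc M s1 c η ζ reg h π s * actProb π h s a *
      |meanReward M h s a c - meanReward Ms h s a c| ≤ 4 * (H * (β * X) + E / β) := by
    calc _ ≤ ∑ h : Fin H, 4 * (β * X + e h / β) := by
          refine Finset.sum_le_sum fun h _ => amgm h _ ?_
          exact L.sum_tOcc_mul_sq_le hη hζ hreg hsum h.isLt π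
            (fun s a => by rw [sq_abs]; exact L.reward_sq h s a) (L.reward_nonneg h)
            (L.reward_err h)
      _ = _ := by
          rw [Fin.sum_univ_eq_sum_range (fun h => 4 * (β * X + e h / β)), ← Finset.mul_sum,
            Finset.sum_add_distrib, ← Finset.sum_div, ← hE]
          simp
  have hG : ∑ j ∈ Finset.range (H - 1), (∑ s, ∑ a, tOcc M s1 c η ζ reg j π s * actProb π j s a *
        ∑ s', |transProb M c j s a s' - transProb Ms c j s a s'| +
        2 * untrustedMass M s1 c η ζ reg j π) ≤ 4 * (H * (β * X) + E / β) +
      H * (2 * ((Fintype.card S : ℝ) ^ 2 * Fintype.card A * (X / ζ))) := by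
    calc _ ≤ ∑ j ∈ Finset.range (H - 1), (4 * (β * X + e j / β) +
          2 * ((Fintype.card S : ℝ) ^ 2 * Fintype.card A * (X / ζ))) := by
          refine Finset.sum_le_sum fun j hj => ?_
          have hj' : j + 1 < H := by have := Finset.mem_range.1 hj; omega
          refine add_le_add (amgm j _ ?_) (mul_le_mul_of_nonneg_left
            (untrustedMass_le hη hζ hreg (by omega) π) (by norm_num))
          exact L.sum_tOcc_mul_sq_le hη hζ hreg hsum (by omega) π
            (fun s a => sq_sum_abs_sub_le (fun _ => transProb_nonneg _ _ _ _ _ _)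
              (fun _ => transProb_nonneg _ _ _ _ _ _) (sum_transProb M c (by omega) s a)
              (sum_transProb Ms c (by omega) s a))
            (fun s a => sub_nonneg.2 (transAff_le_one _ _ _ _ _ _)) (L.trans_err j hj')
      _ ≤ ∑ j ∈ Finset.range H, (4 * (β * X + e j / β) +
          2 * ((Fintype.card S : ℝ) ^ 2 * Fintype.card A * (X / ζ))) := by
          refine Finset.sum_le_sum_of_subset_of_nonneg
            (Finset.range_subset_range.2 (by omega)) fun j _ _ => ?_
          have := L.err_nonneg j
          positivity
      _ = _ := by
          rw [Finset.sum_add_distrib, ← Finset.mul_sum, Finset.sum_add_distrib, ← Finset.sum_div, ← hE]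
          simp
  have hmain := Lolipop.abs_value_sub_le M s1 c η ζ reg Ms π
  have h1 : H * (4 * (H * (β * X) + E / β) +
      H * (2 * ((Fintype.card S : ℝ) ^ 2 * Fintype.card A * (X / ζ)))) =
      4 * H * (H * (β * X) + E / β) +
      2 * (H : ℝ) ^ 2 * ((Fintype.card S : ℝ) ^ 2 * Fintype.card A) / ζ * X := by ring
  have h2 : 2 * (H : ℝ) ^ 2 * ((Fintype.card S : ℝ) ^ 2 * Fintype.card A) / ζ * X ≤
      4 / 45 / η * X := mul_le_mul_of_nonneg_right hηζ hX
  have h3 : 0 ≤ H * (β * X) + E / β := by positivity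
  have h4 : 8 * H * (H * (β * X) + E / β) = X / (32 * η) + 2048 * (H : ℝ) ^ 3 * η * E := by
    rw [hβ]; field_simp; ring
  have h5 : |value M s1 c π - value Ms s1 c π| ≤ 8 * H * (H * (β * X) + E / β) + 4 / 45 / η * X := by
    have h6 := mul_le_mul_of_nonneg_left hG (show (0 : ℝ) ≤ H by linarith)
    rw [h1] at h6
    have h7 : 4 * (H * (β * X) + E / β) ≤ 4 * H * (H * (β * X) + E / β) := by
      nlinarith
    linarith
  rw [h4] at h5
  have h8 : X / (32 * η) + 4 / 45 / η * X ≤ X / (8 * η) := by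
    have h9 : X / (8 * η) - (X / (32 * η) + 4 / 45 / η * X) = (7 / 1440) * (X / η) := by
      field_simp; ring
    have : 0 ≤ X / η := by positivity
    linarith
  have h10 : X / (8 * η) = (Fintype.card S : ℝ) * Fintype.card A / (8 * η) + reg π / 8 := by
    rw [hXdef]; field_simp
  have h11 : 0 ≤ 64 * (H : ℝ) ^ 2 * ζ * E := by positivity
  rw [add_mul]
  linarith

end LayerCover

end CoverCore

/-! ### Measurability of the inverse gap weighting -/

section SumImage

/-- A sum over the distinct values of a family of random points is measurable. -/
lemma measurable_sum_image {Θ P ι : Type*} [MeasurableSpace Θ] [MeasurableSpace P] [MeasurableEq P]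
    [Fintype ι] [DecidableEq P] {p : ι → Θ → P} (hp : ∀ i, Measurable (p i))
    {g : Θ → P → ENNReal} (hg : ∀ i, Measurable fun θ => g θ (p i θ)) :
    Measurable fun θ => ∑ x ∈ Finset.univ.image (fun i => p i θ), g θ x := by
  have key : ∀ θ, ∑ x ∈ Finset.univ.image (fun i => p i θ), g θ x =
      ∑ i, g θ (p i θ) * (∑ j, if p j θ = p i θ then (1 : ENNReal) else 0)⁻¹ := by
    intro θ
    rw [← Finset.sum_fiberwise_of_maps_to (t := Finset.univ.image (fun i => p i θ))
      (g := fun i => p i θ) (fun i _ => Finset.mem_image_of_mem _ (Finset.mem_univ i))]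
    refine Finset.sum_congr rfl fun x hx => ?_
    obtain ⟨i₀, -, hi₀⟩ := Finset.mem_image.1 hx
    have h1 : ∀ i ∈ Finset.univ.filter (fun i => p i θ = x),
        g θ (p i θ) * (∑ j, if p j θ = p i θ then (1 : ENNReal) else 0)⁻¹ =
        g θ x * ((Finset.univ.filter fun i => p i θ = x).card : ENNReal)⁻¹ := by
      intro i hi
      rw [(Finset.mem_filter.1 hi).2, Finset.sum_boole]
    rw [Finset.sum_congr rfl h1, Finset.sum_const, nsmul_eq_mul, mul_left_comm,
      ENNReal.mul_inv_cancel, mul_one]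
    · have : 0 < (Finset.univ.filter fun i => p i θ = x).card :=
        Finset.card_pos.2 ⟨i₀, Finset.mem_filter.2 ⟨Finset.mem_univ _, hi₀⟩⟩
      exact_mod_cast this.ne'
    · exact ENNReal.natCast_ne_top _
  simp_rw [key]
  refine Finset.measurable_sum _ fun i _ => (hg i).mul (Measurable.inv ?_)
  exact Finset.measurable_sum _ fun j _ =>
    Measurable.ite (measurableSet_eq_fun (hp j) (hp i)) measurable_const measurable_const

end SumImage

section Igw

variable {Ω C S A : Type*} [MeasurableSpace C] [Fintype S] [Fintype A]
  [MeasurableSpace S] [MeasurableSpace A] {H : ℕ}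

instance : MeasurableEq (Policy S A H) := by
  constructor
  have : Set.diagonal (Policy S A H) =
      ⋂ (h : Fin H) (s : S) (a : A), {q | (q.1 h s).1 a = (q.2 h s).1 a} := by
    ext q
    simp only [Set.mem_diagonal_iff, Set.mem_iInter, Set.mem_ofPred_eq]
    refine ⟨fun h _ _ _ => by rw [h], fun h => ?_⟩
    funext i s
    exact Subtype.ext (funext fun a => h i s a)
  rw [this]
  refine MeasurableSet.iInter fun h => MeasurableSet.iInter fun s => MeasurableSet.iInter fun a => ?_
  exact measurableSet_eq_fun ((measurable_policy_apply h s a).comp measurable_fst)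
    ((measurable_policy_apply h s a).comp measurable_snd)

variable (X : RunData Ω C S A H) (M0 : CMDP C S A H) (s1 : S)

lemma regHat_nonneg (m : ℕ) (ω : Ω) (c : C) (π : Policy S A H) : 0 ≤ X.regHat M0 s1 m ω c π :=
  regret_nonneg _ _ _ _

lemma card_polCover_le (m : ℕ) (h : Fin H) (ω : Ω) (c : C) :
    (X.polCover m h ω c).card ≤ Fintype.card S * Fintype.card A + 1 := by
  classical
  refine (Finset.card_insert_le _ _).trans (Nat.succ_le_succ (Finset.card_image_le.trans ?_))
  rw [Finset.card_univ, Fintype.card_prod]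

lemma weight_nonneg {η : ℝ} (hη : 0 ≤ η) {m : ℕ} {h : Fin H} {ω : Ω} {c : C}
    (hlam : 0 < X.lam m h ω c) (π : Policy S A H) : 0 ≤ X.weight M0 s1 η m h ω c π := by
  have := mul_nonneg hη (regHat_nonneg X M0 s1 m ω c π)
  unfold RunData.weight
  positivity

lemma lintegral_igw (η : ℝ) (m : ℕ) (h : Fin H) (ω : Ω) (c : C) {F : Policy S A H → ENNReal}
    (hF : Measurable F) : ∫⁻ π, F π ∂(X.igw M0 s1 η m h ω c) =
      ∑ π ∈ X.polCover m h ω c, ENNReal.ofReal (X.weight M0 s1 η m h ω c π) * F π := by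
  unfold RunData.igw
  rw [lintegral_finsetSum_measure]
  refine Finset.sum_congr rfl fun π _ => ?_
  rw [lintegral_smul_measure, lintegral_dirac' _ hF, smul_eq_mul]

lemma lintegral_igw_const {η : ℝ} (hη : 0 ≤ η) {m : ℕ} {h : Fin H} {ω : Ω} {c : C}
    (hlam : 0 < X.lam m h ω c)
    (hsum : ∑ π ∈ X.polCover m h ω c, X.weight M0 s1 η m h ω c π = 1) (x : ENNReal) :
    ∫⁻ _, x ∂(X.igw M0 s1 η m h ω c) = x := by
  rw [lintegral_igw _ _ _ _ _ _ _ _ measurable_const, ← Finset.sum_mul,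
    ← ENNReal.ofReal_sum_of_nonneg fun π _ => weight_nonneg X M0 s1 hη hlam π, hsum]
  simp

/-- The covering policies together with the greedy policy, as a family. -/
noncomputable def coverFamily (m : ℕ) (h : Fin H) (i : Option (S × A)) (q : Ω × C) :
    Policy S A H :=
  match i with
  | none => X.greedy m q.1 q.2
  | some z => X.cover m h z.1 z.2 q.1 q.2

open Classical in
lemma polCover_eq_image (m : ℕ) (h : Fin H) (q : Ω × C) :
    X.polCover m h q.1 q.2 = Finset.univ.image fun i => coverFamily X m h i q := by
  ext π
  simp [RunData.polCover, coverFamily, Option.exists]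
  grind

variable [MeasurableSpace Ω]

/-- The hypotheses on the choices of an epoch `m` that make the inverse gap weighting of segment
`h` measurable. -/
structure MeasurableChoice (𝓜 : Finset (CMDP C S A H)) (η : ℝ) (m : ℕ) (h : Fin H) : Prop where
  eta_nonneg : 0 ≤ η
  greedy_meas : Measurable fun q : Ω × C => X.greedy m q.1 q.2
  cover_meas : ∀ s a, Measurable fun q : Ω × C => X.cover m h s a q.1 q.2
  greedy_max : ∀ ω c π, value (X.estModel M0 (m - 1) ω) s1 c π ≤
    value (X.estModel M0 (m - 1) ω) s1 c (X.greedy m ω c)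
  est_mem : m - 1 ≠ 0 → ∀ h ω, X.est (m - 1) h ω ∈ 𝓜
  est_meas : m - 1 ≠ 0 → ∀ h, ∀ M ∈ 𝓜, MeasurableSet {ω | X.est (m - 1) h ω = M}
  lam_pos : ∀ ω c, 0 < X.lam m h ω c
  lam_sum : ∀ ω c, ∑ π ∈ X.polCover m h ω c, X.weight M0 s1 η m h ω c π = 1

namespace MeasurableChoice

variable {X M0 s1} {𝓜 : Finset (CMDP C S A H)} {η : ℝ} {m : ℕ} {h : Fin H}

lemma measurable_value_estModel (hX : MeasurableChoice X M0 s1 𝓜 η m h)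
    {p : Ω × C → Policy S A H} (hp : Measurable p) :
    Measurable fun q : Ω × C => value (X.estModel M0 (m - 1) q.1) s1 q.2 (p q) := by
  classical
  have hpair : Measurable fun q : Ω × C => (q.2, p q) := measurable_snd.prodMk hp
  by_cases hm : m - 1 = 0
  · simp only [RunData.estModel, if_pos hm]
    exact ((measurable_value M0 s1).comp hpair :)
  · simp only [RunData.estModel, if_neg hm]
    have key : ∀ q : Ω × C, value (layerwise fun h => X.est (m - 1) h q.1) s1 q.2 (p q) =
        ∑ f ∈ Fintype.piFinset fun _ : Fin H => 𝓜,
          if q.1 ∈ ⋂ h, {ω | X.est (m - 1) h ω = f h} then value (layerwise f) s1 q.2 (p q)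
          else 0 := by
      intro q
      rw [Finset.sum_eq_single fun h => X.est (m - 1) h q.1]
      · rw [if_pos (by simp)]
      · intro f _ hf
        rw [if_neg]
        intro hq
        exact hf (funext fun h => (Set.mem_iInter.1 hq h).symm)
      · intro hq
        exact absurd (Fintype.mem_piFinset.2 fun h => hX.est_mem hm h q.1) hq
    simp_rw [key]
    refine Finset.measurable_sum _ fun f hf => Measurable.ite ?_
      ((measurable_value (layerwise f) s1).comp hpair :) measurable_const
    exact (MeasurableSet.iInter fun h => hX.est_meas hm h (f h)
      (Fintype.mem_piFinset.1 hf h)).preimage measurable_fst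

lemma measurable_regHat (hX : MeasurableChoice X M0 s1 𝓜 η m h)
    {p : Ω × C → Policy S A H} (hp : Measurable p) :
    Measurable fun q : Ω × C => X.regHat M0 s1 m q.1 q.2 (p q) := by
  have : ∀ q : Ω × C, X.regHat M0 s1 m q.1 q.2 (p q) =
      value (X.estModel M0 (m - 1) q.1) s1 q.2 (X.greedy m q.1 q.2) -
      value (X.estModel M0 (m - 1) q.1) s1 q.2 (p q) := fun q =>
    regret_eq_of_forall_le _ _ _ (hX.greedy_max q.1 q.2) _
  simp_rw [this]
  exact (hX.measurable_value_estModel hX.greedy_meas).sub (hX.measurable_value_estModel hp)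

lemma measurable_coverFamily (hX : MeasurableChoice X M0 s1 𝓜 η m h) (i : Option (S × A)) :
    Measurable (coverFamily X m h i) := by
  cases i with
  | none => exact hX.greedy_meas
  | some z => exact hX.cover_meas z.1 z.2

lemma lam_lt_iff (hX : MeasurableChoice X M0 s1 𝓜 η m h) (q : Ω × C) {x : ℝ} (hx : 0 < x) :
    X.lam m h q.1 q.2 < x ↔
      ∑ π ∈ X.polCover m h q.1 q.2, ENNReal.ofReal (1 / (x + η * X.regHat M0 s1 m q.1 q.2 π)) <
        1 := by
  have hr : ∀ π, 0 ≤ η * X.regHat M0 s1 m q.1 q.2 π := fun π =>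
    mul_nonneg hX.eta_nonneg (regHat_nonneg X M0 s1 m q.1 q.2 π)
  have hlam := hX.lam_pos q.1 q.2
  have hsum := hX.lam_sum q.1 q.2
  rw [← ENNReal.ofReal_sum_of_nonneg fun π _ => by have := hr π; positivity,
    ENNReal.ofReal_lt_one]
  unfold RunData.weight at hsum
  constructor
  · intro hlt
    refine lt_of_lt_of_eq (Finset.sum_lt_sum_of_nonempty ⟨X.greedy m q.1 q.2, ?_⟩
      fun π _ => ?_) hsum
    · exact Finset.mem_insert_self _ _
    · have := hr π
      exact one_div_lt_one_div_of_lt (by linarith) (by linarith)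
  · intro hlt
    by_contra hge
    push Not at hge
    refine absurd hlt (not_lt.2 (hsum.symm.trans_le (Finset.sum_le_sum fun π _ => ?_)))
    have := hr π
    exact one_div_le_one_div_of_le (by linarith) (by linarith)

/-- The normalization is measurable because it is the unique solution of a monotone equation. -/
lemma measurable_lam (hX : MeasurableChoice X M0 s1 𝓜 η m h) :
    Measurable fun q : Ω × C => X.lam m h q.1 q.2 := by
  classical
  refine measurable_of_Iio fun x => ?_
  rcases le_or_gt x 0 with hx | hx
  · have : (fun q : Ω × C => X.lam m h q.1 q.2) ⁻¹' Set.Iio x = ∅ := by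
      ext q
      simp only [Set.mem_preimage, Set.mem_Iio, Set.mem_empty_iff_false, iff_false, not_lt]
      exact hx.trans (hX.lam_pos q.1 q.2).le
    rw [this]; exact MeasurableSet.empty
  · have : (fun q : Ω × C => X.lam m h q.1 q.2) ⁻¹' Set.Iio x = {q |
        ∑ π ∈ Finset.univ.image (fun i => coverFamily X m h i q),
          ENNReal.ofReal (1 / (x + η * X.regHat M0 s1 m q.1 q.2 π)) < 1} := by
      ext q
      rw [Set.mem_preimage, Set.mem_Iio, hX.lam_lt_iff q hx, polCover_eq_image X m h q]
      rfl
    rw [this]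
    refine measurableSet_lt (measurable_sum_image (fun i => hX.measurable_coverFamily i)
      (g := fun q π => ENNReal.ofReal (1 / (x + η * X.regHat M0 s1 m q.1 q.2 π)))
      fun i => ?_) measurable_const
    have := hX.measurable_regHat (hX.measurable_coverFamily i)
    exact (measurable_const.div (measurable_const.add (this.const_mul η))).ennreal_ofReal

lemma measurable_lintegral_igw (hX : MeasurableChoice X M0 s1 𝓜 η m h)
    {F : C × Policy S A H → ENNReal} (hF : Measurable F) :
    Measurable fun q : Ω × C => ∫⁻ π, F (q.2, π) ∂(X.igw M0 s1 η m h q.1 q.2) := by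
  classical
  have key : ∀ q : Ω × C, ∫⁻ π, F (q.2, π) ∂(X.igw M0 s1 η m h q.1 q.2) =
      ∑ π ∈ Finset.univ.image (fun i => coverFamily X m h i q),
        ENNReal.ofReal (X.weight M0 s1 η m h q.1 q.2 π) * F (q.2, π) := by
    intro q
    have h1 : Measurable fun π : Policy S A H => (q.2, π) := measurable_prodMk_left
    have h2 : Measurable fun π : Policy S A H => F (q.2, π) := (hF.comp h1 :)
    rw [lintegral_igw _ _ _ _ _ _ _ _ h2, polCover_eq_image X m h q]
  simp_rw [key]
  refine measurable_sum_image (fun i => hX.measurable_coverFamily i)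
    (g := fun q π => ENNReal.ofReal (X.weight M0 s1 η m h q.1 q.2 π) * F (q.2, π)) fun i => ?_
  have hp := hX.measurable_coverFamily i
  have h1 := hX.measurable_regHat hp
  have h2 : Measurable fun q : Ω × C => (q.2, coverFamily X m h i q) := measurable_snd.prodMk hp
  refine Measurable.mul (Measurable.ennreal_ofReal ?_) (hF.comp h2 :)
  unfold RunData.weight
  exact measurable_const.div (hX.measurable_lam.add (h1.const_mul η))

lemma measurable_lintegral_lintegral_igw (hX : MeasurableChoice X M0 s1 𝓜 η m h)
    (𝒟 : Measure C) [SFinite 𝒟] {F : C × Policy S A H → ENNReal} (hF : Measurable F) :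
    Measurable fun ω => ∫⁻ c, ∫⁻ π, F (c, π) ∂(X.igw M0 s1 η m h ω c) ∂𝒟 :=
  (hX.measurable_lintegral_igw hF).lintegral_prod_right'

end MeasurableChoice

end Igw

/-! ### The schedule -/

lemma tau_zero : tau 0 = 0 := rfl

lemma tau_of_pos {m : ℕ} (hm : 1 ≤ m) : tau m = 2 ^ m := by
  simp [tau, show m ≠ 0 by omega]

lemma tau_mono : Monotone tau := by
  refine monotone_nat_of_le_succ fun m => ?_
  rcases Nat.eq_zero_or_pos m with rfl | hm
  · simp [tau]
  · rw [tau_of_pos hm, tau_of_pos (by omega)]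
    exact Nat.pow_le_pow_right (by norm_num) (by omega)

lemma segStart_zero (H m : ℕ) : segStart H m 0 = tau (m - 1) * H := by simp [segStart]

lemma segStart_last {H m : ℕ} : segStart H m H = tau m * H := by
  have := tau_mono (show m - 1 ≤ m by omega)
  unfold segStart
  rw [← add_mul]
  congr 1; omega

lemma segStart_mono (H m : ℕ) : Monotone (segStart H m) := fun a b hab => by
  unfold segStart
  exact Nat.add_le_add_left (Nat.mul_le_mul_left _ hab) _

lemma segStart_succ (H m h : ℕ) :
    segStart H m (h + 1) = segStart H m h + (tau m - tau (m - 1)) := by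
  unfold segStart; ring

/-! ### Consequences of the round law -/

section RoundLaw

lemma measurable_fun_mul {Ω : Type*} {m : MeasurableSpace Ω} {f g : Ω → ENNReal}
    (hf : Measurable[m] f) (hg : Measurable[m] g) : Measurable[m] fun ω => f ω * g ω :=
  hf.mul hg

/-- An inequality between integrals over all sets of a sub-σ-algebra extends to integrals against
nonnegative functions. -/
lemma lintegral_mul_le_of_forall_setLIntegral_le {Ω : Type*} {G mΩ : MeasurableSpace Ω}
    (hG : G ≤ mΩ) {μ : Measure Ω} {φ ψ : Ω → ENNReal} (hφ : Measurable φ) (hψ : Measurable ψ)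
    (h : ∀ B, MeasurableSet[G] B → ∫⁻ ω in B, φ ω ∂μ ≤ ∫⁻ ω in B, ψ ω ∂μ)
    {g : Ω → ENNReal} (hg : Measurable[G] g) :
    ∫⁻ ω, g ω * φ ω ∂μ ≤ ∫⁻ ω, g ω * ψ ω ∂μ := by
  have hle : (μ.withDensity φ).trim hG ≤ (μ.withDensity ψ).trim hG := by
    refine Measure.le_iff.2 fun B hB => ?_
    rw [trim_measurableSet_eq hG hB, trim_measurableSet_eq hG hB, withDensity_apply _ (hG B hB),
      withDensity_apply _ (hG B hB)]
    exact h B hB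
  have e : ∀ {χ : Ω → ENNReal}, Measurable χ →
      ∫⁻ ω, g ω * χ ω ∂μ = ∫⁻ ω, g ω ∂((μ.withDensity χ).trim hG) := by
    intro χ hχ
    rw [lintegral_trim hG hg, lintegral_withDensity_eq_lintegral_mul _ hχ (hg.mono hG le_rfl)]
    exact lintegral_congr fun ω => mul_comm _ _
  rw [e hφ, e hψ]
  exact lintegral_mono' hle le_rfl

variable {Ω C S A : Type*} [MeasurableSpace C] [Fintype S] [Fintype A]
  [MeasurableSpace S] [MeasurableSpace A] {H : ℕ}

lemma trajLaw_univ (M : CMDP C S A H) (hH : 1 ≤ H) (s1 : S) (c : C) (π : Policy S A H) :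
    trajLaw M s1 c π Set.univ = 1 := by
  have h1 := lintegral_trajLaw M s1 c π (f := fun _ => 1) measurable_const
  simp only [lintegral_const, measure_univ, mul_one, one_mul] at h1
  rw [h1, ← ENNReal.ofReal_sum_of_nonneg fun x _ => pathProb_nonneg _ _ _ _ _,
    sum_pathProb _ _ _ _ hH]
  simp

variable [mΩ : MeasurableSpace Ω] {μ : Measure Ω} {ℱ : Filtration ℕ mΩ} {𝒟 : Measure C}
  {s1 : S} {𝓜 : Finset (CMDP C S A H)} {Mstar M0 : CMDP C S A H} {η ζ : ℕ → ℝ} {T : ℕ}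
  {X : RunData Ω C S A H}

/-- The observation of round `t`. -/
def RunData.obs (X : RunData Ω C S A H) (t : ℕ) (ω : Ω) : C × Policy S A H × Traj S A H :=
  (X.ctx t ω, X.pol t ω, X.traj t ω)

namespace IsRun

lemma measurable_obs (hX : IsRun μ ℱ 𝒟 s1 𝓜 Mstar M0 η ζ T X) {t : ℕ} (ht : t < T) :
    Measurable[ℱ (t + 1)] (X.obs t) := by
  have h1 := hX.ctx_meas t ht
  have h2 := hX.pol_meas t ht
  have h3 := hX.traj_meas t ht
  exact h1.prodMk (h2.prodMk h3)

lemma measurableChoice (hX : IsRun μ ℱ 𝒟 s1 𝓜 Mstar M0 η ζ T X) (hη : ∀ m, 0 ≤ η m) {m : ℕ}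
    (hm : 1 ≤ m) (h : Fin H) (hT : segStart H m h < T) :
    @MeasurableChoice Ω C S A _ _ _ _ _ H X M0 s1 (ℱ (segStart H m h)) 𝓜 (η m) m h := by
  have h0 : segStart H m 0 ≤ segStart H m h := segStart_mono H m (Nat.zero_le _)
  have hcomp : ∀ h' : Fin H, m - 1 ≠ 0 → segStart H (m - 1) (h' + 1) ≤ segStart H m 0 := by
    intro h' _
    rw [segStart_zero, ← segStart_last]
    exact segStart_mono H (m - 1) h'.isLt
  have hprod : ∀ {a b : ℕ}, a ≤ b → (ℱ a).prod (inferInstance : MeasurableSpace C) ≤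
      (ℱ b).prod (inferInstance : MeasurableSpace C) := fun hab =>
    sup_le_sup (MeasurableSpace.comap_mono (ℱ.mono hab)) le_rfl
  refine @MeasurableChoice.mk Ω C S A _ _ _ _ _ H X M0 s1 (ℱ (segStart H m h)) 𝓜 (η m) m h (hη m)
    ?_ ?_ ?_ ?_ ?_ ?_ ?_
  · exact (hX.greedy_meas m hm (h0.trans_lt hT)).mono (hprod h0) le_rfl
  · exact fun s a => hX.cover_meas m hm h hT s a
  · exact hX.greedy_max m hm (h0.trans_lt hT)
  · intro hm1 h' ω
    exact (hX.est_mle (m - 1) (by omega) h'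
      (((hcomp h' hm1).trans h0).trans hT.le) ω).1
  · intro hm1 h' M hM
    exact ℱ.mono ((hcomp h' hm1).trans h0) _ (hX.est_meas (m - 1) (by omega) h'
      (((hcomp h' hm1).trans h0).trans hT.le) M hM)
  · exact hX.lam_pos m hm h hT
  · exact hX.lam_sum m hm h hT

lemma measurable_inner [SFinite 𝒟] (hX : IsRun μ ℱ 𝒟 s1 𝓜 Mstar M0 η ζ T X) (hη : ∀ m, 0 ≤ η m)
    {m : ℕ} (hm : 1 ≤ m) (h : Fin H) (hT : segStart H m h < T)
    {F : C × Policy S A H → ENNReal} (hF : Measurable F) :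
    Measurable[ℱ (segStart H m h)] fun ω =>
      ∫⁻ c, ∫⁻ π, F (c, π) ∂(X.igw M0 s1 (η m) m h ω c) ∂𝒟 :=
  @MeasurableChoice.measurable_lintegral_lintegral_igw Ω C S A _ _ _ _ _ H X M0 s1
    (ℱ (segStart H m h)) 𝓜 (η m) m h (hX.measurableChoice hη hm h hT) 𝒟 _ F hF

lemma lintegral_mul_obs_le [SFinite 𝒟] (hX : IsRun μ ℱ 𝒟 s1 𝓜 Mstar M0 η ζ T X)
    (hη : ∀ m, 0 ≤ η m) {m : ℕ} (hm : 1 ≤ m) (h : Fin H) {t : ℕ} (ht : t ∈ segment H m h)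
    (hT : t < T) {f : C × Policy S A H × Traj S A H → ENNReal} (hf : Measurable f)
    {F : C × Policy S A H → ENNReal} (hF : Measurable F)
    (hfF : ∀ c π, ∫⁻ y, f (c, π, y) ∂(trajLaw Mstar s1 c π) ≤ F (c, π))
    {g : Ω → ENNReal} (hg : Measurable[ℱ t] g) :
    ∫⁻ ω, g ω * f (X.obs t ω) ∂μ ≤
      ∫⁻ ω, g ω * ∫⁻ c, ∫⁻ π, F (c, π) ∂(X.igw M0 s1 (η m) m h ω c) ∂𝒟 ∂μ := by
  have hst : segStart H m h ≤ t := (Finset.mem_Ico.1 ht).1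
  refine lintegral_mul_le_of_forall_setLIntegral_le (ℱ.le t)
    (hf.comp ((hX.measurable_obs hT).mono (ℱ.le _) le_rfl))
    ((hX.measurable_inner hη hm h (hst.trans_lt hT) hF).mono (ℱ.le _) le_rfl) (fun B hB => ?_) hg
  refine (hX.round_law m hm h t ht hT B hB f hf).trans_le ?_
  exact lintegral_mono fun ω => lintegral_mono fun c => lintegral_mono fun π => hfF c π

end IsRun

end RoundLaw

/-! ### Maximum likelihood -/

section Mle

variable {Ω C S A : Type*} [MeasurableSpace C] [Fintype S] [Fintype A]
  [MeasurableSpace S] [MeasurableSpace A] {H : ℕ}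

lemma ennreal_pow_mul_exp_le_one {x : ENNReal} (hx : x ≤ 1) (n : ℕ) :
    ENNReal.ofReal (Real.exp (n * (1 - x.toReal))) * x ^ n ≤ 1 := by
  have hxt : x ≠ ⊤ := (hx.trans_lt ENNReal.one_lt_top).ne
  rw [← ENNReal.ofReal_toReal hxt, ENNReal.toReal_ofReal ENNReal.toReal_nonneg,
    ← ENNReal.ofReal_pow ENNReal.toReal_nonneg, ← ENNReal.ofReal_mul (Real.exp_pos _).le,
    ENNReal.ofReal_le_one, Real.exp_nat_mul, ← mul_pow]
  refine pow_le_one₀ (mul_nonneg (Real.exp_pos _).le ENNReal.toReal_nonneg) ?_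
  have h1 := Real.add_one_le_exp (x.toReal - 1)
  calc Real.exp (1 - x.toReal) * x.toReal ≤
        Real.exp (1 - x.toReal) * Real.exp (x.toReal - 1) := by gcongr; linarith
    _ = 1 := by rw [← Real.exp_add]; simp

/-- The average trajectory affinity of the models `M` and `Ms` in the rounds of segment `h` of
epoch `m`. -/
noncomputable def segAff (X : RunData Ω C S A H) (𝓜 : Finset (CMDP C S A H))
    (M0 Ms : CMDP C S A H) (s1 : S) (𝒟 : Measure C) (η : ℝ) (m : ℕ) (h : Fin H)
    (M : CMDP C S A H) (ω : Ω) : ENNReal :=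
  ∫⁻ c, ∫⁻ π, ENNReal.ofReal (aff 𝓜 M Ms s1 c π) ∂(X.igw M0 s1 η m h ω c) ∂𝒟

/-- The square root of the likelihood ratio of an observation. -/
noncomputable def sqrtRatio (𝓜 : Finset (CMDP C S A H)) (Ms : CMDP C S A H) (s1 : S)
    (M : CMDP C S A H) (q : C × Policy S A H × Traj S A H) : ENNReal :=
  (density 𝓜 M s1 q.1 q.2.1 q.2.2 / density 𝓜 Ms s1 q.1 q.2.1 q.2.2) ^ (1 / 2 : ℝ)

/-- The sum over the model class of the exponentially compensated likelihood ratios of a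
segment. -/
noncomputable def segLikelihood (X : RunData Ω C S A H) (𝓜 : Finset (CMDP C S A H))
    (M0 Ms : CMDP C S A H) (s1 : S) (𝒟 : Measure C) (η : ℝ) (m : ℕ) (h : Fin H) (ω : Ω) :
    ENNReal :=
  ∑ M ∈ 𝓜, ENNReal.ofReal (Real.exp ((tau m - tau (m - 1) : ℕ) *
      (1 - (segAff X 𝓜 M0 Ms s1 𝒟 η m h M ω).toReal))) *
    ∏ t ∈ segment H m h, sqrtRatio 𝓜 Ms s1 M (X.obs t ω)

variable [MeasurableSingletonClass S] [MeasurableSingletonClass A]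

lemma measurable_sqrtRatio (𝓜 : Finset (CMDP C S A H)) (Ms : CMDP C S A H) (s1 : S)
    (M : CMDP C S A H) : Measurable (sqrtRatio 𝓜 Ms s1 M) :=
  ((measurable_density M s1).div (measurable_density Ms s1)).pow_const _

variable [mΩ : MeasurableSpace Ω] {μ : Measure Ω} [IsProbabilityMeasure μ]
  {ℱ : Filtration ℕ mΩ} {𝒟 : Measure C} [IsProbabilityMeasure 𝒟]
  {s1 : S} {𝓜 : Finset (CMDP C S A H)} {Mstar M0 : CMDP C S A H} {η ζ : ℕ → ℝ} {T : ℕ}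
  {X : RunData Ω C S A H}

namespace IsRun

lemma lintegral_mul_prod_sqrtRatio_le (hX : IsRun μ ℱ 𝒟 s1 𝓜 Mstar M0 η ζ T X)
    (hη : ∀ m, 0 ≤ η m) (hMs : Mstar ∈ 𝓜) {m : ℕ} (hm : 1 ≤ m) (h : Fin H)
    (hT : segStart H m (h + 1) ≤ T) {M : CMDP C S A H} (hM : M ∈ 𝓜) {k : ℕ}
    (hk : k ≤ tau m - tau (m - 1)) {g : Ω → ENNReal} (hg : Measurable[ℱ (segStart H m h)] g) :
    ∫⁻ ω, g ω * ∏ t ∈ Finset.Ico (segStart H m h) (segStart H m h + k),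
        sqrtRatio 𝓜 Mstar s1 M (X.obs t ω) ∂μ ≤
      ∫⁻ ω, g ω * segAff X 𝓜 M0 Mstar s1 𝒟 (η m) m h M ω ^ k ∂μ := by
  rw [segStart_succ] at hT
  induction k generalizing g with
  | zero => simp
  | succ k ih =>
    set a := segStart H m h with ha
    have haT : a < T := by omega
    have hmF : Measurable fun q : C × Policy S A H => ENNReal.ofReal (aff 𝓜 M Mstar s1 q.1 q.2) :=
      (measurable_aff s1).ennreal_ofReal
    have hφ : Measurable[ℱ a] fun ω => segAff X 𝓜 M0 Mstar s1 𝒟 (η m) m h M ω :=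
      hX.measurable_inner hη hm h haT hmF
    have hg' : Measurable[ℱ (a + k)] fun ω => g ω *
        ∏ t ∈ Finset.Ico a (a + k), sqrtRatio 𝓜 Mstar s1 M (X.obs t ω) := by
      refine measurable_fun_mul (hg.mono (ℱ.mono (by omega)) le_rfl)
        (@Finset.measurable_prod _ _ _ _ _ _ (ℱ (a + k)) _ _ fun t ht => ?_)
      have ht' := Finset.mem_Ico.1 ht
      exact (measurable_sqrtRatio 𝓜 Mstar s1 M).comp
        ((hX.measurable_obs (show t < T by omega)).mono
          (ℱ.mono (show t + 1 ≤ a + k by omega)) le_rfl)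
    have h1 := hX.lintegral_mul_obs_le hη hm h (t := a + k)
      (Finset.mem_Ico.2 ⟨by omega, by rw [segStart_succ]; omega⟩) (by omega)
      (measurable_sqrtRatio 𝓜 Mstar s1 M) hmF
      (fun c π => lintegral_sqrt_likelihoodRatio_le hM hMs s1 c π) hg'
    have h2 := ih (g := fun ω => g ω * segAff X 𝓜 M0 Mstar s1 𝒟 (η m) m h M ω) (by omega)
      (measurable_fun_mul hg hφ)
    calc ∫⁻ ω, g ω * ∏ t ∈ Finset.Ico a (a + (k + 1)), sqrtRatio 𝓜 Mstar s1 M (X.obs t ω) ∂μ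
        = ∫⁻ ω, (g ω * ∏ t ∈ Finset.Ico a (a + k), sqrtRatio 𝓜 Mstar s1 M (X.obs t ω)) *
            sqrtRatio 𝓜 Mstar s1 M (X.obs (a + k) ω) ∂μ := by
          refine lintegral_congr fun ω => ?_
          rw [← add_assoc, Finset.prod_Ico_succ_top (by omega), mul_assoc]
      _ ≤ _ := h1
      _ = ∫⁻ ω, g ω * segAff X 𝓜 M0 Mstar s1 𝒟 (η m) m h M ω *
            ∏ t ∈ Finset.Ico a (a + k), sqrtRatio 𝓜 Mstar s1 M (X.obs t ω) ∂μ :=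
          lintegral_congr fun ω => mul_right_comm _ _ _
      _ ≤ _ := h2
      _ = _ := lintegral_congr fun ω => by rw [pow_succ]; ring

lemma segAff_le_one (hX : IsRun μ ℱ 𝒟 s1 𝓜 Mstar M0 η ζ T X)
    (hη : ∀ m, 0 ≤ η m) (hMs : Mstar ∈ 𝓜) {m : ℕ} (hm : 1 ≤ m) (h : Fin H)
    (hT : segStart H m h < T) {M : CMDP C S A H} (hM : M ∈ 𝓜) (ω : Ω) :
    segAff X 𝓜 M0 Mstar s1 𝒟 (η m) m h M ω ≤ 1 := by
  have hH : 1 ≤ H := by have := h.isLt; omega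
  calc segAff X 𝓜 M0 Mstar s1 𝒟 (η m) m h M ω
      ≤ ∫⁻ c, ∫⁻ _, 1 ∂(X.igw M0 s1 (η m) m h ω c) ∂𝒟 :=
        lintegral_mono fun c => lintegral_mono fun π =>
          ENNReal.ofReal_le_one.2 (aff_le_one hM hMs hH s1 c π)
    _ = ∫⁻ _, 1 ∂𝒟 := lintegral_congr fun c => lintegral_igw_const X M0 s1 (hη m)
        (hX.lam_pos m hm h hT ω c) (hX.lam_sum m hm h hT ω c) 1
    _ = 1 := by simp

lemma measurable_segAff (hX : IsRun μ ℱ 𝒟 s1 𝓜 Mstar M0 η ζ T X) (hη : ∀ m, 0 ≤ η m)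
    {m : ℕ} (hm : 1 ≤ m) (h : Fin H) (hT : segStart H m h < T) (M : CMDP C S A H) :
    Measurable[ℱ (segStart H m h)] fun ω => segAff X 𝓜 M0 Mstar s1 𝒟 (η m) m h M ω :=
  hX.measurable_inner hη hm h hT (F := fun q => ENNReal.ofReal (aff 𝓜 M Mstar s1 q.1 q.2))
    (measurable_aff s1).ennreal_ofReal

lemma measurable_compensator (hX : IsRun μ ℱ 𝒟 s1 𝓜 Mstar M0 η ζ T X) (hη : ∀ m, 0 ≤ η m)
    {m : ℕ} (hm : 1 ≤ m) (h : Fin H) (hT : segStart H m h < T) (M : CMDP C S A H) :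
    Measurable[ℱ (segStart H m h)] fun ω =>
      ENNReal.ofReal (Real.exp ((tau m - tau (m - 1) : ℕ) *
        (1 - (segAff X 𝓜 M0 Mstar s1 𝒟 (η m) m h M ω).toReal))) := by
  have h1 : Measurable fun x : ENNReal =>
      ENNReal.ofReal (Real.exp ((tau m - tau (m - 1) : ℕ) * (1 - x.toReal))) := by fun_prop
  exact h1.comp (hX.measurable_segAff hη hm h hT M)

lemma measurable_segLikelihood (hX : IsRun μ ℱ 𝒟 s1 𝓜 Mstar M0 η ζ T X) (hη : ∀ m, 0 ≤ η m)
    {m : ℕ} (hm : 1 ≤ m) (h : Fin H) (hT : segStart H m (h + 1) ≤ T)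
    (hlt : tau (m - 1) < tau m) :
    Measurable[ℱ (segStart H m (h + 1))] (segLikelihood X 𝓜 M0 Mstar s1 𝒟 (η m) m h) := by
  have hs := segStart_succ H m h
  refine @Finset.measurable_sum _ _ _ _ _ _ (ℱ (segStart H m (h + 1))) _ _ fun M _ => ?_
  refine measurable_fun_mul
    ((hX.measurable_compensator hη hm h (by omega) M).mono (ℱ.mono (by omega)) le_rfl)
    (@Finset.measurable_prod _ _ _ _ _ _ (ℱ (segStart H m (h + 1))) _ _ fun t ht => ?_)
  have ht' := Finset.mem_Ico.1 ht
  exact (measurable_sqrtRatio 𝓜 Mstar s1 M).comp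
    ((hX.measurable_obs (show t < T by omega)).mono
      (ℱ.mono (show t + 1 ≤ segStart H m (h + 1) by omega)) le_rfl)

lemma lintegral_mul_segLikelihood_le (hX : IsRun μ ℱ 𝒟 s1 𝓜 Mstar M0 η ζ T X)
    (hη : ∀ m, 0 ≤ η m) (hMs : Mstar ∈ 𝓜) {m : ℕ} (hm : 1 ≤ m) (h : Fin H)
    (hT : segStart H m (h + 1) ≤ T) (hlt : tau (m - 1) < tau m)
    {g : Ω → ENNReal} (hg : Measurable[ℱ (segStart H m h)] g) :
    ∫⁻ ω, g ω * segLikelihood X 𝓜 M0 Mstar s1 𝒟 (η m) m h ω ∂μ ≤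
      𝓜.card * ∫⁻ ω, g ω ∂μ := by
  have hs := segStart_succ H m h
  have hstart : segStart H m h < T := by omega
  set n := tau m - tau (m - 1) with hn
  set E : CMDP C S A H → Ω → ENNReal := fun M ω => ENNReal.ofReal (Real.exp ((n : ℕ) *
      (1 - (segAff X 𝓜 M0 Mstar s1 𝒟 (η m) m h M ω).toReal))) with hE
  have hEm : ∀ M, Measurable[ℱ (segStart H m h)] (E M) := fun M =>
    hX.measurable_compensator hη hm h hstart M
  have hterm : ∀ M ∈ 𝓜, ∫⁻ ω, g ω * (E M ω *
      ∏ t ∈ segment H m h, sqrtRatio 𝓜 Mstar s1 M (X.obs t ω)) ∂μ ≤ ∫⁻ ω, g ω ∂μ := by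
    intro M hM
    have h1 := hX.lintegral_mul_prod_sqrtRatio_le hη hMs hm h hT hM (k := n) le_rfl
      (g := fun ω => g ω * E M ω) (measurable_fun_mul hg (hEm M))
    rw [← hs] at h1
    calc _ = ∫⁻ ω, g ω * E M ω *
          ∏ t ∈ segment H m h, sqrtRatio 𝓜 Mstar s1 M (X.obs t ω) ∂μ :=
          lintegral_congr fun ω => (mul_assoc _ _ _).symm
      _ ≤ _ := h1
      _ ≤ ∫⁻ ω, g ω ∂μ := by
          refine lintegral_mono fun ω => ?_
          rw [mul_assoc]
          exact mul_le_of_le_one_right' (ennreal_pow_mul_exp_le_one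
            (hX.segAff_le_one hη hMs hm h hstart hM ω) n)
  have hmeas : ∀ M ∈ 𝓜, Measurable fun ω => g ω * (E M ω *
      ∏ t ∈ segment H m h, sqrtRatio 𝓜 Mstar s1 M (X.obs t ω)) := by
    intro M _
    refine (hg.mono (ℱ.le _) le_rfl).mul (((hEm M).mono (ℱ.le _) le_rfl).mul
      (Finset.measurable_prod _ fun t ht => ?_))
    have ht' := Finset.mem_Ico.1 ht
    exact (measurable_sqrtRatio 𝓜 Mstar s1 M).comp
      ((hX.measurable_obs (show t < T by omega)).mono (ℱ.le _) le_rfl)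
  calc _ = ∫⁻ ω, ∑ M ∈ 𝓜, g ω * (E M ω *
          ∏ t ∈ segment H m h, sqrtRatio 𝓜 Mstar s1 M (X.obs t ω)) ∂μ :=
        lintegral_congr fun ω => by rw [segLikelihood, Finset.mul_sum]
    _ = ∑ M ∈ 𝓜, ∫⁻ ω, g ω * (E M ω *
          ∏ t ∈ segment H m h, sqrtRatio 𝓜 Mstar s1 M (X.obs t ω)) ∂μ :=
        lintegral_finsetSum' _ fun M hM => (hmeas M hM).aemeasurable
    _ ≤ ∑ _M ∈ 𝓜, ∫⁻ ω, g ω ∂μ := Finset.sum_le_sum hterm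
    _ = _ := by rw [Finset.sum_const, nsmul_eq_mul]

/-- The product of the likelihood sums over the segments of an epoch has bounded expectation. -/
lemma lintegral_prod_segLikelihood_le (hX : IsRun μ ℱ 𝒟 s1 𝓜 Mstar M0 η ζ T X)
    (hη : ∀ m, 0 ≤ η m) (hMs : Mstar ∈ 𝓜) {m : ℕ} (hm : 1 ≤ m) (hT : tau m * H ≤ T)
    (hlt : tau (m - 1) < tau m) :
    ∫⁻ ω, ∏ h, segLikelihood X 𝓜 M0 Mstar s1 𝒟 (η m) m h ω ∂μ ≤ (𝓜.card : ENNReal) ^ H := by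
  set L : ℕ → Ω → ENNReal := fun k ω =>
    if hk : k < H then segLikelihood X 𝓜 M0 Mstar s1 𝒟 (η m) m ⟨k, hk⟩ ω else 1 with hL
  have hseg : ∀ k < H, segStart H m (k + 1) ≤ T := fun k hk => by
    rw [← segStart_last] at hT
    exact (segStart_mono H m hk).trans hT
  have hLm : ∀ k, ∀ (hk : k < H), Measurable[ℱ (segStart H m (k + 1))] (L k) := by
    intro k hk
    have : L k = segLikelihood X 𝓜 M0 Mstar s1 𝒟 (η m) m ⟨k, hk⟩ := by
      funext ω; simp only [hL, dif_pos hk]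
    rw [this]
    exact hX.measurable_segLikelihood hη hm ⟨k, hk⟩ (hseg k hk) hlt
  have key : ∀ k ≤ H, ∫⁻ ω, ∏ j ∈ Finset.range k, L j ω ∂μ ≤ (𝓜.card : ENNReal) ^ k := by
    intro k
    induction k with
    | zero => simp
    | succ k ih =>
      intro hk
      have hk' : k < H := hk
      have hg : Measurable[ℱ (segStart H m k)] fun ω => ∏ j ∈ Finset.range k, L j ω := by
        refine @Finset.measurable_prod _ _ _ _ _ _ (ℱ (segStart H m k)) _ _ fun j hj => ?_
        have hj' := Finset.mem_range.1 hj
        exact (hLm j (by omega)).mono (ℱ.mono (segStart_mono H m (by omega))) le_rfl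
      have h1 := hX.lintegral_mul_segLikelihood_le hη hMs hm ⟨k, hk'⟩ (hseg k hk') hlt hg
      calc ∫⁻ ω, ∏ j ∈ Finset.range (k + 1), L j ω ∂μ
          = ∫⁻ ω, (∏ j ∈ Finset.range k, L j ω) *
              segLikelihood X 𝓜 M0 Mstar s1 𝒟 (η m) m ⟨k, hk'⟩ ω ∂μ := by
            refine lintegral_congr fun ω => ?_
            rw [Finset.prod_range_succ]
            simp only [hL, dif_pos hk']
        _ ≤ _ := h1
        _ ≤ 𝓜.card * (𝓜.card : ENNReal) ^ k := by gcongr; exact ih (by omega)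
        _ = _ := (pow_succ' _ _).symm
  have h2 := key H le_rfl
  refine le_trans (le_of_eq (lintegral_congr fun ω => ?_)) h2
  rw [← Fin.prod_univ_eq_prod_range (fun j => L j ω)]
  refine Finset.prod_congr rfl fun h _ => ?_
  simp only [hL, dif_pos h.isLt]

lemma ae_density_ne (hX : IsRun μ ℱ 𝒟 s1 𝓜 Mstar M0 η ζ T X) (hMs : Mstar ∈ 𝓜) {m : ℕ}
    (hm : 1 ≤ m) (h : Fin H) {t : ℕ} (ht : t ∈ segment H m h) (hT : t < T) :
    ∀ᵐ ω ∂μ, density 𝓜 Mstar s1 (X.ctx t ω) (X.pol t ω) (X.traj t ω) ≠ 0 ∧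
      density 𝓜 Mstar s1 (X.ctx t ω) (X.pol t ω) (X.traj t ω) ≠ ⊤ := by
  set D : Set (C × Policy S A H × Traj S A H) :=
    {q | density 𝓜 Mstar s1 q.1 q.2.1 q.2.2 = 0 ∨ density 𝓜 Mstar s1 q.1 q.2.1 q.2.2 = ⊤} with hD
  have hm' := measurable_density (𝓜 := 𝓜) Mstar s1
  have hs : MeasurableSet D :=
    (hm' (measurableSet_singleton 0)).union (hm' (measurableSet_singleton ⊤))
  have h1 := hX.round_law m hm h t ht hT Set.univ (@MeasurableSet.univ _ (ℱ t))
    (D.indicator 1) (measurable_one.indicator hs)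
  have h2 : ∀ c π, ∫⁻ y, D.indicator 1 (c, π, y) ∂(trajLaw Mstar s1 c π) = (0 : ENNReal) :=
    fun c π => lintegral_density_eq_zero_or_top hMs s1 c π
  simp only [h2, lintegral_zero] at h1
  rw [Measure.restrict_univ, lintegral_eq_zero_iff] at h1
  · filter_upwards [h1] with ω hω
    have h3 : X.obs t ω ∉ D := by
      intro hmem
      have h4 : D.indicator (1 : C × Policy S A H × Traj S A H → ENNReal) (X.obs t ω) = 0 := hω
      rw [Set.indicator_of_mem hmem] at h4
      exact one_ne_zero h4
    rw [hD, Set.mem_ofPred_eq, not_or] at h3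
    exact h3
  · exact (measurable_one.indicator hs).comp ((hX.measurable_obs hT).mono (ℱ.le _) le_rfl)

/-- The guarantee of maximum likelihood, summed over the segments of an epoch. -/
theorem measure_mle_failure_le (hX : IsRun μ ℱ 𝒟 s1 𝓜 Mstar M0 η ζ T X)
    (hη : ∀ m, 0 ≤ η m) (hMs : Mstar ∈ 𝓜) {m : ℕ} (hm : 1 ≤ m) (hT : tau m * H ≤ T)
    (hlt : tau (m - 1) < tau m) {δ : ℝ} (hδ : 0 < δ) :
    μ {ω | ¬ (((tau m - tau (m - 1) : ℕ) : ℝ) * ∑ h, (1 -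
        (segAff X 𝓜 M0 Mstar s1 𝒟 (η m) m h (X.est m h ω) ω).toReal) ≤
      H * Real.log 𝓜.card + Real.log (1 / δ))} ≤ ENNReal.ofReal δ := by
  have hcard : 0 < 𝓜.card := Finset.card_pos.2 ⟨_, hMs⟩
  have hcardr : (0 : ℝ) < 𝓜.card := by exact_mod_cast hcard
  have hseg : ∀ h : Fin H, segStart H m (h + 1) ≤ T := fun h => by
    rw [← segStart_last] at hT
    exact (segStart_mono H m h.isLt).trans hT
  set n := tau m - tau (m - 1) with hn
  set V : ENNReal := ENNReal.ofReal ((𝓜.card : ℝ) ^ H / δ) with hV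
  have hVpos : 0 < (𝓜.card : ℝ) ^ H / δ := by positivity
  have hL := hX.lintegral_prod_segLikelihood_le hη hMs hm hT hlt
  have hLm : Measurable fun ω => ∏ h, segLikelihood X 𝓜 M0 Mstar s1 𝒟 (η m) m h ω :=
    Finset.measurable_prod _ fun h _ =>
      (hX.measurable_segLikelihood hη hm h (hseg h) hlt).mono (ℱ.le _) le_rfl
  have hmarkov : μ {ω | V ≤ ∏ h, segLikelihood X 𝓜 M0 Mstar s1 𝒟 (η m) m h ω} ≤
      ENNReal.ofReal δ := by
    have h1 := mul_meas_ge_le_lintegral (μ := μ) hLm V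
    have h2 : V * μ {ω | V ≤ ∏ h, segLikelihood X 𝓜 M0 Mstar s1 𝒟 (η m) m h ω} ≤
        V * ENNReal.ofReal δ := by
      refine (h1.trans hL).trans (le_of_eq ?_)
      rw [hV, ← ENNReal.ofReal_mul hVpos.le, div_mul_cancel₀ _ hδ.ne',
        ENNReal.ofReal_pow hcardr.le, ENNReal.ofReal_natCast]
    exact (ENNReal.mul_le_mul_iff_right (by simpa [hV] using hVpos) ENNReal.ofReal_ne_top).1 h2
  refine (measure_mono_ae ?_).trans hmarkov
  have hgood : ∀ᵐ ω ∂μ, ∀ h : Fin H, ∀ t ∈ segment H m h,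
      density 𝓜 Mstar s1 (X.ctx t ω) (X.pol t ω) (X.traj t ω) ≠ 0 ∧
      density 𝓜 Mstar s1 (X.ctx t ω) (X.pol t ω) (X.traj t ω) ≠ ⊤ := by
    rw [ae_all_iff]
    intro h
    refine (ae_ball_iff (segment H m h).countable_toSet).2 fun t ht => ?_
    exact hX.ae_density_ne hMs hm h ht ((Finset.mem_Ico.1 ht).2.trans_le (hseg h))
  filter_upwards [hgood] with ω hω hfail
  have hfail' : H * Real.log 𝓜.card + Real.log (1 / δ) < (n : ℝ) * ∑ h, (1 -
        (segAff X 𝓜 M0 Mstar s1 𝒟 (η m) m h (X.est m h ω) ω).toReal) := not_le.1 hfail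
  change V ≤ ∏ h, segLikelihood X 𝓜 M0 Mstar s1 𝒟 (η m) m h ω
  have hone : ∀ h : Fin H, 1 ≤ ∏ t ∈ segment H m h,
      sqrtRatio 𝓜 Mstar s1 (X.est m h ω) (X.obs t ω) := by
    intro h
    have hmle := (hX.est_mle m hm h (hseg h) ω).2 Mstar hMs
    simp only [sqrtRatio, RunData.obs]
    rw [ENNReal.prod_rpow_of_nonneg (by norm_num)]
    refine ENNReal.one_le_rpow ?_ (by norm_num)
    simp_rw [div_eq_mul_inv]
    rw [Finset.prod_mul_distrib, ← ENNReal.prod_inv_distrib, ← div_eq_mul_inv]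
    · rw [ENNReal.le_div_iff_mul_le, one_mul]
      · exact hmle
      · exact Or.inl (Finset.prod_ne_zero_iff.2 fun t ht => (hω h t ht).1)
      · exact Or.inl (ENNReal.prod_ne_top fun t ht => (hω h t ht).2)
    · intro i hi j hj _
      exact Or.inr (hω h j hj).2
  calc V ≤ ENNReal.ofReal (Real.exp ((n : ℝ) * ∑ h, (1 -
        (segAff X 𝓜 M0 Mstar s1 𝒟 (η m) m h (X.est m h ω) ω).toReal))) := by
        refine ENNReal.ofReal_le_ofReal ?_
        rw [← Real.exp_log hVpos, Real.log_div (by positivity) hδ.ne', Real.log_pow]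
        refine Real.exp_le_exp.2 ?_
        rw [one_div, Real.log_inv] at hfail'
        linarith
    _ = ∏ h, ENNReal.ofReal (Real.exp ((n : ℝ) * (1 -
        (segAff X 𝓜 M0 Mstar s1 𝒟 (η m) m h (X.est m h ω) ω).toReal))) := by
        rw [Finset.mul_sum, Real.exp_sum, ENNReal.ofReal_prod_of_nonneg fun _ _ =>
          (Real.exp_pos _).le]
    _ ≤ _ := by
        refine Finset.prod_le_prod' fun h _ => ?_
        refine le_trans ?_ (Finset.single_le_sum (fun _ _ => zero_le)
          (hX.est_mle m hm h (hseg h) ω).1)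
        exact le_mul_of_one_le_right' (hone h)

end IsRun

end Mle

/-! ### The conditional regret of a round -/

section CondRegret

variable {Ω C S A : Type*} [MeasurableSpace C] [Fintype S] [Fintype A] [Nonempty A]
  [MeasurableSpace S] [MeasurableSpace A] {H : ℕ}
  [mΩ : MeasurableSpace Ω] {μ : Measure Ω} [IsProbabilityMeasure μ]
  {ℱ : Filtration ℕ mΩ} {𝒟 : Measure C} [IsProbabilityMeasure 𝒟]
  {s1 : S} {𝓜 : Finset (CMDP C S A H)} {Mstar M0 : CMDP C S A H} {η ζ : ℕ → ℝ} {T : ℕ}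
  {X : RunData Ω C S A H}

/-- The expected regret of a round of segment `h` of epoch `m`, given the past. -/
noncomputable def roundRegret (X : RunData Ω C S A H) (M0 Ms : CMDP C S A H) (s1 : S)
    (𝒟 : Measure C) (η : ℝ) (m : ℕ) (h : Fin H) (ω : Ω) : ENNReal :=
  ∫⁻ c, ∫⁻ π, ENNReal.ofReal (regret Ms s1 c π) ∂(X.igw M0 s1 η m h ω c) ∂𝒟

namespace IsRun

lemma roundRegret_le (hX : IsRun μ ℱ 𝒟 s1 𝓜 Mstar M0 η ζ T X) (hη : ∀ m, 0 ≤ η m) {m : ℕ}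
    (hm : 1 ≤ m) (h : Fin H) (hT : segStart H m h < T) (ω : Ω) :
    roundRegret X M0 Mstar s1 𝒟 (η m) m h ω ≤ ENNReal.ofReal H := by
  calc roundRegret X M0 Mstar s1 𝒟 (η m) m h ω
      ≤ ∫⁻ c, ∫⁻ _, ENNReal.ofReal H ∂(X.igw M0 s1 (η m) m h ω c) ∂𝒟 :=
        lintegral_mono fun c => lintegral_mono fun π => ENNReal.ofReal_le_ofReal (regret_le _ _ _ _)
    _ = ∫⁻ _, ENNReal.ofReal H ∂𝒟 := lintegral_congr fun c =>
        lintegral_igw_const X M0 s1 (hη m) (hX.lam_pos m hm h hT ω c) (hX.lam_sum m hm h hT ω c) _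
    _ = _ := by simp

/-- The conditional expectation of the regret, in terms of the inverse gap weighting. -/
lemma condExp_regret (hX : IsRun μ ℱ 𝒟 s1 𝓜 Mstar M0 η ζ T X) (hη : ∀ m, 0 ≤ η m) {m : ℕ}
    (hm : 1 ≤ m) (h : Fin H) {t : ℕ} (ht : t ∈ segment H m h) (hT : t < T) :
    μ[fun ω => regret Mstar s1 (X.ctx t ω) (X.pol t ω) | ℱ t] =ᵐ[μ]
      fun ω => (roundRegret X M0 Mstar s1 𝒟 (η m) m h ω).toReal := by
  have hst : segStart H m h ≤ t := (Finset.mem_Ico.1 ht).1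
  have hH : 1 ≤ H := by have := h.isLt; omega
  have hregm := measurable_regret Mstar s1
  have hcp : Measurable fun ω => (X.ctx t ω, X.pol t ω) :=
    ((hX.ctx_meas t hT).mono (ℱ.le _) le_rfl).prodMk ((hX.pol_meas t hT).mono (ℱ.le _) le_rfl)
  have hfm : Measurable fun ω => regret Mstar s1 (X.ctx t ω) (X.pol t ω) := (hregm.comp hcp :)
  have hgm : Measurable[ℱ t] (roundRegret X M0 Mstar s1 𝒟 (η m) m h) :=
    (hX.measurable_inner hη hm h (hst.trans_lt hT)
      (F := fun q => ENNReal.ofReal (regret Mstar s1 q.1 q.2)) hregm.ennreal_ofReal).mono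
      (ℱ.mono hst) le_rfl
  have hgtop : ∀ ω, roundRegret X M0 Mstar s1 𝒟 (η m) m h ω ≠ ⊤ := fun ω =>
    ((hX.roundRegret_le hη hm h (hst.trans_lt hT) ω).trans_lt ENNReal.ofReal_lt_top).ne
  have hgreal : Measurable[ℱ t] fun ω => (roundRegret X M0 Mstar s1 𝒟 (η m) m h ω).toReal :=
    ENNReal.measurable_toReal.comp hgm
  have hgint : Integrable (fun ω => (roundRegret X M0 Mstar s1 𝒟 (η m) m h ω).toReal) μ :=
    Integrable.of_bound (C := H) (hgreal.mono (ℱ.le t) le_rfl).aestronglyMeasurable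
      (Filter.Eventually.of_forall fun ω => by
        rw [Real.norm_of_nonneg ENNReal.toReal_nonneg]
        exact ENNReal.toReal_le_of_le_ofReal (Nat.cast_nonneg _)
          (hX.roundRegret_le hη hm h (hst.trans_lt hT) ω))
  have hfint : Integrable (fun ω => regret Mstar s1 (X.ctx t ω) (X.pol t ω)) μ :=
    Integrable.of_bound (C := H) hfm.aestronglyMeasurable (Filter.Eventually.of_forall fun ω => by
      rw [Real.norm_of_nonneg (regret_nonneg _ _ _ _)]; exact regret_le _ _ _ _)
  refine (ae_eq_condExp_of_forall_setIntegral_eq (ℱ.le t) hfint (fun B _ _ => hgint.integrableOn)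
    (fun B hB _ => ?_) hgreal.stronglyMeasurable.aestronglyMeasurable).symm
  rw [integral_eq_lintegral_of_nonneg_ae
      (Filter.Eventually.of_forall fun ω => ENNReal.toReal_nonneg)
      (hgreal.mono (ℱ.le t) le_rfl).aestronglyMeasurable,
    integral_eq_lintegral_of_nonneg_ae (Filter.Eventually.of_forall fun ω => regret_nonneg _ _ _ _)
      hfm.aestronglyMeasurable]
  congr 1
  have h1 := hX.round_law m hm h t ht hT B hB
    (fun q => ENNReal.ofReal (regret Mstar s1 q.1 q.2.1)) (by
      have h2 : Measurable fun q : C × Policy S A H × Traj S A H => (q.1, q.2.1) := by fun_prop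
      exact (hregm.comp h2 :).ennreal_ofReal)
  simp only [lintegral_const, trajLaw_univ Mstar hH, mul_one] at h1
  rw [h1]
  exact lintegral_congr fun ω => ENNReal.ofReal_toReal (hgtop ω)

end IsRun

end CondRegret

/-! ### Comparison of the true and the estimated regret -/

section Slack

variable {Ω C S A : Type*} [MeasurableSpace C] [Fintype S] [Fintype A]
  [MeasurableSpace S] [MeasurableSpace A] {H : ℕ}

/-- One step of the comparison: if the values of `M` and `Ms` differ by at most an eighth of an
earlier estimate `regp` of the regret plus a constant, then the regrets are comparable. -/
lemma regret_comparison [Nonempty A] {M Ms : CMDP C S A H} {s1 : S} {c : C}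
    {regp : Policy S A H → ℝ} {a s : ℝ}
    (herr : ∀ π, |value M s1 c π - value Ms s1 c π| ≤ regp π / 8 + a)
    (hprev : ∀ π, regp π ≤ 2 * regret Ms s1 c π + s) (ha : 0 ≤ a)
    (π : Policy S A H) :
    regret Ms s1 c π ≤ 2 * regret M s1 c π + (s / 3 + 3 * a) ∧
    regret M s1 c π ≤ 2 * regret Ms s1 c π + (s / 3 + 3 * a) := by
  obtain ⟨p, hp⟩ := exists_optimal Ms s1 c
  obtain ⟨q, hq⟩ := exists_optimal M s1 c
  have r1 := regret_eq_of_forall_le Ms s1 c hp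
  have r2 := regret_eq_of_forall_le M s1 c hq
  have key : ∀ π, 3 / 4 * regret Ms s1 c π ≤ regret M s1 c π + s / 4 + 2 * a := by
    intro π
    have e1 := abs_le.1 (herr p)
    have e2 := abs_le.1 (herr π)
    have e3 := hprev p
    have e4 := hprev π
    have e5 : regret Ms s1 c p = 0 := by rw [r1]; ring
    have e6 := hq p
    have e7 := r1 π
    have e8 := r2 π
    linarith
  have n1 := regret_nonneg M s1 c π
  have n2 := regret_nonneg Ms s1 c π
  constructor
  · have := key π
    linarith
  · have e1 := abs_le.1 (herr q)
    have e2 := abs_le.1 (herr π)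
    have e3 := hprev q
    have e4 := hprev π
    have e5 := key q
    have e6 : regret M s1 c q = 0 := by rw [r2]; ring
    have e7 := hp q
    have e8 := r1 π
    have e9 := r2 π
    linarith

/-- The expected loss of affinity of segment `h` of epoch `m` under the context `c`. -/
noncomputable def ctxErr (X : RunData Ω C S A H) (𝓜 : Finset (CMDP C S A H))
    (M0 Ms : CMDP C S A H) (s1 : S) (η : ℝ) (m : ℕ) (h : Fin H) (ω : Ω) (c : C) : ℝ :=
  ∑ π ∈ X.polCover m h ω c, X.weight M0 s1 η m h ω c π *
    (2 * (1 - aff 𝓜 (X.est m h ω) Ms s1 c π))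

/-- The additive error of the estimated values of epoch `m` under the context `c`. -/
noncomputable def ctxAdd (X : RunData Ω C S A H) (𝓜 : Finset (CMDP C S A H))
    (M0 Ms : CMDP C S A H) (s1 : S) (η ζ : ℕ → ℝ) (m : ℕ) (ω : Ω) (c : C) : ℝ :=
  (Fintype.card S : ℝ) * Fintype.card A / (8 * η m) +
    (2048 * (H : ℝ) ^ 3 * η m + 64 * (H : ℝ) ^ 2 * ζ m) *
      ∑ h, ctxErr X 𝓜 M0 Ms s1 (η m) m h ω c

/-- The additive error in the comparison of the true regret with the regret in the estimate of
epoch `m`, under the context `c`. In epoch `1` nothing better than the trivial bound is used. -/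
noncomputable def slack (X : RunData Ω C S A H) (𝓜 : Finset (CMDP C S A H))
    (M0 Ms : CMDP C S A H) (s1 : S) (η ζ : ℕ → ℝ) : ℕ → Ω → C → ℝ
  | 0 => fun _ _ => H
  | 1 => fun _ _ => H
  | m + 2 => fun ω c => slack X 𝓜 M0 Ms s1 η ζ (m + 1) ω c / 3 +
      3 * ctxAdd X 𝓜 M0 Ms s1 η ζ (m + 2) ω c

variable [mΩ : MeasurableSpace Ω] {μ : Measure Ω} [IsProbabilityMeasure μ]
  {ℱ : Filtration ℕ mΩ} {𝒟 : Measure C} [IsProbabilityMeasure 𝒟]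
  {s1 : S} {𝓜 : Finset (CMDP C S A H)} {Mstar M0 : CMDP C S A H} {η ζ : ℕ → ℝ} {T : ℕ}
  {X : RunData Ω C S A H}

lemma segStart_lt_of_tau_mul_le {H m T : ℕ} (hlt : tau (m - 1) < tau m) (hT : tau m * H ≤ T)
    (h : Fin H) : segStart H m h < T := by
  have h1 := segStart_mono H m h.isLt
  rw [segStart_last] at h1
  have h2 := segStart_succ H m h
  have h3 : segStart H m (h + 1) ≤ tau m * H := h1
  omega

lemma tau_pred_lt {m : ℕ} (hm : 1 ≤ m) : tau (m - 1) < tau m := by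
  obtain ⟨k, rfl⟩ : ∃ k, m = k + 1 := ⟨m - 1, by omega⟩
  rcases Nat.eq_zero_or_pos k with rfl | hk
  · simp [tau]
  · rw [Nat.add_sub_cancel, tau_of_pos hk, tau_of_pos (by omega)]
    exact Nat.pow_lt_pow_right (by norm_num) (by omega)

lemma card_polCover_le_two_mul [Nonempty A] (X : RunData Ω C S A H) (s1 : S) (m : ℕ) (h : Fin H)
    (ω : Ω) (c : C) : ((X.polCover m h ω c).card : ℝ) ≤
      2 * ((Fintype.card S : ℝ) * Fintype.card A) := by
  have h1 := card_polCover_le X m h ω c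
  have hS : 0 < Fintype.card S := Fintype.card_pos_iff.2 ⟨s1⟩
  have hA : 0 < Fintype.card A := Fintype.card_pos
  have h2 := Nat.mul_pos hS hA
  have h3 : (X.polCover m h ω c).card ≤ 2 * (Fintype.card S * Fintype.card A) := by omega
  exact_mod_cast h3

namespace IsRun

lemma ctxErr_nonneg (hX : IsRun μ ℱ 𝒟 s1 𝓜 Mstar M0 η ζ T X) (hη : ∀ m, 0 ≤ η m)
    (hMs : Mstar ∈ 𝓜) {m : ℕ} (hm : 1 ≤ m) (hT : tau m * H ≤ T) (h : Fin H) (ω : Ω) (c : C) :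
    0 ≤ ctxErr X 𝓜 M0 Mstar s1 (η m) m h ω c := by
  have hlt := tau_pred_lt hm
  have hseg : segStart H m (h + 1) ≤ T := by
    rw [← segStart_last] at hT; exact (segStart_mono H m h.isLt).trans hT
  refine Finset.sum_nonneg fun π _ => mul_nonneg (weight_nonneg X M0 s1 (hη m)
    (hX.lam_pos m hm h (segStart_lt_of_tau_mul_le hlt hT h) ω c) π) ?_
  have := aff_le_one (hX.est_mle m hm h hseg ω).1 hMs (by have := h.isLt; omega) s1 c π
  linarith

lemma lam_le (hX : IsRun μ ℱ 𝒟 s1 𝓜 Mstar M0 η ζ T X) (hη : ∀ m, 0 ≤ η m) {m : ℕ} (hm : 1 ≤ m)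
    (h : Fin H) (hT : segStart H m h < T) (ω : Ω) (c : C) :
    X.lam m h ω c ≤ (X.polCover m h ω c).card := by
  have hl := hX.lam_pos m hm h hT ω c
  have hs := hX.lam_sum m hm h hT ω c
  have h1 : ∑ π ∈ X.polCover m h ω c, X.weight M0 s1 (η m) m h ω c π ≤
      ∑ _π ∈ X.polCover m h ω c, 1 / X.lam m h ω c := by
    refine Finset.sum_le_sum fun π _ => one_div_le_one_div_of_le hl ?_
    have := mul_nonneg (hη m) (regHat_nonneg X M0 s1 m ω c π)
    linarith
  rw [hs, Finset.sum_const, nsmul_eq_mul, mul_one_div, le_div_iff₀ hl, one_mul] at h1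
  exact h1

/-- An epoch of a run satisfies the hypotheses of the error bound under every context. -/
lemma layerCover [Nonempty A] (hX : IsRun μ ℱ 𝒟 s1 𝓜 Mstar M0 η ζ T X) (hη : ∀ m, 0 ≤ η m)
    (hMs : Mstar ∈ 𝓜) {m : ℕ} (hm : 1 ≤ m) (hT : tau m * H ≤ T) (ω : Ω) (c : C) :
    LayerCover (X.estModel M0 m ω) Mstar s1 c (η m) (ζ m) (X.regHat M0 s1 m ω c)
      (fun h => if hh : h < H then X.polCover m ⟨h, hh⟩ ω c else ∅)
      (fun h => if hh : h < H then X.weight M0 s1 (η m) m ⟨h, hh⟩ ω c else 0)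
      (fun h s a => 1 - rewAff 𝓜 (X.est m h ω) Mstar h s a c)
      (fun h => if hh : h < H then ctxErr X 𝓜 M0 Mstar s1 (η m) m ⟨h, hh⟩ ω c else 0) := by
  have hlt := tau_pred_lt hm
  have hstart : ∀ h : Fin H, segStart H m h < T := segStart_lt_of_tau_mul_le hlt hT
  have hseg : ∀ h : Fin H, segStart H m (h + 1) ≤ T := fun h => by
    rw [← segStart_last] at hT; exact (segStart_mono H m h.isLt).trans hT
  have hest : X.estModel M0 m ω = layerwise fun h => X.est m h ω := by
    simp only [RunData.estModel, if_neg (show m ≠ 0 by omega)]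
  have hmem : ∀ h, X.est m h ω ∈ 𝓜 := fun h => (hX.est_mle m hm h (hseg h) ω).1
  have hw : ∀ h : Fin H, ∀ π, 0 ≤ X.weight M0 s1 (η m) m h ω c π := fun h π =>
    weight_nonneg X M0 s1 (hη m) (hX.lam_pos m hm h (hstart h) ω c) π
  refine ⟨?_, ?_, ?_, ?_, ?_, ?_, ?_⟩
  · intro h hh π _
    simp only [dif_pos hh]; exact hw _ π
  · intro h hh s a π
    simp only [dif_pos hh]
    have hcov := hX.cover_max m hm ⟨h, hh⟩ (hstart ⟨h, hh⟩) s a ω c π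
    refine hcov.trans ?_
    set π' := X.cover m ⟨h, hh⟩ s a ω c with hπ'
    have hmemc : π' ∈ X.polCover m ⟨h, hh⟩ ω c :=
      Finset.mem_insert_of_mem (Finset.mem_image.2 ⟨(s, a), Finset.mem_univ _, rfl⟩)
    have hS : 0 < Fintype.card S := Fintype.card_pos_iff.2 ⟨s1⟩
    have hA : 0 < Fintype.card A := Fintype.card_pos
    have hnn : ∀ π, 0 ≤ tOcc (X.estModel M0 m ω) s1 c (η m) (ζ m) (X.regHat M0 s1 m ω c) h π s *
        actProb π h s a := fun π =>
      mul_nonneg (tOcc_nonneg _ _ _ _ _ _ _ _ _) (actProb_nonneg _ _ _ _)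
    have hr := mul_nonneg (hη m) (regHat_nonneg X M0 s1 m ω c π')
    have hl := hX.lam_pos m hm ⟨h, hh⟩ (hstart ⟨h, hh⟩) ω c
    have hl2 := (hX.lam_le hη hm ⟨h, hh⟩ (hstart ⟨h, hh⟩) ω c).trans
      (card_polCover_le_two_mul X s1 m ⟨h, hh⟩ ω c)
    refine le_trans ?_ (mul_le_mul_of_nonneg_left (Finset.single_le_sum
      (f := fun π => X.weight M0 s1 (η m) m ⟨h, hh⟩ ω c π *
        (tOcc (X.estModel M0 m ω) s1 c (η m) (ζ m) (X.regHat M0 s1 m ω c) h π s *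
        actProb π h s a)) (fun π _ => mul_nonneg (hw _ π) (hnn π)) hmemc) zero_le_two)
    unfold RunData.ratio coverRatio RunData.weight
    change tOcc (X.estModel M0 m ω) s1 c (η m) (ζ m) (X.regHat M0 s1 m ω c) h π' s *
        actProb π' h s a / _ ≤ _
    rw [div_eq_mul_one_div, mul_comm (tOcc _ _ _ _ _ _ _ _ _ * _), ← mul_assoc 2]
    refine mul_le_mul_of_nonneg_right ?_ (hnn π')
    rw [mul_one_div, div_le_div_iff₀ (by positivity) (by linarith)]
    linarith
  · intro h s a
    rw [hest]
    exact sq_meanReward_sub_le (hmem h) hMs h s a c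
  · intro h s a
    exact sub_nonneg.2 (rewAff_le_one (hmem h) hMs h s a c)
  · intro h
    simp only [dif_pos h.isLt]
    exact Finset.sum_le_sum fun π _ => mul_le_mul_of_nonneg_left
      (sum_occ_mul_one_sub_rewAff_le (hmem h) hMs s1 c π h) (hw h π)
  · intro h hh
    have hh' : h < H := by omega
    simp only [dif_pos hh']
    have e : ∀ s a, transAff (X.estModel M0 m ω) Mstar c h s a =
        transAff (X.est m ⟨h, hh'⟩ ω) Mstar c h s a := by
      intro s a
      rw [hest]
      simp only [transAff, transProb, dif_pos hh', layerwise]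
    simp_rw [e]
    exact Finset.sum_le_sum fun π _ => mul_le_mul_of_nonneg_left
      (sum_occ_mul_one_sub_transAff_le (hmem ⟨h, hh'⟩) hMs s1 c π hh) (hw ⟨h, hh'⟩ π)
  · intro h
    split_ifs with hh
    · exact hX.ctxErr_nonneg hη hMs hm hT ⟨h, hh⟩ ω c
    · exact le_rfl

lemma ctxAdd_nonneg (hX : IsRun μ ℱ 𝒟 s1 𝓜 Mstar M0 η ζ T X) (hη : ∀ m, 0 ≤ η m)
    (hζ : ∀ m, 0 ≤ ζ m) (hMs : Mstar ∈ 𝓜) {m : ℕ} (hm : 1 ≤ m) (hT : tau m * H ≤ T) (ω : Ω)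
    (c : C) : 0 ≤ ctxAdd X 𝓜 M0 Mstar s1 η ζ m ω c := by
  have h1 := Finset.sum_nonneg fun h (_ : h ∈ Finset.univ) =>
    hX.ctxErr_nonneg hη hMs hm hT h ω c
  have h2 := hη m
  have h3 := hζ m
  unfold ctxAdd
  positivity

lemma slack_nonneg (hX : IsRun μ ℱ 𝒟 s1 𝓜 Mstar M0 η ζ T X) (hη : ∀ m, 0 ≤ η m)
    (hζ : ∀ m, 0 ≤ ζ m) (hMs : Mstar ∈ 𝓜) {m : ℕ} (hT : tau m * H ≤ T) (ω : Ω)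
    (c : C) : 0 ≤ slack X 𝓜 M0 Mstar s1 η ζ m ω c := by
  induction m with
  | zero => exact Nat.cast_nonneg _
  | succ m ih =>
    cases m with
    | zero => exact Nat.cast_nonneg _
    | succ m =>
      have h1 := ih ((Nat.mul_le_mul_right H (tau_mono (Nat.le_succ _))).trans hT)
      have h2 := hX.ctxAdd_nonneg hη hζ hMs (Nat.succ_le_succ (Nat.zero_le _)) hT ω c
      change 0 ≤ slack X 𝓜 M0 Mstar s1 η ζ (m + 1) ω c / 3 +
        3 * ctxAdd X 𝓜 M0 Mstar s1 η ζ (m + 2) ω c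
      have h3 : 0 ≤ ctxAdd X 𝓜 M0 Mstar s1 η ζ (m + 2) ω c := h2
      positivity

/-- The true regret and the regret in the estimated model are comparable, for every context and
every policy. -/
theorem regret_le_and_regret_le [Nonempty A] (hX : IsRun μ ℱ 𝒟 s1 𝓜 Mstar M0 η ζ T X)
    (hη : ∀ m, 0 ≤ η m) (hζ : ∀ m, 0 ≤ ζ m) (hMs : Mstar ∈ 𝓜) {m : ℕ} (hm : 1 ≤ m)
    (hpos : ∀ j, 2 ≤ j → j ≤ m → 0 < η j ∧ 0 < ζ j ∧
      2 * (H : ℝ) ^ 2 * ((Fintype.card S : ℝ) ^ 2 * Fintype.card A) / ζ j ≤ 4 / 45 / η j)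
    (hT : tau m * H ≤ T) (ω : Ω) (c : C) (π : Policy S A H) :
    regret Mstar s1 c π ≤ 2 * regret (X.estModel M0 m ω) s1 c π +
      slack X 𝓜 M0 Mstar s1 η ζ m ω c ∧
    regret (X.estModel M0 m ω) s1 c π ≤ 2 * regret Mstar s1 c π +
      slack X 𝓜 M0 Mstar s1 η ζ m ω c := by
  induction m, hm using Nat.le_induction generalizing π with
  | base =>
    have h1 := regret_le Mstar s1 c π
    have h2 := regret_le (X.estModel M0 1 ω) s1 c π
    have h3 := regret_nonneg Mstar s1 c π
    have h4 := regret_nonneg (X.estModel M0 1 ω) s1 c π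
    simp only [slack]
    constructor <;> linarith
  | succ m hm ih =>
    obtain ⟨k, rfl⟩ : ∃ k, m = k + 1 := ⟨m - 1, by omega⟩
    have hT' : tau (k + 1) * H ≤ T :=
      (Nat.mul_le_mul_right H (tau_mono (Nat.le_succ _))).trans hT
    obtain ⟨p1, p2, p3⟩ := hpos (k + 1 + 1) (by omega) le_rfl
    have hL := hX.layerCover hη hMs (show 1 ≤ k + 1 + 1 by omega) hT ω c
    refine regret_comparison (regp := X.regHat M0 s1 (k + 1 + 1) ω c)
      (a := ctxAdd X 𝓜 M0 Mstar s1 η ζ (k + 2) ω c)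
      (fun π => ?_) (fun π => ?_) (hX.ctxAdd_nonneg hη hζ hMs (by omega) hT ω c) π
    · have h1 := hL.abs_value_sub_le p1 p2 (fun π => regHat_nonneg X M0 s1 _ ω c π) p3 π
      refine h1.trans (le_of_eq ?_)
      unfold ctxAdd
      congr 3
      rw [← Fin.sum_univ_eq_sum_range (fun h => if hh : h < H then
        ctxErr X 𝓜 M0 Mstar s1 (η (k + 1 + 1)) (k + 1 + 1) ⟨h, hh⟩ ω c else 0)]
      refine Finset.sum_congr rfl fun h _ => ?_
      simp only [dif_pos h.isLt]
    · exact (ih (fun j hj hj' => hpos j hj (by omega)) hT' π).2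

end IsRun

end Slack

/-! ### Averages over the context -/

lemma measurable_of_prod_left {Ω C β : Type*} {m : MeasurableSpace Ω} [MeasurableSpace C]
    [MeasurableSpace β] {f : Ω × C → β} (hf : Measurable f) (ω : Ω) :
    Measurable fun c => f (ω, c) :=
  hf.comp measurable_prodMk_left

section Average

variable {Ω C S A : Type*} [MeasurableSpace C] [Fintype S] [Fintype A]
  [MeasurableSpace S] [MeasurableSpace A] {H : ℕ}
  [mΩ : MeasurableSpace Ω] {μ : Measure Ω} [IsProbabilityMeasure μ]
  {ℱ : Filtration ℕ mΩ} {𝒟 : Measure C} [IsProbabilityMeasure 𝒟]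
  {s1 : S} {𝓜 : Finset (CMDP C S A H)} {Mstar M0 : CMDP C S A H} {η ζ : ℕ → ℝ} {T : ℕ}
  {X : RunData Ω C S A H} [MeasurableSingletonClass S] [MeasurableSingletonClass A]

lemma segStart_succ_le {H m T : ℕ} (hT : tau m * H ≤ T) (h : Fin H) :
    segStart H m (h + 1) ≤ T := by
  rw [← segStart_last] at hT
  exact (segStart_mono H m h.isLt).trans hT

lemma measurable_two_mul_one_sub_aff (M : CMDP C S A H) :
    Measurable fun q : C × Policy S A H =>
      ENNReal.ofReal (2 * (1 - aff 𝓜 M Mstar s1 q.1 q.2)) :=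
  ((measurable_const.sub (measurable_aff s1)).const_mul 2).ennreal_ofReal

/-- The loss of affinity of epoch `m`, averaged over the context and summed over the segments. -/
noncomputable def epochErr (X : RunData Ω C S A H) (𝓜 : Finset (CMDP C S A H))
    (M0 Ms : CMDP C S A H) (s1 : S) (𝒟 : Measure C) (η : ℝ) (m : ℕ) (ω : Ω) : ℝ :=
  ∑ h, 2 * (1 - (segAff X 𝓜 M0 Ms s1 𝒟 η m h (X.est m h ω) ω).toReal)

namespace IsRun

lemma ofReal_ctxErr (hX : IsRun μ ℱ 𝒟 s1 𝓜 Mstar M0 η ζ T X) (hη : ∀ m, 0 ≤ η m)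
    (hMs : Mstar ∈ 𝓜) {m : ℕ} (hm : 1 ≤ m) (hT : tau m * H ≤ T) (h : Fin H) (ω : Ω) (c : C) :
    ENNReal.ofReal (ctxErr X 𝓜 M0 Mstar s1 (η m) m h ω c) =
      ∫⁻ π, ENNReal.ofReal (2 * (1 - aff 𝓜 (X.est m h ω) Mstar s1 c π))
        ∂(X.igw M0 s1 (η m) m h ω c) := by
  have hst := segStart_lt_of_tau_mul_le (tau_pred_lt hm) hT h
  have hw := weight_nonneg X M0 s1 (hη m) (hX.lam_pos m hm h hst ω c)
  have hp : Measurable fun π : Policy S A H => (c, π) := measurable_prodMk_left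
  have ha : Measurable fun π : Policy S A H => aff 𝓜 (X.est m h ω) Mstar s1 c π :=
    ((measurable_aff s1).comp hp :)
  have hle : ∀ π, 0 ≤ 2 * (1 - aff 𝓜 (X.est m h ω) Mstar s1 c π) := fun π => by
    have := aff_le_one (hX.est_mle m hm h (segStart_succ_le hT h) ω).1 hMs
      (by have := h.isLt; omega) s1 c π
    linarith
  have hF : Measurable fun π : Policy S A H =>
      ENNReal.ofReal (2 * (1 - aff 𝓜 (X.est m h ω) Mstar s1 c π)) :=
    ((measurable_const.sub ha).const_mul 2).ennreal_ofReal
  rw [lintegral_igw _ _ _ _ _ _ _ _ hF, ctxErr,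
    ENNReal.ofReal_sum_of_nonneg fun π _ => mul_nonneg (hw π) (hle π)]
  exact Finset.sum_congr rfl fun π _ => ENNReal.ofReal_mul (hw π)

lemma measurable_section_igw (hX : IsRun μ ℱ 𝒟 s1 𝓜 Mstar M0 η ζ T X) (hη : ∀ m, 0 ≤ η m)
    {m : ℕ} (hm : 1 ≤ m) (h : Fin H) (hT : segStart H m h < T)
    {F : C × Policy S A H → ENNReal} (hF : Measurable F) (ω : Ω) :
    Measurable fun c => ∫⁻ π, F (c, π) ∂(X.igw M0 s1 (η m) m h ω c) :=
  measurable_of_prod_left (f := fun q : Ω × C => ∫⁻ π, F (q.2, π) ∂(X.igw M0 s1 (η m) m h q.1 q.2))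
    (@MeasurableChoice.measurable_lintegral_igw Ω C S A _ _ _ _ _ H X M0 s1
      (ℱ (segStart H m h)) 𝓜 (η m) m h (hX.measurableChoice hη hm h hT) F hF) ω

lemma measurable_ctxErr (hX : IsRun μ ℱ 𝒟 s1 𝓜 Mstar M0 η ζ T X) (hη : ∀ m, 0 ≤ η m)
    (hMs : Mstar ∈ 𝓜) {m : ℕ} (hm : 1 ≤ m) (hT : tau m * H ≤ T) (h : Fin H) (ω : Ω) :
    Measurable (ctxErr X 𝓜 M0 Mstar s1 (η m) m h ω) := by
  have h1 := hX.measurable_section_igw hη hm h (segStart_lt_of_tau_mul_le (tau_pred_lt hm) hT h)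
    (measurable_two_mul_one_sub_aff (𝓜 := 𝓜) (Mstar := Mstar) (s1 := s1) (X.est m h ω)) ω
  have h2 : ctxErr X 𝓜 M0 Mstar s1 (η m) m h ω = fun c => (∫⁻ π, ENNReal.ofReal
      (2 * (1 - aff 𝓜 (X.est m h ω) Mstar s1 c π)) ∂(X.igw M0 s1 (η m) m h ω c)).toReal := by
    funext c
    rw [← hX.ofReal_ctxErr hη hMs hm hT h ω c,
      ENNReal.toReal_ofReal (hX.ctxErr_nonneg hη hMs hm hT h ω c)]
  rw [h2]
  exact h1.ennreal_toReal

/-- The average over the context of the loss of affinity, which is what maximum likelihood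
controls. -/
lemma lintegral_ctxErr_add (hX : IsRun μ ℱ 𝒟 s1 𝓜 Mstar M0 η ζ T X) (hη : ∀ m, 0 ≤ η m)
    (hMs : Mstar ∈ 𝓜) {m : ℕ} (hm : 1 ≤ m) (hT : tau m * H ≤ T) (h : Fin H) (ω : Ω) :
    ∫⁻ c, ENNReal.ofReal (ctxErr X 𝓜 M0 Mstar s1 (η m) m h ω c) ∂𝒟 +
      2 * segAff X 𝓜 M0 Mstar s1 𝒟 (η m) m h (X.est m h ω) ω = 2 := by
  have hst := segStart_lt_of_tau_mul_le (tau_pred_lt hm) hT h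
  have hmem := (hX.est_mle m hm h (segStart_succ_le hT h) ω).1
  set M := X.est m h ω with hM
  have haff : Measurable fun q : C × Policy S A H => ENNReal.ofReal (aff 𝓜 M Mstar s1 q.1 q.2) :=
    (measurable_aff s1).ennreal_ofReal
  have hmeas := hX.measurable_section_igw hη hm h hst haff ω
  rw [segAff, ← lintegral_const_mul _ hmeas, ← lintegral_add_left
    (hX.measurable_ctxErr hη hMs hm hT h ω).ennreal_ofReal]
  calc _ = ∫⁻ _, 2 ∂𝒟 := lintegral_congr fun c => ?_
    _ = 2 := by simp
  have hp : Measurable fun π : Policy S A H => (c, π) := measurable_prodMk_left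
  have haff' : Measurable fun π : Policy S A H => ENNReal.ofReal (aff 𝓜 M Mstar s1 c π) :=
    (haff.comp hp :)
  have hsub' : Measurable fun π : Policy S A H =>
      ENNReal.ofReal (2 * (1 - aff 𝓜 M Mstar s1 c π)) :=
    ((measurable_two_mul_one_sub_aff (𝓜 := 𝓜) (Mstar := Mstar) (s1 := s1) M).comp hp :)
  rw [hX.ofReal_ctxErr hη hMs hm hT h ω c, ← lintegral_const_mul _ haff',
    ← lintegral_add_left hsub']
  refine Eq.trans (lintegral_congr fun π => ?_) (lintegral_igw_const X M0 s1 (hη m)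
    (hX.lam_pos m hm h hst ω c) (hX.lam_sum m hm h hst ω c) 2)
  have h1 := aff_le_one hmem hMs (by have := h.isLt; omega) s1 c π
  have h0 : 0 ≤ aff 𝓜 M Mstar s1 c π := aff_nonneg _ _ _
  rw [show (2 : ENNReal) = ENNReal.ofReal 2 by simp, ← ENNReal.ofReal_mul (by norm_num),
    ← ENNReal.ofReal_add (by linarith) (by linarith)]
  congr 1; ring

lemma integral_ctxErr (hX : IsRun μ ℱ 𝒟 s1 𝓜 Mstar M0 η ζ T X) (hη : ∀ m, 0 ≤ η m)
    (hMs : Mstar ∈ 𝓜) {m : ℕ} (hm : 1 ≤ m) (hT : tau m * H ≤ T) (h : Fin H) (ω : Ω) :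
    ∫ c, ctxErr X 𝓜 M0 Mstar s1 (η m) m h ω c ∂𝒟 =
      2 * (1 - (segAff X 𝓜 M0 Mstar s1 𝒟 (η m) m h (X.est m h ω) ω).toReal) := by
  have h1 := hX.lintegral_ctxErr_add hη hMs hm hT h ω
  have h2 := hX.segAff_le_one hη hMs hm h (segStart_lt_of_tau_mul_le (tau_pred_lt hm) hT h)
    (hX.est_mle m hm h (segStart_succ_le hT h) ω).1 ω
  rw [integral_eq_lintegral_of_nonneg_ae
    (Filter.Eventually.of_forall fun c => hX.ctxErr_nonneg hη hMs hm hT h ω c)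
    (hX.measurable_ctxErr hη hMs hm hT h ω).aestronglyMeasurable]
  have h3 : ∫⁻ c, ENNReal.ofReal (ctxErr X 𝓜 M0 Mstar s1 (η m) m h ω c) ∂𝒟 ≠ ⊤ := by
    intro h4; rw [h4] at h1; simp at h1
  have h4 := (h2.trans_lt ENNReal.one_lt_top).ne
  have h5 := congrArg ENNReal.toReal h1
  rw [ENNReal.toReal_add h3 (ENNReal.mul_ne_top (by simp) h4), ENNReal.toReal_mul] at h5
  simp only [ENNReal.toReal_ofNat] at h5
  linarith

lemma integrable_ctxErr (hX : IsRun μ ℱ 𝒟 s1 𝓜 Mstar M0 η ζ T X) (hη : ∀ m, 0 ≤ η m)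
    (hMs : Mstar ∈ 𝓜) {m : ℕ} (hm : 1 ≤ m) (hT : tau m * H ≤ T) (h : Fin H) (ω : Ω) :
    Integrable (ctxErr X 𝓜 M0 Mstar s1 (η m) m h ω) 𝒟 := by
  have h1 := hX.lintegral_ctxErr_add hη hMs hm hT h ω
  refine ⟨(hX.measurable_ctxErr hη hMs hm hT h ω).aestronglyMeasurable, ?_⟩
  rw [hasFiniteIntegral_iff_ofReal
    (Filter.Eventually.of_forall fun c => hX.ctxErr_nonneg hη hMs hm hT h ω c)]
  exact (le_self_add.trans_eq h1).trans_lt (by simp)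

lemma integrable_ctxAdd (hX : IsRun μ ℱ 𝒟 s1 𝓜 Mstar M0 η ζ T X) (hη : ∀ m, 0 ≤ η m)
    (hMs : Mstar ∈ 𝓜) {m : ℕ} (hm : 1 ≤ m) (hT : tau m * H ≤ T) (ω : Ω) :
    Integrable (ctxAdd X 𝓜 M0 Mstar s1 η ζ m ω) 𝒟 :=
  (integrable_const _).add ((integrable_finsetSum _ fun h _ =>
    hX.integrable_ctxErr hη hMs hm hT h ω).const_mul _)

lemma integral_ctxAdd (hX : IsRun μ ℱ 𝒟 s1 𝓜 Mstar M0 η ζ T X) (hη : ∀ m, 0 ≤ η m)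
    (hMs : Mstar ∈ 𝓜) {m : ℕ} (hm : 1 ≤ m) (hT : tau m * H ≤ T) (ω : Ω) :
    ∫ c, ctxAdd X 𝓜 M0 Mstar s1 η ζ m ω c ∂𝒟 =
      (Fintype.card S : ℝ) * Fintype.card A / (8 * η m) +
        (2048 * (H : ℝ) ^ 3 * η m + 64 * (H : ℝ) ^ 2 * ζ m) *
          epochErr X 𝓜 M0 Mstar s1 𝒟 (η m) m ω := by
  unfold ctxAdd epochErr
  rw [integral_add (integrable_const _) ((integrable_finsetSum _ fun h _ =>
      hX.integrable_ctxErr hη hMs hm hT h ω).const_mul _), integral_const_mul,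
    integral_finsetSum _ fun h _ => hX.integrable_ctxErr hη hMs hm hT h ω]
  simp_rw [hX.integral_ctxErr hη hMs hm hT _ ω]
  simp

lemma integrable_slack (hX : IsRun μ ℱ 𝒟 s1 𝓜 Mstar M0 η ζ T X) (hη : ∀ m, 0 ≤ η m)
    (hMs : Mstar ∈ 𝓜) {m : ℕ} (hm : 1 ≤ m) (hT : tau m * H ≤ T) (ω : Ω) :
    Integrable (slack X 𝓜 M0 Mstar s1 η ζ m ω) 𝒟 := by
  induction m, hm using Nat.le_induction with
  | base => exact integrable_const _
  | succ m hm ih =>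
    obtain ⟨k, rfl⟩ : ∃ k, m = k + 1 := ⟨m - 1, by omega⟩
    exact ((ih ((Nat.mul_le_mul_right H (tau_mono (Nat.le_succ _))).trans hT)).div_const 3).add
      ((hX.integrable_ctxAdd hη hMs (by omega) hT ω).const_mul 3)

lemma integral_slack_succ (hX : IsRun μ ℱ 𝒟 s1 𝓜 Mstar M0 η ζ T X) (hη : ∀ m, 0 ≤ η m)
    (hMs : Mstar ∈ 𝓜) {m : ℕ} (hm : 1 ≤ m) (hT : tau (m + 1) * H ≤ T) (ω : Ω) :
    ∫ c, slack X 𝓜 M0 Mstar s1 η ζ (m + 1) ω c ∂𝒟 =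
      (∫ c, slack X 𝓜 M0 Mstar s1 η ζ m ω c ∂𝒟) / 3 +
        3 * ((Fintype.card S : ℝ) * Fintype.card A / (8 * η (m + 1)) +
        (2048 * (H : ℝ) ^ 3 * η (m + 1) + 64 * (H : ℝ) ^ 2 * ζ (m + 1)) *
          epochErr X 𝓜 M0 Mstar s1 𝒟 (η (m + 1)) (m + 1) ω) := by
  obtain ⟨k, rfl⟩ : ∃ k, m = k + 1 := ⟨m - 1, by omega⟩
  rw [← hX.integral_ctxAdd hη hMs (by omega) hT ω, ← integral_div, ← integral_const_mul,
    ← integral_add ((hX.integrable_slack hη hMs hm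
      ((Nat.mul_le_mul_right H (tau_mono (Nat.le_succ _))).trans hT) ω).div_const 3)
      ((hX.integrable_ctxAdd hη hMs (by omega) hT ω).const_mul 3)]
  rfl

/-- The expected regret of a round, in terms of the error of the previous estimate. -/
theorem roundRegret_toReal_le [Nonempty A] (hX : IsRun μ ℱ 𝒟 s1 𝓜 Mstar M0 η ζ T X)
    (hη : ∀ m, 0 ≤ η m) (hζ : ∀ m, 0 ≤ ζ m) (hMs : Mstar ∈ 𝓜) {m : ℕ} (hm : 2 ≤ m)
    (hpos : ∀ j, 2 ≤ j → j ≤ m → 0 < η j ∧ 0 < ζ j ∧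
      2 * (H : ℝ) ^ 2 * ((Fintype.card S : ℝ) ^ 2 * Fintype.card A) / ζ j ≤ 4 / 45 / η j)
    (h : Fin H) (hT : segStart H m h < T) (ω : Ω) :
    (roundRegret X M0 Mstar s1 𝒟 (η m) m h ω).toReal ≤
      4 * ((Fintype.card S : ℝ) * Fintype.card A) / η m +
        ∫ c, slack X 𝓜 M0 Mstar s1 η ζ (m - 1) ω c ∂𝒟 := by
  have hT' : tau (m - 1) * H ≤ T := by
    rw [← segStart_zero]
    exact ((segStart_mono H m (Nat.zero_le _)).trans_lt hT).le
  have hηm := (hpos m hm le_rfl).1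
  have hint := hX.integrable_slack hη hMs (show 1 ≤ m - 1 by omega) hT' ω (ζ := ζ)
  have hs0 := hX.slack_nonneg hη hζ hMs hT' ω
  have hreg : Measurable fun q : C × Policy S A H => ENNReal.ofReal (regret Mstar s1 q.1 q.2) :=
    (measurable_regret Mstar s1).ennreal_ofReal
  have key : ∀ c, ∫⁻ π, ENNReal.ofReal (regret Mstar s1 c π) ∂(X.igw M0 s1 (η m) m h ω c) ≤
      ENNReal.ofReal (4 * ((Fintype.card S : ℝ) * Fintype.card A) / η m +
        slack X 𝓜 M0 Mstar s1 η ζ (m - 1) ω c) := by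
    intro c
    have hl := hX.lam_pos m (by omega) h hT ω c
    have hw := weight_nonneg X M0 s1 (hη m) hl
    have hp : Measurable fun π : Policy S A H => (c, π) := measurable_prodMk_left
    have hreg' : Measurable fun π : Policy S A H => ENNReal.ofReal (regret Mstar s1 c π) :=
      (hreg.comp hp :)
    rw [lintegral_igw _ _ _ _ _ _ _ _ hreg']
    simp_rw [← ENNReal.ofReal_mul (hw _)]
    rw [← ENNReal.ofReal_sum_of_nonneg fun π _ => mul_nonneg (hw π) (regret_nonneg _ _ _ _)]
    refine ENNReal.ofReal_le_ofReal ?_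
    calc ∑ π ∈ X.polCover m h ω c, X.weight M0 s1 (η m) m h ω c π * regret Mstar s1 c π
        ≤ ∑ π ∈ X.polCover m h ω c, (2 / η m + X.weight M0 s1 (η m) m h ω c π *
            slack X 𝓜 M0 Mstar s1 η ζ (m - 1) ω c) := by
          refine Finset.sum_le_sum fun π _ => ?_
          have h1 := (hX.regret_le_and_regret_le hη hζ hMs (show 1 ≤ m - 1 by omega)
            (fun j hj hj' => hpos j hj (by omega)) hT' ω c π).1
          have h2 : X.weight M0 s1 (η m) m h ω c π * regret (X.estModel M0 (m - 1) ω) s1 c π ≤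
              1 / η m := by
            have hr := regHat_nonneg X M0 s1 m ω c π
            have := mul_nonneg hηm.le hr
            unfold RunData.weight
            change 1 / _ * X.regHat M0 s1 m ω c π ≤ _
            rw [one_div_mul_eq_div, div_le_div_iff₀ (by linarith) hηm]
            linarith
          have h3 := mul_le_mul_of_nonneg_left h1 (hw π)
          have h4 : 2 / η m = 2 * (1 / η m) := by ring
          rw [h4]
          linarith
      _ = (X.polCover m h ω c).card * (2 / η m) + slack X 𝓜 M0 Mstar s1 η ζ (m - 1) ω c := by
          rw [Finset.sum_add_distrib, ← Finset.sum_mul, hX.lam_sum m (by omega) h hT ω c,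
            Finset.sum_const, nsmul_eq_mul, one_mul]
      _ ≤ _ := by
          have h5 := mul_le_mul_of_nonneg_right (card_polCover_le_two_mul X s1 m h ω c)
            (show 0 ≤ 2 / η m by positivity)
          have h6 : 2 * ((Fintype.card S : ℝ) * Fintype.card A) * (2 / η m) =
              4 * ((Fintype.card S : ℝ) * Fintype.card A) / η m := by ring
          linarith
  have hnn : ∀ c, 0 ≤ 4 * ((Fintype.card S : ℝ) * Fintype.card A) / η m +
      slack X 𝓜 M0 Mstar s1 η ζ (m - 1) ω c := fun c => add_nonneg (by positivity) (hs0 c)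
  have hint' : Integrable (fun c => 4 * ((Fintype.card S : ℝ) * Fintype.card A) / η m +
      slack X 𝓜 M0 Mstar s1 η ζ (m - 1) ω c) 𝒟 := (integrable_const _).add hint
  have h1 : roundRegret X M0 Mstar s1 𝒟 (η m) m h ω ≤
      ENNReal.ofReal (∫ c, (4 * ((Fintype.card S : ℝ) * Fintype.card A) / η m +
        slack X 𝓜 M0 Mstar s1 η ζ (m - 1) ω c) ∂𝒟) := by
    rw [ofReal_integral_eq_lintegral_ofReal hint'
      (Filter.Eventually.of_forall hnn)]
    exact lintegral_mono key
  have h2 := ENNReal.toReal_le_of_le_ofReal (integral_nonneg hnn) h1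
  rw [integral_add (integrable_const _) hint] at h2
  simpa using h2

end IsRun

end Average

/-! ### The number of epochs -/

lemma numEpochs_spec {H : ℕ} (hH : 1 ≤ H) (T : ℕ) :
    1 ≤ numEpochs H T ∧ T ≤ tau (numEpochs H T) * H := by
  have hne : {N | 1 ≤ N ∧ T ≤ tau N * H}.Nonempty := by
    refine ⟨T + 1, by omega, ?_⟩
    rw [tau_of_pos (by omega)]
    have h1 : T + 1 < 2 ^ (T + 1) := Nat.lt_two_pow_self
    nlinarith
  exact Nat.sInf_mem hne

lemma tau_mul_lt_of_lt_numEpochs {H T m : ℕ} (hm : 1 ≤ m) (h : m < numEpochs H T) :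
    tau m * H < T := by
  by_contra hge
  exact absurd (Nat.sInf_le (s := {N | 1 ≤ N ∧ T ≤ tau N * H}) ⟨hm, not_lt.1 hge⟩) (not_le.2 h)

lemma numEpochs_le_three_mul_log {H T : ℕ} (hH : 1 ≤ H) (hT : 2 ≤ T) :
    (numEpochs H T : ℝ) ≤ 3 * Real.log T := by
  have hTr : (2 : ℝ) ≤ T := by exact_mod_cast hT
  have hl : Real.log 2 ≤ Real.log T := Real.log_le_log (by norm_num) hTr
  have hl2 := Real.log_two_gt_d9
  obtain ⟨k, hk⟩ : ∃ k, numEpochs H T = k + 1 :=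
    ⟨numEpochs H T - 1, by have := (numEpochs_spec hH T).1; omega⟩
  rw [hk]
  rcases Nat.eq_zero_or_pos k with rfl | hk0
  · push_cast; linarith
  · have h1 := tau_mul_lt_of_lt_numEpochs (H := H) (T := T) hk0 (by omega)
    rw [tau_of_pos hk0] at h1
    have h2 : 2 ^ k ≤ T := (Nat.le_mul_of_pos_right _ hH).trans h1.le
    have h3 : ((2 : ℝ) ^ k) ≤ T := by exact_mod_cast h2
    have h4 : (k : ℝ) * Real.log 2 ≤ Real.log T := by
      rw [← Real.log_pow]; exact Real.log_le_log (by positivity) h3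
    have h5 : (1 : ℝ) ≤ k := by exact_mod_cast hk0
    push_cast
    nlinarith

/-- Every round belongs to a segment. -/
lemma exists_mem_segment {H T t : ℕ} (hH : 1 ≤ H) (ht : t < T) :
    ∃ m, 1 ≤ m ∧ m ≤ numEpochs H T ∧ ∃ h : Fin H, t ∈ segment H m h := by
  have hex : ∃ m, 1 ≤ m ∧ t < tau m * H :=
    ⟨numEpochs H T, (numEpochs_spec hH T).1, ht.trans_le (numEpochs_spec hH T).2⟩
  classical
  obtain ⟨h1, h2⟩ := Nat.find_spec hex
  set m := Nat.find hex with hm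
  have h3 : tau (m - 1) * H ≤ t := by
    rcases Nat.lt_or_ge (m - 1) 1 with h0 | h0
    · have : m - 1 = 0 := by omega
      rw [this, tau_zero]; omega
    · by_contra hlt
      exact Nat.find_min hex (show m - 1 < m by omega) ⟨h0, not_le.1 hlt⟩
  refine ⟨m, h1, Nat.find_min' hex ⟨(numEpochs_spec hH T).1,
    ht.trans_le (numEpochs_spec hH T).2⟩, ?_⟩
  have hn : 0 < tau m - tau (m - 1) := Nat.sub_pos_of_lt (tau_pred_lt h1)
  set n := tau m - tau (m - 1) with hn'
  have h4 : tau m * H = tau (m - 1) * H + n * H := by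
    rw [← add_mul]; congr 1; have := tau_pred_lt h1; omega
  have h5 : (t - tau (m - 1) * H) / n < H := by
    rw [Nat.div_lt_iff_lt_mul hn, Nat.mul_comm H n]; omega
  refine ⟨⟨(t - tau (m - 1) * H) / n, h5⟩, Finset.mem_Ico.2 ?_⟩
  have h6 := Nat.div_add_mod (t - tau (m - 1) * H) n
  have h7 := Nat.mod_lt (t - tau (m - 1) * H) hn
  simp only [segStart, ← hn']
  rw [mul_add]
  omega

lemma two_pow_le_tau_sub {m : ℕ} (hm : 2 ≤ m) : 2 ^ m ≤ 4 * (tau (m - 1) - tau (m - 2)) := by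
  obtain ⟨k, rfl⟩ : ∃ k, m = k + 2 := ⟨m - 2, by omega⟩
  rcases Nat.eq_zero_or_pos k with rfl | hk
  · simp [tau]
  · rw [show k + 2 - 1 = k + 1 by omega, Nat.add_sub_cancel, tau_of_pos (by omega), tau_of_pos hk,
      pow_succ, pow_succ]
    omega

lemma tau_sub_le_tau_sub {m : ℕ} (hm : 2 ≤ m) :
    tau (m - 1) - tau (m - 2) ≤ tau m - tau (m - 1) := by
  obtain ⟨k, rfl⟩ : ∃ k, m = k + 2 := ⟨m - 2, by omega⟩
  rcases Nat.eq_zero_or_pos k with rfl | hk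
  · simp [tau]
  · rw [show k + 2 - 1 = k + 1 by omega, Nat.add_sub_cancel, tau_of_pos (show 1 ≤ k + 2 by omega),
      tau_of_pos (show 1 ≤ k + 1 by omega), tau_of_pos hk, pow_succ, pow_succ]
    omega

/-- The number of oracle calls is at most logarithmic in the number of rounds. -/
lemma oracleCalls_finite_and_ncard_le {H T : ℕ} (hH : 1 ≤ H) (hT : 2 ≤ T) :
    (oracleCalls H T).Finite ∧ ((oracleCalls H T).ncard : ℝ) ≤ 3 * H * Real.log T := by
  have hsub : oracleCalls H T ⊆
      ((Finset.Icc 1 (numEpochs H T) ×ˢ (Finset.univ : Finset (Fin H)) : Finset (ℕ × Fin H)) :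
        Set (ℕ × Fin H)) := by
    rintro ⟨m, h⟩ ⟨h1, h2⟩
    simp only at h1 h2
    simp only [Finset.coe_product, Set.mem_prod, Finset.mem_coe, Finset.mem_Icc, Finset.mem_univ,
      and_true]
    refine ⟨h1, ?_⟩
    -- the last round of the segment is a round of an epoch not after the last one
    by_contra hlt
    have h3 := tau_mono (show numEpochs H T ≤ m - 1 by omega)
    have h4 := (numEpochs_spec hH T).2.trans (Nat.mul_le_mul_right H h3)
    have h5 := segStart_mono H m (Nat.zero_le (h : ℕ))
    rw [segStart_zero] at h5
    have h6 := segStart_succ H m h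
    have h7 := tau_pred_lt h1
    omega
  refine ⟨(Finset.finite_toSet _).subset hsub, ?_⟩
  have h1 := Set.ncard_le_ncard hsub (Finset.finite_toSet _)
  rw [Set.ncard_coe_finset, Finset.card_product, Nat.card_Icc, Finset.card_univ,
    Fintype.card_fin] at h1
  have h2 : ((oracleCalls H T).ncard : ℝ) ≤ numEpochs H T * H := by
    have : (oracleCalls H T).ncard ≤ numEpochs H T * H := by simpa using h1
    exact_mod_cast this
  have h3 := mul_le_mul_of_nonneg_right (numEpochs_le_three_mul_log hH hT) (Nat.cast_nonneg H)
  linarith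

/-! ### The parameters -/

/-- The logarithm in the regret bound is bounded below, as `|𝓜| log T / δ ≥ 2 log 2`. -/
lemma three_div_eleven_le_log {D T : ℕ} (hD : 1 ≤ D) (hT : 2 ≤ T) {δ : ℝ} (hδ : 0 < δ)
    (hδ' : δ < 1 / 2) : 3 / 11 ≤ Real.log (D * Real.log T / δ) := by
  have hTr : (2 : ℝ) ≤ T := by exact_mod_cast hT
  have hDr : (1 : ℝ) ≤ D := by exact_mod_cast hD
  have hl : Real.log 2 ≤ Real.log T := Real.log_le_log (by norm_num) hTr
  have hl2 := Real.log_two_gt_d9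
  have hx : (11 / 8 : ℝ) ≤ D * Real.log T / δ := by
    rw [le_div_iff₀ hδ]
    nlinarith
  refine le_trans ?_ (Real.log_le_log (by norm_num) hx)
  have := Real.one_sub_inv_le_log_of_pos (show (0 : ℝ) < 11 / 8 by norm_num)
  norm_num at this ⊢
  linarith

/-- The logarithm in the rate of the oracle is of the order of the logarithm in the regret bound. -/
lemma log_confidence_le {D H T ν : ℕ} (hH : 1 ≤ H) (hD : 1 ≤ D) (hT : 2 ≤ T) {δ : ℝ} (hδ : 0 < δ)
    (hδ' : δ < 1 / 2) (hν : 1 ≤ ν) (hν' : ν ≤ numEpochs H T) :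
    Real.log (D / (δ / (2 * (ν : ℝ) ^ 2))) ≤ 13 * Real.log (D * Real.log T / δ) := by
  have hTr : (2 : ℝ) ≤ T := by exact_mod_cast hT
  have hDr : (1 : ℝ) ≤ D := by exact_mod_cast hD
  have hνr : (1 : ℝ) ≤ ν := by exact_mod_cast hν
  have hl : 0 < Real.log T := Real.log_pos (by linarith)
  have h1 : (ν : ℝ) ≤ 3 * Real.log T :=
    le_trans (by exact_mod_cast hν') (numEpochs_le_three_mul_log hH hT)
  have h2 := three_div_eleven_le_log hD hT hδ hδ'
  set x := (D : ℝ) * Real.log T / δ with hx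
  have hx0 : 0 < x := by positivity
  have h3 : (D : ℝ) / (δ / (2 * (ν : ℝ) ^ 2)) ≤ 18 * x ^ 2 := by
    have e1 : (D : ℝ) / (δ / (2 * (ν : ℝ) ^ 2)) = 2 * (ν : ℝ) ^ 2 * (D / δ) := by
      field_simp
    have e2 : 18 * x ^ 2 = 2 * (3 * Real.log T) ^ 2 * ((D / δ) * (D / δ)) := by
      rw [hx]; field_simp; ring
    rw [e1, e2]
    have h4 : 1 ≤ (D : ℝ) / δ := by rw [le_div_iff₀ hδ]; linarith
    have h5 : (D : ℝ) / δ ≤ (D / δ) * (D / δ) := le_mul_of_one_le_left (by linarith) h4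
    gcongr
  refine (Real.log_le_log (by positivity) h3).trans ?_
  rw [Real.log_mul (by norm_num) (by positivity), Real.log_pow]
  have h6 : Real.log 18 ≤ 3 := by
    rw [Real.log_le_iff_le_exp (by norm_num)]
    have h7 := Real.exp_one_gt_d9
    have h8 : Real.exp 3 = Real.exp 1 ^ 3 := by rw [← Real.exp_nat_mul]; norm_num
    rw [h8]
    have h9 : (2.7 : ℝ) ^ 3 ≤ Real.exp 1 ^ 3 := by gcongr; linarith
    norm_num at h9 ⊢
    linarith
  push_cast
  linarith

lemma log_confidence_pos {D ν : ℕ} (hD : 1 ≤ D) {δ : ℝ} (hδ : 0 < δ)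
    (hδ' : δ < 1 / 2) (hν : 1 ≤ ν) : 0 < Real.log (D / (δ / (2 * (ν : ℝ) ^ 2))) := by
  have hDr : (1 : ℝ) ≤ D := by exact_mod_cast hD
  have hνr : (1 : ℝ) ≤ ν := by exact_mod_cast hν
  refine Real.log_pos ?_
  rw [lt_div_iff₀ (by positivity), one_mul, div_lt_iff₀ (by positivity)]
  nlinarith

/-- The common order of magnitude `H⁶ S⁴ A³ / γ_m` of all error terms of epoch `m`. -/
noncomputable def errScale (K δ : ℝ) (D H S A ν m : ℕ) : ℝ :=
  (H : ℝ) ^ 6 * (S : ℝ) ^ 4 * (A : ℝ) ^ 3 / gammaParam K δ D H S A ν m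

section Params

variable {K δ : ℝ} {D H S A ν m : ℕ}

lemma mleRate_pos (hK : 0 < K) (hδ : 0 < δ) (hδ' : δ < 1 / 2) (hD : 1 ≤ D) (hν : 1 ≤ ν)
    (hm : 2 ≤ m) : 0 < mleRate K D (δ / (2 * (ν : ℝ) ^ 2)) (tau (m - 1) - tau (m - 2)) := by
  have h1 := two_pow_le_tau_sub hm
  have h2 : 0 < tau (m - 1) - tau (m - 2) := by
    have : 0 < 2 ^ m := by positivity
    omega
  have h3 : (0 : ℝ) < ((tau (m - 1) - tau (m - 2) : ℕ) : ℝ) := by exact_mod_cast h2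
  have h4 := log_confidence_pos hD hδ hδ' hν
  unfold mleRate
  positivity

lemma gammaParam_nonneg : 0 ≤ gammaParam K δ D H S A ν m := by
  unfold gammaParam
  split_ifs
  · exact le_rfl
  · exact Real.sqrt_nonneg _

lemma etaParam_nonneg : 0 ≤ etaParam K δ D H S A ν m :=
  div_nonneg gammaParam_nonneg (by positivity)

lemma zetaParam_nonneg : 0 ≤ zetaParam K δ D H S A ν m :=
  div_nonneg gammaParam_nonneg (by positivity)

lemma gammaParam_pos (hK : 0 < K) (hδ : 0 < δ) (hδ' : δ < 1 / 2) (hD : 1 ≤ D) (hν : 1 ≤ ν)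
    (hm : 2 ≤ m) (hH : 1 ≤ H) (hS : 1 ≤ S) (hA : 1 ≤ A) : 0 < gammaParam K δ D H S A ν m := by
  have h1 := mleRate_pos hK hδ hδ' hD hν hm
  rw [gammaParam, if_neg (by omega)]
  positivity

lemma gammaParam_mul_mleRate (hK : 0 < K) (hδ : 0 < δ) (hδ' : δ < 1 / 2) (hD : 1 ≤ D) (hν : 1 ≤ ν)
    (hm : 2 ≤ m) (hH : 1 ≤ H) (hS : 1 ≤ S) (hA : 1 ≤ A) :
    gammaParam K δ D H S A ν m *
      mleRate K D (δ / (2 * (ν : ℝ) ^ 2)) (tau (m - 1) - tau (m - 2)) =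
      errScale K δ D H S A ν m := by
  have h1 := mleRate_pos hK hδ hδ' hD hν hm
  have h2 := gammaParam_pos hK hδ hδ' hD hν hm hH hS hA
  have h3 : gammaParam K δ D H S A ν m ^ 2 = (H : ℝ) ^ 6 * (S : ℝ) ^ 4 * (A : ℝ) ^ 3 /
      mleRate K D (δ / (2 * (ν : ℝ) ^ 2)) (tau (m - 1) - tau (m - 2)) := by
    rw [gammaParam, if_neg (by omega), Real.sq_sqrt (by positivity)]
  rw [errScale, eq_div_iff h2.ne', mul_right_comm, ← sq, h3, div_mul_cancel₀ _ h1.ne']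

/-- The error scale decays like the inverse square root of the length of the epoch. -/
lemma errScale_le {T : ℕ} (hK : 0 < K) (hδ : 0 < δ) (hδ' : δ < 1 / 2) (hD : 1 ≤ D) (hν : 1 ≤ ν)
    (hm : 2 ≤ m) (hH : 1 ≤ H) (hS : 1 ≤ S) (hA : 1 ≤ A) (hT : 2 ≤ T) (hν' : ν ≤ numEpochs H T) :
    errScale K δ D H S A ν m ≤ Real.sqrt (52 * K) *
      Real.sqrt ((H : ℝ) ^ 6 * (S : ℝ) ^ 4 * (A : ℝ) ^ 3 * Real.log (D * Real.log T / δ)) *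
      Real.sqrt (1 / 2) ^ m := by
  have h1 := mleRate_pos hK hδ hδ' hD hν hm
  have h2 := gammaParam_pos hK hδ hδ' hD hν hm hH hS hA
  have h3 := gammaParam_mul_mleRate hK hδ hδ' hD hν hm hH hS hA
  have hl := three_div_eleven_le_log hD hT hδ hδ'
  have hL := log_confidence_le hH hD hT hδ hδ' hν hν'
  set ℓ := Real.log (D * Real.log T / δ) with hℓ
  set G := (H : ℝ) ^ 6 * (S : ℝ) ^ 4 * (A : ℝ) ^ 3 with hG
  have hG0 : 0 < G := by positivity
  refine le_of_sq_le_sq_of_nonneg ?_ (by positivity)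
  have e1 : errScale K δ D H S A ν m ^ 2 =
      G * mleRate K D (δ / (2 * (ν : ℝ) ^ 2)) (tau (m - 1) - tau (m - 2)) := by
    rw [sq]; nth_rw 2 [← h3]
    rw [errScale, ← mul_assoc, div_mul_cancel₀ _ h2.ne']
  have e2 : (Real.sqrt (52 * K) * Real.sqrt (G * ℓ) * Real.sqrt (1 / 2) ^ m) ^ 2 =
      G * (K * (13 * ℓ) / (2 ^ m / 4)) := by
    rw [mul_pow, mul_pow, Real.sq_sqrt (by positivity), Real.sq_sqrt (by positivity), ← pow_mul,
      mul_comm m 2, pow_mul, Real.sq_sqrt (by norm_num), one_div, inv_pow]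
    field_simp
    ring
  rw [e1, e2]
  refine mul_le_mul_of_nonneg_left ?_ hG0.le
  have h4 : ((2 : ℝ) ^ m) / 4 ≤ ((tau (m - 1) - tau (m - 2) : ℕ) : ℝ) := by
    have : ((2 ^ m : ℕ) : ℝ) ≤ ((4 * (tau (m - 1) - tau (m - 2)) : ℕ) : ℝ) := by
      exact_mod_cast two_pow_le_tau_sub hm
    push_cast at this ⊢
    linarith
  unfold mleRate
  gcongr

lemma card_div_etaParam_le (hK : 0 < K) (hδ : 0 < δ) (hδ' : δ < 1 / 2) (hD : 1 ≤ D) (hν : 1 ≤ ν)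
    (hm : 2 ≤ m) (hH : 1 ≤ H) (hS : 1 ≤ S) (hA : 1 ≤ A) :
    (S : ℝ) * A / etaParam K δ D H S A ν m ≤ 2160 * errScale K δ D H S A ν m := by
  have h2 := gammaParam_pos hK hδ hδ' hD hν hm hH hS hA
  have hHr : (1 : ℝ) ≤ H := by exact_mod_cast hH
  have he := Real.exp_one_lt_d9
  have hSr : (0 : ℝ) < S := by exact_mod_cast hS
  have hAr : (0 : ℝ) < A := by exact_mod_cast hA
  unfold errScale etaParam
  set γ := gammaParam K δ D H S A ν m
  have e1 : (S : ℝ) * A / (γ / (720 * Real.exp 1 * (H : ℝ) ^ 5 * (S : ℝ) ^ 3 * (A : ℝ) ^ 2)) =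
      (720 * Real.exp 1) * ((H : ℝ) ^ 5 * (S : ℝ) ^ 4 * (A : ℝ) ^ 3 / γ) := by
    field_simp
  rw [e1]
  have h5 : (H : ℝ) ^ 5 ≤ (H : ℝ) ^ 6 := pow_le_pow_right₀ hHr (by norm_num)
  have h6 : 720 * Real.exp 1 ≤ 2160 := by linarith
  gcongr

/-- The untrusted mass, which is of the order `1 / ζ`, is dominated by a small multiple of
`1 / η`. -/
lemma eta_zeta_balance (hK : 0 < K) (hδ : 0 < δ) (hδ' : δ < 1 / 2) (hD : 1 ≤ D) (hν : 1 ≤ ν)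
    (hm : 2 ≤ m) (hH : 1 ≤ H) (hS : 1 ≤ S) (hA : 1 ≤ A) :
    0 < etaParam K δ D H S A ν m ∧ 0 < zetaParam K δ D H S A ν m ∧
      2 * (H : ℝ) ^ 2 * ((S : ℝ) ^ 2 * A) / zetaParam K δ D H S A ν m ≤
        4 / 45 / etaParam K δ D H S A ν m := by
  have h2 := gammaParam_pos hK hδ hδ' hD hν hm hH hS hA
  have hHr : (1 : ℝ) ≤ H := by exact_mod_cast hH
  have hSr : (1 : ℝ) ≤ S := by exact_mod_cast hS
  have hAr : (1 : ℝ) ≤ A := by exact_mod_cast hA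
  have hex := Real.exp_pos 1
  unfold etaParam zetaParam
  set γ := gammaParam K δ D H S A ν m
  refine ⟨by positivity, by positivity, ?_⟩
  have e1 : 2 * (H : ℝ) ^ 2 * ((S : ℝ) ^ 2 * A) / (γ / (8 * Real.exp 1 * H * ((H : ℝ) + 1) ^ 2)) =
      (Real.exp 1 / γ) * (16 * (H : ℝ) ^ 3 * ((H : ℝ) + 1) ^ 2 * (S : ℝ) ^ 2 * A) := by
    field_simp
    ring
  have e2 : 4 / 45 / (γ / (720 * Real.exp 1 * (H : ℝ) ^ 5 * (S : ℝ) ^ 3 * (A : ℝ) ^ 2)) =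
      (Real.exp 1 / γ) * (64 * (H : ℝ) ^ 5 * (S : ℝ) ^ 3 * (A : ℝ) ^ 2) := by
    field_simp
    ring
  rw [e1, e2]
  refine mul_le_mul_of_nonneg_left ?_ (by positivity)
  have h3 : ((H : ℝ) + 1) ^ 2 ≤ 4 * (H : ℝ) ^ 2 := by nlinarith
  have h4 : (S : ℝ) ^ 2 ≤ (S : ℝ) ^ 3 := pow_le_pow_right₀ hSr (by norm_num)
  have h5 : (A : ℝ) ≤ (A : ℝ) ^ 2 := by nlinarith
  calc 16 * (H : ℝ) ^ 3 * ((H : ℝ) + 1) ^ 2 * (S : ℝ) ^ 2 * A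
      ≤ 16 * (H : ℝ) ^ 3 * (4 * (H : ℝ) ^ 2) * (S : ℝ) ^ 3 * (A : ℝ) ^ 2 := by gcongr
    _ = _ := by ring

/-- The additive value error of an epoch is of the order of the error scale. -/
lemma add_err_le (hK : 0 < K) (hδ : 0 < δ) (hδ' : δ < 1 / 2) (hD : 1 ≤ D) (hν : 1 ≤ ν)
    (hm : 2 ≤ m) (hH : 1 ≤ H) (hS : 1 ≤ S) (hA : 1 ≤ A) {ε : ℝ}
    (hε : ε ≤ 2 * H * (mleRate K D (δ / (2 * (ν : ℝ) ^ 2)) (tau (m - 1) - tau (m - 2)) / K)) :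
    (S : ℝ) * A / (8 * etaParam K δ D H S A ν m) +
      (2048 * (H : ℝ) ^ 3 * etaParam K δ D H S A ν m +
        64 * (H : ℝ) ^ 2 * zetaParam K δ D H S A ν m) * ε ≤
      (270 + 9 / K) * errScale K δ D H S A ν m := by
  have h1 := mleRate_pos hK hδ hδ' hD hν hm
  have h2 := gammaParam_pos hK hδ hδ' hD hν hm hH hS hA
  have h3 := gammaParam_mul_mleRate hK hδ hδ' hD hν hm hH hS hA
  have h4 := card_div_etaParam_le hK hδ hδ' hD hν hm hH hS hA
  have hHr : (1 : ℝ) ≤ H := by exact_mod_cast hH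
  have hSr : (1 : ℝ) ≤ S := by exact_mod_cast hS
  have hAr : (1 : ℝ) ≤ A := by exact_mod_cast hA
  have he := Real.exp_one_gt_d9
  have h5 : (S : ℝ) * A / (8 * etaParam K δ D H S A ν m) =
      (S : ℝ) * A / etaParam K δ D H S A ν m / 8 := by rw [mul_comm 8, div_div]
  have hη0 := etaParam_nonneg (K := K) (δ := δ) (D := D) (H := H) (S := S) (A := A) (ν := ν) (m := m)
  have hζ0 := zetaParam_nonneg (K := K) (δ := δ) (D := D) (H := H) (S := S) (A := A) (ν := ν)
    (m := m)
  have h6 : (2048 * (H : ℝ) ^ 3 * etaParam K δ D H S A ν m +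
      64 * (H : ℝ) ^ 2 * zetaParam K δ D H S A ν m) * ε ≤
      (2048 * (H : ℝ) ^ 3 * etaParam K δ D H S A ν m +
      64 * (H : ℝ) ^ 2 * zetaParam K δ D H S A ν m) *
      (2 * H * (mleRate K D (δ / (2 * (ν : ℝ) ^ 2)) (tau (m - 1) - tau (m - 2)) / K)) := by
    gcongr
  have hg0 : 0 ≤ errScale K δ D H S A ν m := by rw [← h3]; positivity
  set E := mleRate K D (δ / (2 * (ν : ℝ) ^ 2)) (tau (m - 1) - tau (m - 2))
  set g := errScale K δ D H S A ν m
  have h7 : 2048 * (H : ℝ) ^ 3 * etaParam K δ D H S A ν m * (2 * H * (E / K)) ≤ 3 / K * g := by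
    rw [← h3]
    unfold etaParam
    set γ := gammaParam K δ D H S A ν m
    have e1 : 2048 * (H : ℝ) ^ 3 * (γ / (720 * Real.exp 1 * (H : ℝ) ^ 5 * (S : ℝ) ^ 3 *
        (A : ℝ) ^ 2)) * (2 * H * (E / K)) =
        (4096 / (720 * Real.exp 1 * (H * (S : ℝ) ^ 3 * (A : ℝ) ^ 2))) * (γ * E / K) := by
      field_simp
      ring
    have e2 : 3 / K * (γ * E) = 3 * (γ * E / K) := by ring
    rw [e1, e2]
    refine mul_le_mul_of_nonneg_right ?_ (by positivity)
    have h8 : 1 ≤ H * (S : ℝ) ^ 3 * (A : ℝ) ^ 2 :=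
      one_le_mul_of_one_le_of_one_le (one_le_mul_of_one_le_of_one_le hHr (one_le_pow₀ hSr))
        (one_le_pow₀ hAr)
    rw [div_le_iff₀ (by positivity)]
    nlinarith
  have h9 : 64 * (H : ℝ) ^ 2 * zetaParam K δ D H S A ν m * (2 * H * (E / K)) ≤ 6 / K * g := by
    rw [← h3]
    unfold zetaParam
    set γ := gammaParam K δ D H S A ν m
    have e1 : 64 * (H : ℝ) ^ 2 * (γ / (8 * Real.exp 1 * H * ((H : ℝ) + 1) ^ 2)) *
        (2 * H * (E / K)) =
        (16 * (H : ℝ) ^ 2 / (Real.exp 1 * ((H : ℝ) + 1) ^ 2)) * (γ * E / K) := by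
      field_simp
      ring
    have e2 : 6 / K * (γ * E) = 6 * (γ * E / K) := by ring
    rw [e1, e2]
    refine mul_le_mul_of_nonneg_right ?_ (by positivity)
    rw [div_le_iff₀ (by positivity)]
    have h8 : (H : ℝ) ^ 2 ≤ ((H : ℝ) + 1) ^ 2 := by gcongr; linarith
    nlinarith
  have h10 : (270 + 9 / K) * g = 270 * g + (3 / K * g + 6 / K * g) := by ring
  rw [h5, h10]
  linarith

end Params

/-! ### The regret bound -/

lemma sum_inv_sqrt_le (T : ℕ) :
    ∑ t ∈ Finset.range T, 1 / Real.sqrt ((t : ℝ) + 1) ≤ 2 * Real.sqrt T := by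
  induction T with
  | zero => simp
  | succ T ih =>
    rw [Finset.sum_range_succ]
    push_cast
    have h1 : 0 < Real.sqrt ((T : ℝ) + 1) := Real.sqrt_pos.2 (by positivity)
    have h2 := Real.sqrt_nonneg (T : ℝ)
    have h3 := Real.sq_sqrt (show (0 : ℝ) ≤ T by positivity)
    have h4 := Real.sq_sqrt (show (0 : ℝ) ≤ (T : ℝ) + 1 by positivity)
    have h5 : 1 / Real.sqrt ((T : ℝ) + 1) ≤
        2 * Real.sqrt ((T : ℝ) + 1) - 2 * Real.sqrt (T : ℝ) := by
      rw [div_le_iff₀ h1]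
      nlinarith [sq_nonneg (Real.sqrt ((T : ℝ) + 1) - Real.sqrt (T : ℝ))]
    linarith

lemma sum_inv_sq_le (N : ℕ) : ∑ m ∈ Finset.Ico 2 N, 1 / (2 * (m : ℝ) ^ 2) ≤ 1 := by
  rcases Nat.lt_or_ge N 2 with hN | hN
  · rw [Finset.Ico_eq_empty (by omega)]; simp
  have key : ∑ m ∈ Finset.Ico 2 N, 1 / (2 * (m : ℝ) ^ 2) ≤ 1 - 1 / ((N : ℝ) - 1) := by
    induction N, hN using Nat.le_induction with
    | base => norm_num
    | succ N hN ih =>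
      rw [Finset.sum_Ico_succ_top hN]
      have hNr : (2 : ℝ) ≤ N := by exact_mod_cast hN
      have h1 : 1 / (2 * (N : ℝ) ^ 2) ≤ 1 / ((N : ℝ) - 1) - 1 / N := by
        rw [div_sub_div _ _ (by linarith) (by linarith), div_le_div_iff₀ (by positivity)
          (mul_pos (by linarith) (by linarith))]
        nlinarith
      push_cast
      rw [add_sub_cancel_right]
      linarith
  have hNr : (2 : ℝ) ≤ N := by exact_mod_cast hN
  have : 0 ≤ 1 / ((N : ℝ) - 1) := div_nonneg zero_le_one (by linarith)
  linarith

/-- The constant in the bound of the averaged `slack`: three times the constant `270 + 9 / K` of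
`add_err_le`, times the constant `√(52 K)` of `errScale_le`, with a factor `3` for the geometric
sum. -/
noncomputable def slackConst (K : ℝ) : ℝ := 3 * (1 + (810 + 27 / K) * Real.sqrt (52 * K))

/-- The constant in the bound of the regret of a round: the first term bounds `4 S A / η`, the second
one the error of the previous estimate. -/
noncomputable def roundConst (K : ℝ) : ℝ := 8640 * Real.sqrt (52 * K) + 2 * slackConst K

lemma three_le_slackConst {K : ℝ} (hK : 0 < K) : 3 ≤ slackConst K := by
  have : 0 ≤ (810 + 27 / K) * Real.sqrt (52 * K) := by positivity
  unfold slackConst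
  linarith

section Regret

variable {Ω C S A : Type*} [MeasurableSpace C] [Fintype S] [Fintype A] [Nonempty A]
  [MeasurableSpace S] [MeasurableSpace A] [MeasurableSingletonClass S] [MeasurableSingletonClass A]
  {H : ℕ} [mΩ : MeasurableSpace Ω] {μ : Measure Ω} [IsProbabilityMeasure μ]
  {ℱ : Filtration ℕ mΩ} {𝒟 : Measure C} [IsProbabilityMeasure 𝒟]
  {s1 : S} {𝓜 : Finset (CMDP C S A H)} {Mstar M0 : CMDP C S A H} {η ζ : ℕ → ℝ} {T : ℕ}
  {X : RunData Ω C S A H} {K δ : ℝ} {ν : ℕ → ℕ}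

/-- The event that the maximum likelihood guarantee holds in epoch `m` with confidence `δ`. -/
def MLESucceeds (X : RunData Ω C S A H) (𝓜 : Finset (CMDP C S A H)) (M0 Ms : CMDP C S A H)
    (s1 : S) (𝒟 : Measure C) (η δ : ℝ) (m : ℕ) (ω : Ω) : Prop :=
  ((tau m - tau (m - 1) : ℕ) : ℝ) * ∑ h, (1 -
    (segAff X 𝓜 M0 Ms s1 𝒟 η m h (X.est m h ω) ω).toReal) ≤
      H * Real.log 𝓜.card + Real.log (1 / δ)

/-- `√(H⁶ S⁴ A³ log (|𝓜| log T / δ))`, the regret bound divided by `√(H T)`. -/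
noncomputable def regretScale (D H S A T : ℕ) (δ : ℝ) : ℝ :=
  Real.sqrt ((H : ℝ) ^ 6 * (S : ℝ) ^ 4 * (A : ℝ) ^ 3 * Real.log (D * Real.log T / δ))

lemma le_two_mul_regretScale {D H S A T : ℕ} (hD : 1 ≤ D) (hH : 1 ≤ H) (hS : 1 ≤ S) (hA : 1 ≤ A)
    (hT : 2 ≤ T) (hδ : 0 < δ) (hδ' : δ < 1 / 2) : (H : ℝ) ≤ 2 * regretScale D H S A T δ := by
  have hHr : (1 : ℝ) ≤ H := by exact_mod_cast hH
  have hSr : (1 : ℝ) ≤ S := by exact_mod_cast hS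
  have hAr : (1 : ℝ) ≤ A := by exact_mod_cast hA
  have hl := three_div_eleven_le_log hD hT hδ hδ'
  have h1 : (H : ℝ) / 2 ≤ regretScale D H S A T δ := by
    refine Real.le_sqrt_of_sq_le ?_
    calc ((H : ℝ) / 2) ^ 2 = (H : ℝ) ^ 2 * 1 * 1 * (1 / 4) := by ring
      _ ≤ (H : ℝ) ^ 6 * (S : ℝ) ^ 4 * (A : ℝ) ^ 3 * Real.log (D * Real.log T / δ) := by
        have h2 := pow_le_pow_right₀ hHr (show 2 ≤ 6 by norm_num)
        have h3 := one_le_pow₀ hSr (n := 4)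
        have h4 := one_le_pow₀ hAr (n := 3)
        have h5 : (1 / 4 : ℝ) ≤ Real.log (D * Real.log T / δ) := by linarith
        gcongr
  linarith

lemma sqrt_half_bounds : 7 / 10 ≤ Real.sqrt (1 / 2) ∧ Real.sqrt (1 / 2) ≤ 1 :=
  ⟨Real.le_sqrt_of_sq_le (by norm_num), Real.sqrt_le_one.2 (by norm_num)⟩

namespace IsRun

lemma epochErr_le (hX : IsRun μ ℱ 𝒟 s1 𝓜 Mstar M0 η ζ T X) (hη : ∀ m, 0 ≤ η m)
    (hMs : Mstar ∈ 𝓜) (hK : 0 < K) (hδ : 0 < δ) (hδ' : δ < 1 / 2) (hH : 1 ≤ H) {m k : ℕ}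
    (hm : 2 ≤ m) (hT : tau m * H ≤ T) (hk : 1 ≤ k) {ω : Ω}
    (hω : MLESucceeds X 𝓜 M0 Mstar s1 𝒟 (η m) (δ / (2 * (k : ℝ) ^ 2)) m ω) :
    epochErr X 𝓜 M0 Mstar s1 𝒟 (η m) m ω ≤ 2 * H *
      (mleRate K 𝓜.card (δ / (2 * (k : ℝ) ^ 2)) (tau (m - 1) - tau (m - 2)) / K) := by
  have hcard : 1 ≤ 𝓜.card := Finset.card_pos.2 ⟨_, hMs⟩
  have hcardr : (1 : ℝ) ≤ 𝓜.card := by exact_mod_cast hcard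
  have hHr : (1 : ℝ) ≤ H := by exact_mod_cast hH
  have hkr : (1 : ℝ) ≤ k := by exact_mod_cast hk
  have hn1 : (0 : ℝ) < ((tau (m - 1) - tau (m - 2) : ℕ) : ℝ) := by
    have h1 := two_pow_le_tau_sub hm
    have h2 : 0 < tau (m - 1) - tau (m - 2) := by
      have : 0 < 2 ^ m := by positivity
      omega
    exact_mod_cast h2
  have hn2 : ((tau (m - 1) - tau (m - 2) : ℕ) : ℝ) ≤ ((tau m - tau (m - 1) : ℕ) : ℝ) := by
    exact_mod_cast tau_sub_le_tau_sub hm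
  set δm := δ / (2 * (k : ℝ) ^ 2) with hδm
  have hδm0 : 0 < δm := by positivity
  have hδm1 : δm ≤ 1 := by
    rw [hδm, div_le_one (by positivity)]; nlinarith
  set e := ∑ h, (1 - (segAff X 𝓜 M0 Mstar s1 𝒟 (η m) m h (X.est m h ω) ω).toReal) with he
  have he0 : 0 ≤ e := Finset.sum_nonneg fun h _ => by
    have h1 := hX.segAff_le_one hη hMs (by omega) h
      (segStart_lt_of_tau_mul_le (tau_pred_lt (by omega)) hT h)
      (hX.est_mle m (by omega) h (segStart_succ_le hT h) ω).1 ω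
    have := ENNReal.toReal_mono ENNReal.one_ne_top h1
    rw [ENNReal.toReal_one] at this
    linarith
  have h2 : ((tau (m - 1) - tau (m - 2) : ℕ) : ℝ) * e ≤ H * Real.log (𝓜.card / δm) := by
    refine (mul_le_mul_of_nonneg_right hn2 he0).trans (hω.trans ?_)
    have h3 : Real.log (𝓜.card / δm) = Real.log 𝓜.card + Real.log (1 / δm) := by
      rw [← Real.log_mul (by positivity) (by positivity), mul_one_div]
    have h4 : 0 ≤ Real.log (1 / δm) := Real.log_nonneg (by rw [le_div_iff₀ hδm0]; linarith)
    rw [h3, mul_add]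
    nlinarith
  have h5 : epochErr X 𝓜 M0 Mstar s1 𝒟 (η m) m ω = 2 * e := by
    rw [epochErr, he, Finset.mul_sum]
  rw [h5, mleRate, mul_assoc]
  refine mul_le_mul_of_nonneg_left ?_ zero_le_two
  have h6 : (H : ℝ) * (K * Real.log (𝓜.card / δm) / ((tau (m - 1) - tau (m - 2) : ℕ) : ℝ) / K) =
      H * Real.log (𝓜.card / δm) / ((tau (m - 1) - tau (m - 2) : ℕ) : ℝ) := by
    field_simp
  rw [h6, le_div_iff₀ hn1, mul_comm]
  exact h2

/-- On the event that all oracle calls succeed, the averaged error of the estimates decays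
geometrically with the epochs. -/
lemma integral_slack_le
    (hX : IsRun μ ℱ 𝒟 s1 𝓜 Mstar M0
      (fun m => etaParam K δ 𝓜.card H (Fintype.card S) (Fintype.card A) (ν m) m)
      (fun m => zetaParam K δ 𝓜.card H (Fintype.card S) (Fintype.card A) (ν m) m) T X)
    (hMs : Mstar ∈ 𝓜) (hK : 0 < K) (hδ : 0 < δ) (hδ' : δ < 1 / 2) (hH : 1 ≤ H) (hT : 2 ≤ T)
    (hν : ∀ m, 1 ≤ m → m ≤ numEpochs H T → m ≤ ν m ∧ ν m ≤ numEpochs H T) {ω : Ω}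
    (hω : ∀ m ∈ Finset.Ico 2 (numEpochs H T), MLESucceeds X 𝓜 M0 Mstar s1 𝒟
      (etaParam K δ 𝓜.card H (Fintype.card S) (Fintype.card A) (ν m) m)
      (δ / (2 * (ν m : ℝ) ^ 2)) m ω)
    {m : ℕ} (hm : 1 ≤ m) (hmN : m < numEpochs H T) :
    ∫ c, slack X 𝓜 M0 Mstar s1
      (fun m => etaParam K δ 𝓜.card H (Fintype.card S) (Fintype.card A) (ν m) m)
      (fun m => zetaParam K δ 𝓜.card H (Fintype.card S) (Fintype.card A) (ν m) m) m ω c ∂𝒟 ≤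
      slackConst K * regretScale 𝓜.card H (Fintype.card S) (Fintype.card A) T δ *
        Real.sqrt (1 / 2) ^ m := by
  have hD : 1 ≤ 𝓜.card := Finset.card_pos.2 ⟨_, hMs⟩
  have hS : 1 ≤ Fintype.card S := Fintype.card_pos_iff.2 ⟨s1⟩
  have hA : 1 ≤ Fintype.card A := Fintype.card_pos
  have hR := le_two_mul_regretScale (D := 𝓜.card) (S := Fintype.card S) (A := Fintype.card A)
    hD hH hS hA hT hδ hδ'
  have hR0 : 0 ≤ regretScale 𝓜.card H (Fintype.card S) (Fintype.card A) T δ := Real.sqrt_nonneg _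
  have hZ := three_le_slackConst hK
  obtain ⟨hr1, hr2⟩ := sqrt_half_bounds
  induction m, hm using Nat.le_induction with
  | base =>
    simp only [slack, integral_const, probReal_univ, one_smul, pow_one]
    set r := Real.sqrt (1 / 2)
    set R := regretScale 𝓜.card H (Fintype.card S) (Fintype.card A) T δ
    have h1 : 3 * R * (7 / 10) ≤ slackConst K * R * r := by gcongr
    linarith
  | succ m hm ih =>
    have hTm : tau (m + 1) * H ≤ T := (tau_mul_lt_of_lt_numEpochs (by omega) hmN).le
    have hνm := hν (m + 1) (by omega) hmN.le
    have hν1 : 1 ≤ ν (m + 1) := by omega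
    have h1 := ih (by omega)
    have h2 := hX.epochErr_le (fun _ => etaParam_nonneg) hMs hK hδ hδ' hH (by omega) hTm hν1
      (hω (m + 1) (Finset.mem_Ico.2 ⟨by omega, hmN⟩))
    have h3 := add_err_le hK hδ hδ' hD hν1 (show 2 ≤ m + 1 by omega) hH hS hA h2
    have h4 := errScale_le (T := T) hK hδ hδ' hD hν1 (show 2 ≤ m + 1 by omega) hH hS hA hT hνm.2
    rw [hX.integral_slack_succ (fun _ => etaParam_nonneg) hMs hm hTm ω]
    change errScale K δ 𝓜.card H (Fintype.card S) (Fintype.card A) (ν (m + 1)) (m + 1) ≤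
      Real.sqrt (52 * K) * regretScale 𝓜.card H (Fintype.card S) (Fintype.card A) T δ *
      Real.sqrt (1 / 2) ^ (m + 1) at h4
    set r := Real.sqrt (1 / 2)
    set R := regretScale 𝓜.card H (Fintype.card S) (Fintype.card A) T δ
    set a := Real.sqrt (52 * K) with ha
    have ha0 : 0 ≤ a := Real.sqrt_nonneg _
    have hrm : 0 ≤ r ^ m := pow_nonneg (by linarith) m
    have h5 : (270 + 9 / K) * errScale K δ 𝓜.card H (Fintype.card S) (Fintype.card A)
        (ν (m + 1)) (m + 1) ≤ (270 + 9 / K) * (a * R * r ^ (m + 1)) := by gcongr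
    have h6 : 3 * ((270 + 9 / K) * (a * R * r ^ (m + 1))) =
        (slackConst K / 3 - 1) * (R * r ^ m * r) := by
      unfold slackConst; rw [pow_succ]; ring
    have hRr : 0 ≤ R * r ^ m := by positivity
    have h7 : slackConst K * R * r ^ (m + 1) = slackConst K * (R * r ^ m) * r := by
      rw [pow_succ]; ring
    have h8 : slackConst K / 3 * (R * r ^ m) + (slackConst K / 3 - 1) * (R * r ^ m * r) ≤
        slackConst K * (R * r ^ m) * r := by
      -- one third of the previous error plus the new error, as `√(1/2) ≥ 7/10`
      have h9 : 0 ≤ (R * r ^ m) * (slackConst K / 3 * (2 * r - 1) + r) :=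
        mul_nonneg hRr (add_nonneg (mul_nonneg (by linarith) (by linarith)) (by linarith))
      nlinarith
    rw [h7]
    refine le_trans ?_ h8
    rw [← h6]
    linarith

/-- On the event that all oracle calls succeed, the expected regret of the rounds of an epoch is
inversely proportional to the square root of the length of the epoch. -/
lemma roundRegret_le_roundConst
    (hX : IsRun μ ℱ 𝒟 s1 𝓜 Mstar M0
      (fun m => etaParam K δ 𝓜.card H (Fintype.card S) (Fintype.card A) (ν m) m)
      (fun m => zetaParam K δ 𝓜.card H (Fintype.card S) (Fintype.card A) (ν m) m) T X)
    (hMs : Mstar ∈ 𝓜) (hK : 0 < K) (hδ : 0 < δ) (hδ' : δ < 1 / 2) (hH : 1 ≤ H) (hT : 2 ≤ T)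
    (hν : ∀ m, 1 ≤ m → m ≤ numEpochs H T → m ≤ ν m ∧ ν m ≤ numEpochs H T) {ω : Ω}
    (hω : ∀ m ∈ Finset.Ico 2 (numEpochs H T), MLESucceeds X 𝓜 M0 Mstar s1 𝒟
      (etaParam K δ 𝓜.card H (Fintype.card S) (Fintype.card A) (ν m) m)
      (δ / (2 * (ν m : ℝ) ^ 2)) m ω)
    {m : ℕ} (hm : 1 ≤ m) (hmN : m ≤ numEpochs H T) (h : Fin H) (hst : segStart H m h < T) :
    (roundRegret X M0 Mstar s1 𝒟
      (etaParam K δ 𝓜.card H (Fintype.card S) (Fintype.card A) (ν m) m) m h ω).toReal ≤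
      roundConst K * regretScale 𝓜.card H (Fintype.card S) (Fintype.card A) T δ *
        Real.sqrt (1 / 2) ^ m := by
  have hD : 1 ≤ 𝓜.card := Finset.card_pos.2 ⟨_, hMs⟩
  have hS : 1 ≤ Fintype.card S := Fintype.card_pos_iff.2 ⟨s1⟩
  have hA : 1 ≤ Fintype.card A := Fintype.card_pos
  have hR := le_two_mul_regretScale (D := 𝓜.card) (S := Fintype.card S) (A := Fintype.card A)
    hD hH hS hA hT hδ hδ'
  have hR0 : 0 ≤ regretScale 𝓜.card H (Fintype.card S) (Fintype.card A) T δ := Real.sqrt_nonneg _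
  have hZ := three_le_slackConst hK
  obtain ⟨hr1, hr2⟩ := sqrt_half_bounds
  have ha0 : 0 ≤ Real.sqrt (52 * K) := Real.sqrt_nonneg _
  rcases Nat.lt_or_ge m 2 with hm2 | hm2
  · obtain rfl : m = 1 := by omega
    have h1 := ENNReal.toReal_le_of_le_ofReal (Nat.cast_nonneg H)
      (hX.roundRegret_le (fun _ => etaParam_nonneg) hm h hst ω)
    refine h1.trans ?_
    rw [pow_one]
    have h2 : 6 ≤ roundConst K := by unfold roundConst; linarith
    set r := Real.sqrt (1 / 2)
    set R := regretScale 𝓜.card H (Fintype.card S) (Fintype.card A) T δ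
    have h3 : 6 * R * (7 / 10) ≤ roundConst K * R * r := by gcongr
    linarith
  have hνm := hν m hm hmN
  have hν1 : 1 ≤ ν m := by omega
  have h1 := hX.roundRegret_toReal_le (fun _ => etaParam_nonneg) (fun _ => zetaParam_nonneg) hMs
    hm2 (fun j hj hj' => eta_zeta_balance hK hδ hδ' hD
      (by have := (hν j (by omega) (by omega)).1; omega) hj hH hS hA) h hst ω
  have h2 := hX.integral_slack_le hMs hK hδ hδ' hH hT hν hω (show 1 ≤ m - 1 by omega) (by omega)
  have h3 := card_div_etaParam_le hK hδ hδ' hD hν1 hm2 hH hS hA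
  have h4 := errScale_le (T := T) hK hδ hδ' hD hν1 hm2 hH hS hA hT hνm.2
  change errScale K δ 𝓜.card H (Fintype.card S) (Fintype.card A) (ν m) m ≤
    Real.sqrt (52 * K) * regretScale 𝓜.card H (Fintype.card S) (Fintype.card A) T δ *
    Real.sqrt (1 / 2) ^ m at h4
  refine h1.trans ?_
  set r := Real.sqrt (1 / 2)
  set R := regretScale 𝓜.card H (Fintype.card S) (Fintype.card A) T δ
  have h5 : r ^ (m - 1) ≤ 2 * r ^ m := by
    obtain ⟨k, rfl⟩ : ∃ k, m = k + 1 := ⟨m - 1, by omega⟩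
    rw [Nat.add_sub_cancel, pow_succ]
    have : 0 ≤ r ^ k := pow_nonneg (by linarith) k
    nlinarith
  have h6 : slackConst K * R * r ^ (m - 1) ≤ slackConst K * R * (2 * r ^ m) := by gcongr
  have h7 : roundConst K * R * r ^ m = 8640 * (Real.sqrt (52 * K) * R * r ^ m) +
      slackConst K * R * (2 * r ^ m) := by unfold roundConst; ring
  have h8 : ∀ x : ℝ, 4 * ((Fintype.card S : ℝ) * Fintype.card A) / x =
      4 * ((Fintype.card S : ℝ) * Fintype.card A / x) := fun x => by ring
  rw [h7, h8]
  linarith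

/-- All oracle calls succeed with high probability. -/
lemma measure_not_mleSucceeds_le
    (hX : IsRun μ ℱ 𝒟 s1 𝓜 Mstar M0 η ζ T X) (hη : ∀ m, 0 ≤ η m)
    (hMs : Mstar ∈ 𝓜) (hδ : 0 < δ)
    (hν : ∀ m, 1 ≤ m → m ≤ numEpochs H T → m ≤ ν m ∧ ν m ≤ numEpochs H T) :
    μ {ω | ¬ ∀ m ∈ Finset.Ico 2 (numEpochs H T), MLESucceeds X 𝓜 M0 Mstar s1 𝒟 (η m)
      (δ / (2 * (ν m : ℝ) ^ 2)) m ω} ≤ ENNReal.ofReal δ := by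
  have hsub : {ω | ¬ ∀ m ∈ Finset.Ico 2 (numEpochs H T), MLESucceeds X 𝓜 M0 Mstar s1 𝒟 (η m)
      (δ / (2 * (ν m : ℝ) ^ 2)) m ω} ⊆ ⋃ m ∈ Finset.Ico 2 (numEpochs H T),
      {ω | ¬ MLESucceeds X 𝓜 M0 Mstar s1 𝒟 (η m) (δ / (2 * (ν m : ℝ) ^ 2)) m ω} := by
    intro ω hω
    simp only [Set.mem_ofPred_eq, not_forall] at hω
    obtain ⟨m, hm, h1⟩ := hω
    exact Set.mem_biUnion (Finset.mem_coe.2 hm) h1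
  have hle : ∀ m ∈ Finset.Ico 2 (numEpochs H T),
      μ {ω | ¬ MLESucceeds X 𝓜 M0 Mstar s1 𝒟 (η m) (δ / (2 * (ν m : ℝ) ^ 2)) m ω} ≤
        ENNReal.ofReal (δ * (1 / (2 * (m : ℝ) ^ 2))) := by
    intro m hm
    obtain ⟨h2, hN⟩ := Finset.mem_Ico.1 hm
    have hνm := (hν m (by omega) hN.le).1
    have h3 : (m : ℝ) ≤ ν m := by exact_mod_cast hνm
    have h4 : (2 : ℝ) ≤ m := by exact_mod_cast h2
    have h5 : (0 : ℝ) < ν m := by linarith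
    refine (hX.measure_mle_failure_le hη hMs (by omega)
      (tau_mul_lt_of_lt_numEpochs (by omega) hN).le (tau_pred_lt (by omega))
      (δ := δ / (2 * (ν m : ℝ) ^ 2)) (by positivity)).trans (ENNReal.ofReal_le_ofReal ?_)
    rw [mul_one_div]
    gcongr
  calc _ ≤ ∑ m ∈ Finset.Ico 2 (numEpochs H T),
        μ {ω | ¬ MLESucceeds X 𝓜 M0 Mstar s1 𝒟 (η m) (δ / (2 * (ν m : ℝ) ^ 2)) m ω} :=
        (measure_mono hsub).trans (measure_biUnion_finset_le _ _)
    _ ≤ ∑ m ∈ Finset.Ico 2 (numEpochs H T), ENNReal.ofReal (δ * (1 / (2 * (m : ℝ) ^ 2))) :=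
        Finset.sum_le_sum hle
    _ = ENNReal.ofReal (δ * ∑ m ∈ Finset.Ico 2 (numEpochs H T), 1 / (2 * (m : ℝ) ^ 2)) := by
        rw [Finset.mul_sum, ENNReal.ofReal_sum_of_nonneg fun m _ => by positivity]
    _ ≤ ENNReal.ofReal δ := by
        refine ENNReal.ofReal_le_ofReal ?_
        have := mul_le_mul_of_nonneg_left (sum_inv_sq_le (numEpochs H T)) hδ.le
        linarith

/-- The regret of round `t` is of the order `1 / √(t + 1)`, whatever its epoch is, and the rounds
are summed on the event that all oracle calls succeed. -/
theorem measure_regret_le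
    (hX : IsRun μ ℱ 𝒟 s1 𝓜 Mstar M0
      (fun m => etaParam K δ 𝓜.card H (Fintype.card S) (Fintype.card A) (ν m) m)
      (fun m => zetaParam K δ 𝓜.card H (Fintype.card S) (Fintype.card A) (ν m) m) T X)
    (hMs : Mstar ∈ 𝓜) (hK : 0 < K) (hδ : 0 < δ) (hδ' : δ < 1 / 2) (hH : 1 ≤ H) (hT : 2 ≤ T)
    (hν : ∀ m, 1 ≤ m → m ≤ numEpochs H T → m ≤ ν m ∧ ν m ≤ numEpochs H T) :
    ENNReal.ofReal (1 - δ) ≤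
      μ {ω | ∑ t ∈ Finset.range T,
          (μ[fun ω' => regret Mstar s1 (X.ctx t ω') (X.pol t ω') | ℱ t]) ω ≤
        2 * roundConst K * Real.sqrt ((H : ℝ) ^ 7 * (Fintype.card S : ℝ) ^ 4 *
          (Fintype.card A : ℝ) ^ 3 * T * Real.log (𝓜.card * Real.log T / δ))} := by
  have hη : ∀ m, 0 ≤ etaParam K δ 𝓜.card H (Fintype.card S) (Fintype.card A) (ν m) m :=
    fun _ => etaParam_nonneg
  have hfail := hX.measure_not_mleSucceeds_le hη hMs hδ hν
  set good := {ω | ∑ t ∈ Finset.range T,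
          (μ[fun ω' => regret Mstar s1 (X.ctx t ω') (X.pol t ω') | ℱ t]) ω ≤
        2 * roundConst K * Real.sqrt ((H : ℝ) ^ 7 * (Fintype.card S : ℝ) ^ 4 *
          (Fintype.card A : ℝ) ^ 3 * T * Real.log (𝓜.card * Real.log T / δ))} with hgood
  have hcond : ∀ᵐ ω ∂μ, ∀ t ∈ Finset.range T, ∃ m, 1 ≤ m ∧ m ≤ numEpochs H T ∧ ∃ h : Fin H,
      t ∈ segment H m h ∧
      (μ[fun ω' => regret Mstar s1 (X.ctx t ω') (X.pol t ω') | ℱ t]) ω =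
        (roundRegret X M0 Mstar s1 𝒟
          (etaParam K δ 𝓜.card H (Fintype.card S) (Fintype.card A) (ν m) m) m h ω).toReal := by
    refine (ae_ball_iff (Finset.range T).countable_toSet).2 fun t ht => ?_
    obtain ⟨m, hm, hmN, h, hseg⟩ := exists_mem_segment hH (Finset.mem_range.1 ht)
    filter_upwards [hX.condExp_regret hη hm h hseg (Finset.mem_range.1 ht)] with ω hω
    exact ⟨m, hm, hmN, h, hseg, hω⟩
  have hbad : μ goodᶜ ≤ ENNReal.ofReal δ := by
    refine (measure_mono_ae ?_).trans hfail
    filter_upwards [hcond] with ω hω hnot hall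
    refine hnot ?_
    have hR0 : 0 ≤ regretScale 𝓜.card H (Fintype.card S) (Fintype.card A) T δ := Real.sqrt_nonneg _
    have hc0 : 0 ≤ roundConst K := by
      have := three_le_slackConst hK
      have := Real.sqrt_nonneg (52 * K)
      unfold roundConst
      linarith
    have hround : ∀ t ∈ Finset.range T,
        (μ[fun ω' => regret Mstar s1 (X.ctx t ω') (X.pol t ω') | ℱ t]) ω ≤
        roundConst K * regretScale 𝓜.card H (Fintype.card S) (Fintype.card A) T δ *
          Real.sqrt H * (1 / Real.sqrt ((t : ℝ) + 1)) := by
      intro t ht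
      obtain ⟨m, hm, hmN, h, hseg, heq⟩ := hω t ht
      obtain ⟨hs1, hs2⟩ := Finset.mem_Ico.1 hseg
      rw [heq]
      refine (hX.roundRegret_le_roundConst hMs hK hδ hδ' hH hT hν hall hm hmN h
        (hs1.trans_lt (Finset.mem_range.1 ht))).trans ?_
      rw [mul_assoc (_ * _) (Real.sqrt H)]
      refine mul_le_mul_of_nonneg_left ?_ (mul_nonneg hc0 hR0)
      -- a round `t` of epoch `m` satisfies `t < 2 ^ m * H`
      have h1 : t + 1 ≤ 2 ^ m * H := by
        have h2 := segStart_mono H m h.isLt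
        rw [segStart_last, tau_of_pos hm] at h2
        exact hs2.trans_le h2
      have h3 : (t : ℝ) + 1 ≤ 2 ^ m * H := by exact_mod_cast h1
      rw [mul_one_div, ← Real.sqrt_div (Nat.cast_nonneg H)]
      refine Real.le_sqrt_of_sq_le ?_
      rw [← pow_mul, mul_comm m 2, pow_mul, Real.sq_sqrt (by norm_num), one_div, inv_pow,
        le_div_iff₀ (by positivity), inv_mul_le_iff₀ (by positivity)]
      exact h3
    have hsq : regretScale 𝓜.card H (Fintype.card S) (Fintype.card A) T δ * Real.sqrt H *
        Real.sqrt T = Real.sqrt ((H : ℝ) ^ 7 * (Fintype.card S : ℝ) ^ 4 *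
          (Fintype.card A : ℝ) ^ 3 * T * Real.log (𝓜.card * Real.log T / δ)) := by
      rw [regretScale, mul_assoc, ← Real.sqrt_mul (Nat.cast_nonneg H),
        ← Real.sqrt_mul' _ (by positivity)]
      congr 1; ring
    change (_ : ℝ) ≤ _
    calc _ ≤ ∑ t ∈ Finset.range T, roundConst K *
          regretScale 𝓜.card H (Fintype.card S) (Fintype.card A) T δ *
          Real.sqrt H * (1 / Real.sqrt ((t : ℝ) + 1)) := Finset.sum_le_sum hround
      _ = roundConst K * regretScale 𝓜.card H (Fintype.card S) (Fintype.card A) T δ *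
          Real.sqrt H * ∑ t ∈ Finset.range T, 1 / Real.sqrt ((t : ℝ) + 1) := by
          rw [Finset.mul_sum]
      _ ≤ roundConst K * regretScale 𝓜.card H (Fintype.card S) (Fintype.card A) T δ *
          Real.sqrt H * (2 * Real.sqrt T) :=
          mul_le_mul_of_nonneg_left (sum_inv_sqrt_le T) (by positivity)
      _ = 2 * roundConst K * (regretScale 𝓜.card H (Fintype.card S) (Fintype.card A) T δ *
          Real.sqrt H * Real.sqrt T) := by ring
      _ = _ := by rw [hsq]
  have h1 : (1 : ENNReal) ≤ μ good + μ goodᶜ := by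
    rw [← measure_univ (μ := μ), ← Set.union_compl_self good]
    exact measure_union_le _ _
  rw [ENNReal.ofReal_sub _ hδ.le, ENNReal.ofReal_one]
  exact tsub_le_iff_right.2 (h1.trans (by gcongr))

end IsRun

end Regret

end Lolipop

open Lolipop

theorem theorem4p2 (K : ℝ) (hK : 0 < K) :
    ∃ B : ℝ, 0 < B ∧
      ∀ (C S A Ω : Type*) [MeasurableSpace C]
        [Fintype S] [MeasurableSpace S] [MeasurableSingletonClass S]
        [Fintype A] [Nonempty A] [MeasurableSpace A] [MeasurableSingletonClass A]
        [mΩ : MeasurableSpace Ω]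
        (H T : ℕ) (_ : 1 ≤ H) (_ : 2 ≤ T) (δ : ℝ) (_ : 0 < δ) (_ : δ < 1 / 2)
        (s1 : S) (𝒟 : Measure C) [IsProbabilityMeasure 𝒟]
        (𝓜 : Finset (CMDP C S A H)) (Mstar : CMDP C S A H) (_ : Mstar ∈ 𝓜)
        (_ : ∀ᵐ c ∂𝒟, ∀ π : Policy S A H, ∀ᵐ y ∂(trajLaw Mstar s1 c π),
          ∑ h, ((y h).2.2 : ℝ) ≤ 1)
        (M0 : CMDP C S A H) (_ : ∀ h s a c, M0.R h s a c = Measure.dirac 0)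
        (ν : ℕ → ℕ) (_ : ∀ m, 1 ≤ m → m ≤ numEpochs H T → m ≤ ν m ∧ ν m ≤ numEpochs H T)
        (μ : Measure Ω) [IsProbabilityMeasure μ] (ℱ : Filtration ℕ mΩ)
        (X : RunData Ω C S A H)
        (_ : IsRun μ ℱ 𝒟 s1 𝓜 Mstar M0
          (fun m => etaParam K δ 𝓜.card H (Fintype.card S) (Fintype.card A) (ν m) m)
          (fun m => zetaParam K δ 𝓜.card H (Fintype.card S) (Fintype.card A) (ν m) m) T X),
        ENNReal.ofReal (1 - δ) ≤
            μ {ω | ∑ t ∈ Finset.range T,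
                (μ[fun ω' => regret Mstar s1 (X.ctx t ω') (X.pol t ω') | ℱ t]) ω ≤
              B * Real.sqrt ((H : ℝ) ^ 7 * (Fintype.card S : ℝ) ^ 4 * (Fintype.card A : ℝ) ^ 3 * T *
                Real.log (𝓜.card * Real.log T / δ))} ∧
          (oracleCalls H T).Finite ∧
          ((oracleCalls H T).ncard : ℝ) ≤ B * H * Real.log T := by
  have h1 := three_le_slackConst hK
  have h2 : 3 ≤ 2 * roundConst K := by
    have := Real.sqrt_nonneg (52 * K)
    unfold roundConst
    linarith
  refine ⟨2 * roundConst K, by linarith, ?_⟩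
  intro C S A Ω _ _ _ _ _ _ _ _ _ H T hH hT δ hδ hδ' s1 𝒟 _ 𝓜 Mstar hMs _ M0 _ ν hν μ _ ℱ X hX
  obtain ⟨h3, h4⟩ := oracleCalls_finite_and_ncard_le (H := H) hH hT
  refine ⟨hX.measure_regret_le hMs hK hδ hδ' hH hT hν, h3, h4.trans ?_⟩
  have hl : 0 ≤ Real.log T := Real.log_nonneg (by exact_mod_cast (by omega : 1 ≤ T))
  gcongr
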